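/- **Setting.** Let $d\ge 1$, $\alpha\in(0,2)$, and let $\Gamma\subset\mathbb R^d$ be a non-empty open set with $rx\in\Gamma$ for all $x\in\Gamma$ and $r\in\mathbb R\setminus\{0\}$. Let $(\Omega,\mathcal F,\mathbb P)$ be a probability space with a jointly measurable family $\{\tau_x\}_{x\in\mathbb R^d}$ of maps $\Omega\to\Omega$ such that $\tau_0=\mathrm{id}$, $\tau_x\circ\tau_y=\tau_{x+y}$, $\mathbb P(\tau_xA)=\mathbb P(A)$ for all $A\in\mathcal F$ and $x\in\mathbb R^d$, and $\mathbb P(A)\in\{0,1\}$ whenever $A\in\mathcal F$ and $\tau_xA=A$ for all $x$. Let $\mu:\Omega\to[0,\infty)$ be a random variable with $\mathbb E[\mu]=1$ such that, for every $\omega$, $\mu(\tau_x\omega)>0$ for a.e. $x$. Let $\kappa:\mathbb R^d\times\mathbb R^d\times\Omega\to[0,\infty)$ be measurable with $\kappa(x,y;\omega)=\kappa(y,x;\omega)$ and $\kappa(x+z,y+z;\omega)=\kappa(x,y;\tau_z\omega)$ for all $x,y,z,\omega$, and such that, almost surely, $x\mapsto\int(1\wedge|z|^2)\,\kappa(x,x+z;\omega)|z|^{-d-\alpha}\,dz$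 belongs to $L^1_{loc}(\mathbb R^d;dx)$. For $\varepsilon>0$ put $\mu^{\varepsilon,\omega}(dx)=\mu(\tau_{x/\varepsilon}\omega)\,dx$ and $$\mathcal E^{\varepsilon,\omega}(f,g)=\frac12\iint_{x\ne y}(f(x)-f(y))(g(x)-g(y))\frac{\kappa(x/\varepsilon,y/\varepsilon;\omega)}{|x-y|^{d+\alpha}}\mathbf 1_{\{x-y\in\Gamma\}}\,dx\,dy,$$ and let $\mathcal F^{\varepsilon,\omega}$ be the closure of $C_c^1(\mathbb R^d)$ with respect to $(\mathcal E^{\varepsilon,\omega}(\cdot,\cdot)+\|\cdot\|^2_{L^2(\mu^{\varepsilon,\omega})})^{1/2}$. For a bounded measurable even $K\ge 0$ on $\mathbb R^d$, define $(\mathcal E^K,\mathcal F^K)$ on $L^2(\mathbb R^d;dx)$ in the same way, with $\kappa(x/\varepsilon,y/\varepsilon;\omega)$ replaced by $K(x-y)$ and $\mu^{\varepsilon,\omega}$ by $dx$. For $\lambda>0$ and $f\in C_c(\mathbb R^d)$, the resolvent $U_\lambda^{\varepsilon,\omega}f$ is the element of $\mathcal F^{\varepsilon,\omega}$ with $$\lambda\langle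 U_\lambda^{\varepsilon,\omega}f,v\rangle_{L^2(\mu^{\varepsilon,\omega})}+\mathcal E^{\varepsilon,\omega}(U_\lambda^{\varepsilon,\omega}f,v)=\langle f,v\rangle_{L^2(\mu^{\varepsilon,\omega})}\quad\text{for all }v\in\mathcal F^{\varepsilon,\omega},$$ and $U_\lambda^Kf\in\mathcal F^K$ is defined in the same way from $(\mathcal E^K,\mathcal F^K)$ on $L^2(dx)$. **Assumption (H).** There are a measurable even function $K$ on $\mathbb R^d$ and constants $C_1,C_2>0$ with $C_1\le K\le C_2$ such that the following hold for almost every $\omega$. (i) If $f_\varepsilon\in\mathcal F^{\varepsilon,\omega}$ for $\varepsilon\in(0,1]$ and $\limsup_{\varepsilon\to0}\big(\|f_\varepsilon\|_\infty+\mathcal E^{\varepsilon,\omega}(f_\varepsilon,f_\varepsilon)\big)<\infty$, then for every sequence $(\varepsilon_n)\subset(0,1]$ with $\varepsilon_n\to0$ there are a subsequence $(\varepsilon_{n_k})$ and $f_*\in L^1_{loc}(\mathbb R^d)$ such that $f_{\varepsilon_{n_k}}\to f_*$ in $L^1(B(0,r);dx)$ for every $r>1$. (ii) For every $g\in C_c^\infty(\mathbb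 R^d)$, $$\lim_{\eta\to0}\limsup_{\varepsilon\to0}\iint_{0<|x-y|\le\eta}(g(x)-g(y))^2\frac{\kappa(x/\varepsilon,y/\varepsilon;\omega)}{|x-y|^{d+\alpha}}\,dx\,dy=0,$$ and the same holds with the domain of integration replaced by $\{|x-y|\ge1/\eta\}$. (iii) There is $q>1$ such that $\limsup_{\varepsilon\to0}\int_{B(0,R)}\big(\int_{B(0,R)}\kappa(x/\varepsilon,y/\varepsilon;\omega)\,dy\big)^q\,dx<\infty$ for every $R\ge1$. (iv) For every $\eta>0$, every bounded measurable $f$ and every $g\in C_c^\infty(\mathbb R^d)$, as $\varepsilon\to0$, $$\iint_{\{\eta<|x-y|<1/\eta,\;x-y\in\Gamma\}}(f(x)-f(y))(g(x)-g(y))\frac{\kappa(x/\varepsilon,y/\varepsilon;\omega)}{|x-y|^{d+\alpha}}\,dx\,dy$$ converges to the same integral with $\kappa(x/\varepsilon,y/\varepsilon;\omega)$ replaced by $K(x-y)$. **Theorem.** Suppose that (H) holds and that $\mathbb E[\mu^p]<\infty$ for some $p>1$. Then there is a set $\Omega_2\subset\Omega$ of full probability such that for every $\omega\in\Omega_2$,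 every $\lambda>0$ and every $f\in C_c(\mathbb R^d)$, the resolvents $U_\lambda^{\varepsilon,\omega}f$ ($\varepsilon>0$) and $U_\lambda^Kf$ exist and are unique up to Lebesgue-null sets, and, as $\varepsilon\to0$: 1. $U_\lambda^{\varepsilon,\omega}f\to U_\lambda^Kf$ in $L^1(B(0,r);dx)$ for every $r>1$; 2. $\langle U_\lambda^{\varepsilon,\omega}f,g\rangle_{L^2(\mu^{\varepsilon,\omega})}\to\langle U_\lambda^Kf,g\rangle_{L^2(dx)}$ for every $g\in C_c(\mathbb R^d)$; 3. $\mathcal E^{\varepsilon,\omega}(U_\lambda^{\varepsilon,\omega}f,g)\to\mathcal E^K(U_\lambda^Kf,g)$ for every $g\in C_c^\infty(\mathbb R^d)$. -/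

import Mathlib

open MeasureTheory Filter Topology Set
open scoped NNReal ENNReal

namespace StableHomog

noncomputable section

/-- The Euclidean space `ℝ^d`. -/
abbrev Rd (d : ℕ) : Type := EuclideanSpace ℝ (Fin d)

/-- `f ∈ C_c(ℝ^d)`. -/
def IsCc {d : ℕ} (f : Rd d → ℝ) : Prop := Continuous f ∧ HasCompactSupport f

/-- `f ∈ C_c^1(ℝ^d)`. -/
def IsCcOne {d : ℕ} (f : Rd d → ℝ) : Prop := ContDiff ℝ 1 f ∧ HasCompactSupport f

/-- `f ∈ C_c^∞(ℝ^d)`. -/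
def IsCcInfty {d : ℕ} (f : Rd d → ℝ) : Prop := ContDiff ℝ (⊤ : ℕ∞) f ∧ HasCompactSupport f

/-- `f ∈ B_b(ℝ^d)`: bounded and Borel measurable. -/
def IsBb {d : ℕ} (f : Rd d → ℝ) : Prop := Measurable f ∧ ∃ M : ℝ, ∀ x, |f x| ≤ M

/-- An infinite cone, symmetric with respect to the origin, with non-empty interior:
a non-empty open set stable under multiplication by all non-zero reals. -/
structure IsSymmCone {d : ℕ} (Γ : Set (Rd d)) : Prop where
  nonempty : Γ.Nonempty
  isOpen : IsOpen Γ
  smul_mem : ∀ x ∈ Γ, ∀ r : ℝ, r ≠ 0 → r • x ∈ Γ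

/-! ### Symmetric jump forms -/

open Classical in
/-- The jump density `k(x,y) |x-y|^{-(d+α)} 1_{x-y ∈ Γ}` at the pair `q = (x, y)`.
It vanishes on the diagonal, since `a / 0 = 0`, so integrating it over `ℝ^d × ℝ^d` is
integrating over the complement of the diagonal. -/
def jump {d : ℕ} (α : ℝ) (Γ : Set (Rd d)) (k : Rd d → Rd d → ℝ≥0) (q : Rd d × Rd d) : ℝ≥0 :=
  if q.1 - q.2 ∈ Γ then k q.1 q.2 / ‖q.1 - q.2‖₊ ^ ((d : ℝ) + α) else 0

/-- The integral of `(f(x)-f(y))^2` against the jump density over a set `S` of pairs. -/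
def energyOn {d : ℕ} (α : ℝ) (Γ : Set (Rd d)) (k : Rd d → Rd d → ℝ≥0)
    (S : Set (Rd d × Rd d)) (f : Rd d → ℝ) : ℝ≥0∞ :=
  ∫⁻ q in S, ENNReal.ofReal ((f q.1 - f q.2) ^ 2) * (jump α Γ k q : ℝ≥0∞)

/-- The integral of `(f(x)-f(y)) (g(x)-g(y))` against the jump density over a set `S` of pairs. -/
def formOn {d : ℕ} (α : ℝ) (Γ : Set (Rd d)) (k : Rd d → Rd d → ℝ≥0)
    (S : Set (Rd d × Rd d)) (f g : Rd d → ℝ) : ℝ :=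
  ∫ q in S, (f q.1 - f q.2) * (g q.1 - g q.2) * (jump α Γ k q : ℝ)

/-- The energy `E(f,f)`, as an element of `[0,∞]`. -/
def energy {d : ℕ} (α : ℝ) (Γ : Set (Rd d)) (k : Rd d → Rd d → ℝ≥0) (f : Rd d → ℝ) : ℝ≥0∞ :=
  2⁻¹ * energyOn α Γ k univ f

/-- The bilinear form `E(f,g)`. -/
def form {d : ℕ} (α : ℝ) (Γ : Set (Rd d)) (k : Rd d → Rd d → ℝ≥0) (f g : Rd d → ℝ) : ℝ :=
  1 / 2 * formOn α Γ k univ f g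

/-- Membership in the domain of the Dirichlet form on `L²(m)`: the closure of `C_c^1(ℝ^d)` with
respect to the norm `(E(·,·) + ‖·‖²_{L²(m)})^{1/2}`. -/
structure MemDomain {d : ℕ} (α : ℝ) (Γ : Set (Rd d)) (k : Rd d → Rd d → ℝ≥0)
    (m : Measure (Rd d)) (u : Rd d → ℝ) : Prop where
  aestronglyMeasurable : AEStronglyMeasurable u volume
  memLp : MemLp u 2 m
  energy_lt_top : energy α Γ k u < ∞
  approx : ∃ φ : ℕ → Rd d → ℝ, (∀ n, IsCcOne (φ n)) ∧
    Tendsto (fun n => energy α Γ k (u - φ n) + eLpNorm (u - φ n) 2 m ^ 2) atTop (𝓝 0)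

/-- `u` is the `lam`-resolvent of the Dirichlet form on `L²(m)` applied to `f`: `u` belongs to
the domain and `lam ⟨u,v⟩ + E(u,v) = ⟨f,v⟩` for all `v` in the domain. -/
def IsResolvent {d : ℕ} (α : ℝ) (Γ : Set (Rd d)) (k : Rd d → Rd d → ℝ≥0)
    (m : Measure (Rd d)) (lam : ℝ) (f u : Rd d → ℝ) : Prop :=
  MemDomain α Γ k m u ∧ ∀ v : Rd d → ℝ, MemDomain α Γ k m v →
    lam * ∫ x, u x * v x ∂m + form α Γ k u v = ∫ x, f x * v x ∂m

open Classical in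
/-- The `lam`-resolvent of the Dirichlet form on `L²(m)` applied to `f` (a representative of it;
zero if there were none). -/
def resolvent {d : ℕ} (α : ℝ) (Γ : Set (Rd d)) (k : Rd d → Rd d → ℝ≥0)
    (m : Measure (Rd d)) (lam : ℝ) (f : Rd d → ℝ) : Rd d → ℝ :=
  if h : ∃ u, IsResolvent α Γ k m lam f u then h.choose else 0

/-! ### The random environment -/

/-- A stationary and ergodic measurable group of transformations of `(Ω, P)`. -/
structure IsStationaryErgodic {d : ℕ} {Ω : Type*} [MeasurableSpace Ω] (P : Measure Ω)
    (τ : Rd d → Ω → Ω) : Prop where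
  zero : ∀ ω, τ 0 ω = ω
  add : ∀ x y ω, τ x (τ y ω) = τ (x + y) ω
  measurable : Measurable fun q : Rd d × Ω => τ q.1 q.2
  stationary : ∀ x (A : Set Ω), MeasurableSet A → P (τ x '' A) = P A
  ergodic : ∀ A : Set Ω, MeasurableSet A → (∀ x, τ x '' A = A) → P A = 0 ∨ P A = 1

/-- The standing assumptions on the random speed measure density `μ` and the random conductance
`κ`. -/
structure IsEnvironment {d : ℕ} {Ω : Type*} [MeasurableSpace Ω] (P : Measure Ω)
    (τ : Rd d → Ω → Ω) (α : ℝ) (μ : Ω → ℝ≥0) (κ : Rd d → Rd d → Ω → ℝ≥0) : Prop where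
  measurable_mu : Measurable μ
  mu_pos : ∀ ω, ∀ᵐ x : Rd d, 0 < μ (τ x ω)
  mean_mu : ∫⁻ ω, (μ ω : ℝ≥0∞) ∂P = 1
  measurable_kappa : Measurable fun q : Rd d × Rd d × Ω => κ q.1 q.2.1 q.2.2
  symm : ∀ x y ω, κ x y ω = κ y x ω
  shift : ∀ x y z ω, κ (x + z) (y + z) ω = κ x y (τ z ω)
  domain : ∀ᵐ ω ∂P, ∀ R : ℝ, 0 < R →
    ∫⁻ x in Metric.ball (0 : Rd d) R, ∫⁻ z : Rd d,
      ((min 1 (‖z‖₊ ^ 2) : ℝ≥0) : ℝ≥0∞) *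
        (jump α univ (fun x y => κ x y ω) (x, x + z) : ℝ≥0∞) < ∞

/-- The rescaled coefficient `κ(x/ε, y/ε; ω)`. -/
def scaledCoeff {d : ℕ} {Ω : Type*} (κ : Rd d → Rd d → Ω → ℝ≥0) (ε : ℝ) (ω : Ω) :
    Rd d → Rd d → ℝ≥0 :=
  fun x y => κ (ε⁻¹ • x) (ε⁻¹ • y) ω

/-- The rescaled reference measure `μ(τ_{x/ε} ω) dx`. -/
def scaledMeasure {d : ℕ} {Ω : Type*} (τ : Rd d → Ω → Ω) (μ : Ω → ℝ≥0) (ε : ℝ) (ω : Ω) :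
    Measure (Rd d) :=
  volume.withDensity fun x => (μ (τ (ε⁻¹ • x) ω) : ℝ≥0∞)

/-! ### Assumption (H) -/

/-- Precompactness in `L^1_loc` of families with bounded sup norm and energy. -/
def HypCompact {d : ℕ} {Ω : Type*} (τ : Rd d → Ω → Ω) (α : ℝ) (Γ : Set (Rd d))
    (μ : Ω → ℝ≥0) (κ : Rd d → Rd d → Ω → ℝ≥0) (ω : Ω) : Prop :=
  ∀ f : ℝ → Rd d → ℝ,
    (∀ ε ∈ Ioc (0 : ℝ) 1,
      MemDomain α Γ (scaledCoeff κ ε ω) (scaledMeasure τ μ ε ω) (f ε)) →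
    limsup (fun ε : ℝ => eLpNorm (f ε) ∞ volume + energy α Γ (scaledCoeff κ ε ω) (f ε))
      (𝓝[>] 0) < ∞ →
    ∀ e : ℕ → ℝ, (∀ n, e n ∈ Ioc (0 : ℝ) 1) → Tendsto e atTop (𝓝 0) →
      ∃ s : ℕ → ℕ, StrictMono s ∧ ∃ f₀ : Rd d → ℝ, LocallyIntegrable f₀ volume ∧
        ∀ r : ℝ, 1 < r →
          Tendsto (fun n => eLpNorm (f (e (s n)) - f₀) 1 (volume.restrict (Metric.ball 0 r)))
            atTop (𝓝 0)

/-- Small and large jumps are negligible on smooth test functions. -/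
def HypJumps {d : ℕ} {Ω : Type*} (α : ℝ) (κ : Rd d → Rd d → Ω → ℝ≥0) (ω : Ω) : Prop :=
  ∀ g : Rd d → ℝ, IsCcInfty g →
    Tendsto (fun η : ℝ => limsup (fun ε : ℝ =>
      energyOn α univ (scaledCoeff κ ε ω) {q | ‖q.1 - q.2‖ ≤ η} g) (𝓝[>] 0))
      (𝓝[>] 0) (𝓝 0) ∧
    Tendsto (fun η : ℝ => limsup (fun ε : ℝ =>
      energyOn α univ (scaledCoeff κ ε ω) {q | 1 / η ≤ ‖q.1 - q.2‖} g) (𝓝[>] 0))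
      (𝓝[>] 0) (𝓝 0)

/-- A local `L^p` bound on the coefficient for some `p > 1`. -/
def HypMoment {d : ℕ} {Ω : Type*} (κ : Rd d → Rd d → Ω → ℝ≥0) (ω : Ω) : Prop :=
  ∃ p : ℝ, 1 < p ∧ ∀ R : ℝ, 1 ≤ R →
    limsup (fun ε : ℝ => ∫⁻ x in Metric.ball (0 : Rd d) R,
      (∫⁻ y in Metric.ball (0 : Rd d) R, (scaledCoeff κ ε ω x y : ℝ≥0∞)) ^ p) (𝓝[>] 0) < ∞

/-- Convergence of the truncated bilinear forms to the one with coefficient `K(x-y)`. -/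
def HypForms {d : ℕ} {Ω : Type*} (α : ℝ) (Γ : Set (Rd d)) (κ : Rd d → Rd d → Ω → ℝ≥0)
    (K : Rd d → ℝ≥0) (ω : Ω) : Prop :=
  ∀ η : ℝ, 0 < η → ∀ f g : Rd d → ℝ, IsBb f → IsCcInfty g →
    Tendsto (fun ε : ℝ => formOn α Γ (scaledCoeff κ ε ω)
        {q | η < ‖q.1 - q.2‖ ∧ ‖q.1 - q.2‖ < 1 / η} f g)
      (𝓝[>] 0)
      (𝓝 (formOn α Γ (fun x y => K (x - y))
        {q | η < ‖q.1 - q.2‖ ∧ ‖q.1 - q.2‖ < 1 / η} f g))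

/-- Assumption (H): the four conditions above hold almost surely, with limiting coefficient `K`. -/
structure AssumptionH {d : ℕ} {Ω : Type*} [MeasurableSpace Ω] (P : Measure Ω)
    (τ : Rd d → Ω → Ω) (α : ℝ) (Γ : Set (Rd d)) (μ : Ω → ℝ≥0) (κ : Rd d → Rd d → Ω → ℝ≥0)
    (K : Rd d → ℝ≥0) : Prop where
  measurable_K : Measurable K
  even_K : ∀ z, K (-z) = K z
  bounds_K : ∃ C₁ C₂ : ℝ≥0, 0 < C₁ ∧ ∀ z, C₁ ≤ K z ∧ K z ≤ C₂
  compact : ∀ᵐ ω ∂P, HypCompact τ α Γ μ κ ω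
  jumps : ∀ᵐ ω ∂P, HypJumps α κ ω
  moment : ∀ᵐ ω ∂P, HypMoment κ ω
  forms : ∀ᵐ ω ∂P, HypForms α Γ κ K ω

/-- The resolvent `U_λ^{ε,ω} f` of the rescaled form on `L²(μ(τ_{x/ε} ω) dx)`. -/
def Ueps {d : ℕ} {Ω : Type*} (τ : Rd d → Ω → Ω) (α : ℝ) (Γ : Set (Rd d)) (μ : Ω → ℝ≥0)
    (κ : Rd d → Rd d → Ω → ℝ≥0) (lam : ℝ) (ε : ℝ) (ω : Ω) (f : Rd d → ℝ) : Rd d → ℝ :=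
  resolvent α Γ (scaledCoeff κ ε ω) (scaledMeasure τ μ ε ω) lam f

/-- The resolvent `U_λ^K f` of the form with coefficient `K(x-y)` on `L²(dx)`. -/
def UK {d : ℕ} (α : ℝ) (Γ : Set (Rd d)) (K : Rd d → ℝ≥0) (lam : ℝ) (f : Rd d → ℝ) : Rd d → ℝ :=
  resolvent α Γ (fun x y => K (x - y)) volume lam f

end

end StableHomog

namespace StableHomog

noncomputable section

section

variable {d : ℕ}

/-! ### Square-integrable functions -/

section L2

variable {X : Type*} [MeasurableSpace X] {ν : Measure X}

/-! The scheme is a priori bounds, compactness, identification of the limit, uniqueness, for one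
fixed typical environment ω. If |f| ≤ M, the maximum principle (`FormClosure.le_of_le`) gives |U^ε
f| ≤ M/λ. Testing the equation with the solution itself bounds its energy by ∫ f U^ε f dμ^ε, hence
uniformly in ε ∈ (0,1], because the local masses of μ^ε are bounded. `HypCompact` then yields L¹_loc
limit points; once each of them is shown to be U^K f, the whole family converges.

To identify a limit point u, the equation is tested with a smooth g. In ∫ U^ε f g dμ^ε the solution
may be replaced by u: the difference is bounded and tends to zero in L¹_loc, hence in every finite
L^s_loc, while the density of μ^ε is bounded in L^p_loc by E[μ^p] < ∞ and the maximal inequality.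
The ergodic theorem then treats ∫ u g dμ^ε. In the form, the pairs with η < |x-y| < 1/η are handled
in the same way, with `HypMoment` in place of the L^p bound and `HypForms` in place of the ergodic
theorem. The other pairs contribute little, uniformly in small ε, by Cauchy–Schwarz, the energy
bound and `HypJumps`.

The inequality 2ab ≤ a² + b² passes to the limit and shows that u is square integrable with finite
energy. Whether u lies in the closure of C_c^1 is never asked. A bounded function in L² of finite
energy that solves the homogeneous equation against C_c^∞ vanishes
(`ae_eq_zero_of_forall_isCcInfty`), since cut-off and mollification, neither of which spoils the
energy bound, make the function itself admissible as a test function.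

The weight u g is not known in advance, so the ergodic theorem must hold off a single null set for
all bounded weights of bounded support. It is proved by Banach's principle: a weak type (1,1)
maximal inequality, transferred from Vitali's covering lemma, and a dense class in L² made of
constants and coboundaries, for which convergence holds for every weight. -/

theorem integral_mul_eq_inner {f g : X → ℝ} (hf : MemLp f 2 ν) (hg : MemLp g 2 ν) :
    ∫ x, f x * g x ∂ν = inner ℝ (hf.toLp f) (hg.toLp g) := by
  rw [L2.inner_def]
  refine integral_congr_ae ?_
  filter_upwards [hf.coeFn_toLp, hg.coeFn_toLp] with x h1 h2
  simp [h1, h2, mul_comm]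

theorem abs_integral_mul_le {f g : X → ℝ} (hf : MemLp f 2 ν) (hg : MemLp g 2 ν) :
    |∫ x, f x * g x ∂ν| ≤ (eLpNorm f 2 ν).toReal * (eLpNorm g 2 ν).toReal := by
  rw [integral_mul_eq_inner hf hg, ← Lp.norm_toLp f hf, ← Lp.norm_toLp g hg]
  exact abs_real_inner_le_norm _ _

theorem integrable_mul_of_memLp_two {f g : X → ℝ} (hf : MemLp f 2 ν) (hg : MemLp g 2 ν) :
    Integrable (fun x => f x * g x) ν := hf.integrable_mul hg

theorem tendsto_integral_mul_of_L2 {ι : Type*} {l : Filter ι} {f g : ι → X → ℝ} {f' g' : X → ℝ}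
    (hf : ∀ i, MemLp (f i) 2 ν) (hf' : MemLp f' 2 ν)
    (hg : ∀ i, MemLp (g i) 2 ν) (hg' : MemLp g' 2 ν)
    (hff : Tendsto (fun i => eLpNorm (f i - f') 2 ν) l (𝓝 0))
    (hgg : Tendsto (fun i => eLpNorm (g i - g') 2 ν) l (𝓝 0)) :
    Tendsto (fun i => ∫ x, f i x * g i x ∂ν) l (𝓝 (∫ x, f' x * g' x ∂ν)) := by
  simp_rw [fun i => integral_mul_eq_inner (hf i) (hg i), integral_mul_eq_inner hf' hg']
  exact ((Lp.tendsto_Lp_iff_tendsto_eLpNorm'' f hf f' hf').2 hff).inner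
    ((Lp.tendsto_Lp_iff_tendsto_eLpNorm'' g hg g' hg').2 hgg)

theorem eLpNorm_two_sq (f : X → ℝ) : eLpNorm f 2 ν ^ 2 = ∫⁻ x, ENNReal.ofReal (f x ^ 2) ∂ν := by
  have := eLpNorm_nnreal_pow_eq_lintegral (f := f) (μ := ν) (p := 2) two_ne_zero
  have h2 : ((2 : ℝ≥0) : ℝ≥0∞) = 2 := by norm_num
  rw [h2] at this
  simp only [NNReal.coe_ofNat, ENNReal.rpow_ofNat] at this
  rw [this]
  refine lintegral_congr fun x => ?_
  rw [← enorm_pow, Real.enorm_eq_ofReal (sq_nonneg _)]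

theorem toReal_eLpNorm_two_sq (f : X → ℝ) (hf : AEStronglyMeasurable f ν) :
    (eLpNorm f 2 ν ^ 2).toReal = ∫ x, f x ^ 2 ∂ν := by
  rw [eLpNorm_two_sq, integral_eq_lintegral_of_nonneg_ae (ae_of_all _ fun x => sq_nonneg _)
    (hf.pow 2)]

theorem tendsto_sq_iff {ι : Type*} {l : Filter ι} {a : ι → ℝ≥0∞} :
    Tendsto (fun i => a i ^ 2) l (𝓝 0) ↔ Tendsto a l (𝓝 0) := by
  constructor
  · intro h
    have := (ENNReal.continuous_rpow_const (y := 1 / 2)).continuousAt.tendsto.comp h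
    simp only [one_div, inv_pos, Nat.ofNat_pos, ENNReal.zero_rpow_of_pos] at this
    refine this.congr fun i => ?_
    simp only [Function.comp]
    rw [← ENNReal.rpow_natCast, ← ENNReal.rpow_mul]
    norm_num
  · intro h
    simpa [Function.comp_def] using ((ENNReal.continuous_pow 2).tendsto 0).comp h

end L2

/-! ### The increment of a function and the jump measure -/

/-- The increment `(x, y) ↦ u(x) - u(y)`. -/
def inc (u : Rd d → ℝ) : Rd d × Rd d → ℝ := fun q => u q.1 - u q.2

theorem inc_sub (u v : Rd d → ℝ) : inc (u - v) = inc u - inc v := by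
  ext q; simp only [inc, Pi.sub_apply]; ring

theorem inc_add (u v : Rd d → ℝ) : inc (u + v) = inc u + inc v := by
  ext q; simp only [inc, Pi.add_apply]; ring

theorem inc_smul (c : ℝ) (u : Rd d → ℝ) : inc (c • u) = c • inc u := by
  ext q; simp only [inc, Pi.smul_apply, smul_eq_mul]; ring

theorem ae_prod_of_ae {u : Rd d → Prop} (h : ∀ᵐ x, u x) :
    ∀ᵐ q : Rd d × Rd d, u q.1 ∧ u q.2 := by
  have h1 : ∀ᵐ q : Rd d × Rd d, u q.1 :=
    (Measure.quasiMeasurePreserving_fst (μ := volume) (ν := (volume : Measure (Rd d)))).ae h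
  have h2 : ∀ᵐ q : Rd d × Rd d, u q.2 :=
    (Measure.quasiMeasurePreserving_snd (μ := (volume : Measure (Rd d))) (ν := volume)).ae h
  exact h1.and h2

theorem inc_ae_eq {u v : Rd d → ℝ} (h : u =ᵐ[volume] v) : inc u =ᵐ[volume] inc v := by
  filter_upwards [ae_prod_of_ae h] with q hq
  simp only [inc, hq.1, hq.2]

theorem aestronglyMeasurable_inc {u : Rd d → ℝ} (hu : AEStronglyMeasurable u volume) :
    AEStronglyMeasurable (inc u) volume :=
  (hu.comp_fst (ν := volume)).sub (hu.comp_snd (μ := volume))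

/-! ### The closure of `C_c^1` -/

/-- `u` belongs to the closure of `C_c^1` for the norm of `L²(m)` and that of the increments
in `L²(J)`. -/
structure FormClosure (m : Measure (Rd d)) (J : Measure (Rd d × Rd d)) (u : Rd d → ℝ) :
    Prop where
  aesm : AEStronglyMeasurable u volume
  memLp : MemLp u 2 m
  memLp_inc : MemLp (inc u) 2 J
  approx : ∃ φ : ℕ → Rd d → ℝ, (∀ n, IsCcOne (φ n)) ∧ (∀ n, MemLp (φ n) 2 m) ∧
    (∀ n, MemLp (inc (φ n)) 2 J) ∧
    Tendsto (fun n => eLpNorm (φ n - u) 2 m) atTop (𝓝 0) ∧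
    Tendsto (fun n => eLpNorm (inc (φ n) - inc u) 2 J) atTop (𝓝 0)

variable {m : Measure (Rd d)} {J : Measure (Rd d × Rd d)}

theorem FormClosure.of_isCcOne {φ : Rd d → ℝ} (h : IsCcOne φ) (h1 : MemLp φ 2 m)
    (h2 : MemLp (inc φ) 2 J) : FormClosure m J φ :=
  ⟨h.1.continuous.aestronglyMeasurable, h1, h2, fun _ => φ, fun _ => h, fun _ => h1, fun _ => h2,
    by simp, by simp⟩

theorem FormClosure.sub {u v : Rd d → ℝ} (hu : FormClosure m J u) (hv : FormClosure m J v) :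
    FormClosure m J (u - v) := by
  obtain ⟨φ, a1, a2, a3, a4, a5⟩ := hu.approx
  obtain ⟨ψ, b1, b2, b3, b4, b5⟩ := hv.approx
  refine ⟨hu.aesm.sub hv.aesm, hu.memLp.sub hv.memLp, ?_, fun n => φ n - ψ n,
    fun n => ⟨(a1 n).1.sub (b1 n).1, ?_⟩, fun n => (a2 n).sub (b2 n), fun n => ?_, ?_, ?_⟩
  · rw [inc_sub]; exact hu.memLp_inc.sub hv.memLp_inc
  · simpa [sub_eq_add_neg] using (a1 n).2.add (b1 n).2.neg
  · rw [inc_sub]; exact (a3 n).sub (b3 n)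
  · refine tendsto_of_tendsto_of_tendsto_of_le_of_le tendsto_const_nhds
      (by simpa using a4.add b4) (fun _ => zero_le) fun n => ?_
    have : φ n - ψ n - (u - v) = (φ n - u) - (ψ n - v) := by abel
    simp only [this]
    exact eLpNorm_sub_le ((a2 n).sub hu.memLp).1 ((b2 n).sub hv.memLp).1 (by norm_num)
  · refine tendsto_of_tendsto_of_tendsto_of_le_of_le tendsto_const_nhds
      (by simpa using a5.add b5) (fun _ => zero_le) fun n => ?_
    have : inc (φ n - ψ n) - inc (u - v) = (inc (φ n) - inc u) - (inc (ψ n) - inc v) := by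
      simp only [inc_sub]; abel
    simp only [this]
    exact eLpNorm_sub_le ((a3 n).sub hu.memLp_inc).1 ((b3 n).sub hv.memLp_inc).1 (by norm_num)

/-- Solvability of the variational equation in the closure of `C_c^1`. -/
theorem exists_formClosure_solution (hm' : volume ≪ m) (hJ : J ≪ volume)
    {F : Rd d → ℝ} (hF : MemLp F 2 m) :
    ∃ u, FormClosure m J u ∧ ∀ v, FormClosure m J v →
      ∫ x, u x * v x ∂m + ∫ q, inc u q * inc v q ∂J = ∫ x, F x * v x ∂m := by
  let H := WithLp 2 (Lp ℝ 2 m × Lp ℝ 2 J)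
  let V : Submodule ℝ H :=
    { carrier := {x | ∃ φ, IsCcOne φ ∧ x.fst =ᵐ[m] φ ∧ x.snd =ᵐ[J] inc φ}
      zero_mem' := by
        refine ⟨0, ⟨contDiff_const, HasCompactSupport.zero⟩, Lp.coeFn_zero _ _ _, ?_⟩
        filter_upwards [Lp.coeFn_zero ℝ 2 J] with q hq
        simpa [inc] using hq
      add_mem' := by
        rintro x y ⟨φ, h1, h2, h3⟩ ⟨ψ, k1, k2, k3⟩
        refine ⟨φ + ψ, ⟨h1.1.add k1.1, h1.2.add k1.2⟩, ?_, ?_⟩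
        · exact (Lp.coeFn_add _ _).trans (h2.add k2)
        · rw [inc_add]; exact (Lp.coeFn_add _ _).trans (h3.add k3)
      smul_mem' := by
        rintro c x ⟨φ, h1, h2, h3⟩
        refine ⟨c • φ, ⟨h1.1.const_smul c, h1.2.smul_left (f := fun _ => c)⟩, ?_, ?_⟩
        · exact (Lp.coeFn_smul _ _).trans (h2.const_smul c)
        · rw [inc_smul]; exact (Lp.coeFn_smul _ _).trans (h3.const_smul c) }
  let W := V.topologicalClosure
  have hWc : IsClosed (W : Set H) := V.isClosed_topologicalClosure
  have : CompleteSpace W := hWc.completeSpace_coe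
  -- elements of the closure are graphs
  have hgraph : ∀ w ∈ W, ∃ u, FormClosure m J u ∧ w.fst =ᵐ[m] u ∧ w.snd =ᵐ[J] inc u := by
    intro w hw
    obtain ⟨x, hx, hxw⟩ := mem_closure_iff_seq_limit.1 (show w ∈ closure (V : Set H) from hw)
    choose φ hφ h1 h2 using hx
    have c1 : Tendsto (fun n => (x n).fst) atTop (𝓝 w.fst) :=
      ((WithLp.continuous_fst (p := 2) ..).tendsto w).comp hxw
    have c2 : Tendsto (fun n => (x n).snd) atTop (𝓝 w.snd) :=
      ((WithLp.continuous_snd (p := 2) ..).tendsto w).comp hxw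
    rw [Lp.tendsto_Lp_iff_tendsto_eLpNorm'] at c1 c2
    have p1 : ∀ n, MemLp (φ n) 2 m := fun n => (Lp.memLp (x n).fst).ae_eq (h1 n)
    have p2 : ∀ n, MemLp (inc (φ n)) 2 J := fun n => (Lp.memLp (x n).snd).ae_eq (h2 n)
    have c1' : Tendsto (fun n => eLpNorm (φ n - (w.fst : Rd d → ℝ)) 2 m) atTop (𝓝 0) :=
      c1.congr fun n => eLpNorm_congr_ae ((h1 n).sub (ae_eq_refl _))
    have c2' : Tendsto (fun n => eLpNorm (inc (φ n) - (w.snd : Rd d × Rd d → ℝ)) 2 J) atTop (𝓝 0) :=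
      c2.congr fun n => eLpNorm_congr_ae ((h2 n).sub (ae_eq_refl _))
    obtain ⟨s, hs, hs'⟩ := (tendstoInMeasure_of_tendsto_eLpNorm (by norm_num)
      (fun n => (p1 n).1) (Lp.memLp w.fst).1 c1').exists_seq_tendsto_ae
    obtain ⟨t, ht, ht'⟩ := (tendstoInMeasure_of_tendsto_eLpNorm (by norm_num)
      (fun n => (p2 (s n)).1) (Lp.memLp w.snd).1 (c2'.comp hs.tendsto_atTop)).exists_seq_tendsto_ae
    -- Along one subsequence both components converge almost everywhere. `hm'` turns m-a.e.
    -- convergence into Lebesgue-a.e. convergence, hence convergence at both entries of almost every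
    -- pair, and `hJ` carries this over to J.
    have e : w.snd =ᵐ[J] inc (w.fst : Rd d → ℝ) := by
      filter_upwards [hJ.ae_le (ae_prod_of_ae (hm'.ae_le hs')), ht'] with q hq hq'
      refine tendsto_nhds_unique hq' ?_
      have := (hq.1.sub hq.2).comp ht.tendsto_atTop
      exact this
    refine ⟨w.fst, ⟨(Lp.stronglyMeasurable w.fst).aestronglyMeasurable, Lp.memLp _,
      (Lp.memLp w.snd).ae_eq e, φ, hφ, p1, p2, c1', ?_⟩, ae_eq_refl _, e⟩
    exact c2'.congr fun n => eLpNorm_congr_ae ((ae_eq_refl _).sub e)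
  have hmem : ∀ v (hv : FormClosure m J v),
      WithLp.toLp 2 (hv.memLp.toLp v, hv.memLp_inc.toLp (inc v)) ∈ W := by
    intro v hv
    obtain ⟨φ, a1, a2, a3, a4, a5⟩ := hv.approx
    refine mem_closure_of_tendsto (f := fun n =>
      WithLp.toLp 2 ((a2 n).toLp (φ n), (a3 n).toLp (inc (φ n)))) (b := atTop) ?_
      (Eventually.of_forall fun n => ⟨φ n, a1 n, (a2 n).coeFn_toLp, (a3 n).coeFn_toLp⟩)
    refine ((WithLp.prod_continuous_toLp 2 _ _).tendsto _).comp ?_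
    exact ((Lp.tendsto_Lp_iff_tendsto_eLpNorm'' φ a2 v hv.memLp).2 a4).prodMk_nhds
      ((Lp.tendsto_Lp_iff_tendsto_eLpNorm'' _ a3 _ hv.memLp_inc).2 a5)
  -- The solution is the orthogonal projection of (F, 0) onto the closed space of pairs (v, inc v):
  -- orthogonality of the residual to each such pair is the variational equation.
  let b : H := WithLp.toLp 2 (hF.toLp F, 0)
  obtain ⟨u, hu, hu1, hu2⟩ := hgraph (W.starProjection b) (W.starProjection_apply_mem b)
  refine ⟨u, hu, fun v hv => ?_⟩
  have := W.starProjection_inner_eq_zero b _ (hmem v hv)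
  rw [inner_sub_left, sub_eq_zero, WithLp.prod_inner_apply, WithLp.prod_inner_apply] at this
  have e1 : (W.starProjection b).fst = hu.memLp.toLp u :=
    Lp.ext (hu1.trans hu.memLp.coeFn_toLp.symm)
  have e2 : (W.starProjection b).snd = hu.memLp_inc.toLp (inc u) :=
    Lp.ext (hu2.trans hu.memLp_inc.coeFn_toLp.symm)
  rw [integral_mul_eq_inner hu.memLp hv.memLp, integral_mul_eq_inner hu.memLp_inc hv.memLp_inc,
    integral_mul_eq_inner hF hv.memLp, ← e1, ← e2]
  simpa [b] using this.symm

theorem ae_eq_zero_of_integral_sq_add {u : Rd d → ℝ} (hu : MemLp u 2 m)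
    (h : ∫ x, u x * u x ∂m + ∫ q, inc u q * inc u q ∂J ≤ 0) : u =ᵐ[m] 0 := by
  have h1 : 0 ≤ ∫ q, inc u q * inc u q ∂J := integral_nonneg fun q => mul_self_nonneg _
  have h2 : ∫ x, u x * u x ∂m = 0 :=
    le_antisymm (by linarith) (integral_nonneg fun q => mul_self_nonneg _)
  rw [integral_eq_zero_iff_of_nonneg (fun q => mul_self_nonneg _)
    (integrable_mul_of_memLp_two hu hu)] at h2
  filter_upwards [h2] with x hx
  simpa using hx

theorem formClosure_solution_unique {F u v : Rd d → ℝ} (hu : FormClosure m J u)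
    (hv : FormClosure m J v)
    (hu' : ∀ w, FormClosure m J w →
      ∫ x, u x * w x ∂m + ∫ q, inc u q * inc w q ∂J = ∫ x, F x * w x ∂m)
    (hv' : ∀ w, FormClosure m J w →
      ∫ x, v x * w x ∂m + ∫ q, inc v q * inc w q ∂J = ∫ x, F x * w x ∂m) : u =ᵐ[m] v := by
  have hw := hu.sub hv
  have h0 : u - v =ᵐ[m] 0 := by
    refine ae_eq_zero_of_integral_sq_add (J := J) hw.memLp (le_of_eq ?_)
    have e1 := hu' _ hw
    have e2 := hv' _ hw
    have i1 : ∫ x, (u - v) x * (u - v) x ∂m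
        = ∫ x, u x * (u - v) x ∂m - ∫ x, v x * (u - v) x ∂m := by
      rw [← integral_sub (integrable_mul_of_memLp_two hu.memLp hw.memLp)
        (integrable_mul_of_memLp_two hv.memLp hw.memLp)]
      refine integral_congr_ae (ae_of_all _ fun x => ?_)
      simp only [Pi.sub_apply]; ring
    have i2 : ∫ q, inc (u - v) q * inc (u - v) q ∂J
        = ∫ q, inc u q * inc (u - v) q ∂J - ∫ q, inc v q * inc (u - v) q ∂J := by
      rw [← integral_sub (integrable_mul_of_memLp_two hu.memLp_inc hw.memLp_inc)
        (integrable_mul_of_memLp_two hv.memLp_inc hw.memLp_inc)]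
      refine integral_congr_ae (ae_of_all _ fun x => ?_)
      simp only [inc, Pi.sub_apply]; ring
    rw [i1, i2]; linarith
  filter_upwards [h0] with x hx
  simpa [sub_eq_zero] using hx

/-! ### The maximum principle -/

/-- A `C^1` nondecreasing function vanishing on `(-∞, 0]` and positive on `(0, ∞)`. -/
def softPos (t : ℝ) : ℝ := ∫ s in (0 : ℝ)..t, min 1 (max 0 s)

theorem continuous_clampUnit : Continuous fun s : ℝ => min (1 : ℝ) (max 0 s) := by fun_prop

theorem hasDerivAt_softPos (t : ℝ) : HasDerivAt softPos (min 1 (max 0 t)) t :=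
  intervalIntegral.integral_hasDerivAt_right (continuous_clampUnit.intervalIntegrable _ _)
    (continuous_clampUnit.stronglyMeasurableAtFilter _ _) continuous_clampUnit.continuousAt

theorem deriv_softPos : deriv softPos = fun t => min 1 (max 0 t) :=
  funext fun t => (hasDerivAt_softPos t).deriv

theorem contDiff_softPos : ContDiff ℝ 1 softPos := by
  rw [contDiff_one_iff_deriv, deriv_softPos]
  exact ⟨fun t => (hasDerivAt_softPos t).differentiableAt, continuous_clampUnit⟩

theorem lipschitzWith_softPos : LipschitzWith 1 softPos := by
  refine lipschitzWith_of_nnnorm_deriv_le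
    (fun t => (hasDerivAt_softPos t).differentiableAt) fun t => ?_
  rw [deriv_softPos, ← NNReal.coe_le_coe, coe_nnnorm, Real.norm_eq_abs, abs_le]
  constructor
  · have : (0 : ℝ) ≤ min 1 (max 0 t) := le_min zero_le_one (le_max_left _ _)
    simp only [NNReal.coe_one]; linarith
  · exact min_le_left _ _

theorem monotone_softPos : Monotone softPos :=
  monotone_of_deriv_nonneg (fun t => (hasDerivAt_softPos t).differentiableAt) fun t => by
    rw [deriv_softPos]; exact le_min zero_le_one (le_max_left _ _)

theorem softPos_of_nonpos {t : ℝ} (ht : t ≤ 0) : softPos t = 0 := by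
  unfold softPos
  rw [intervalIntegral.integral_congr (g := fun _ => (0 : ℝ)), intervalIntegral.integral_zero]
  intro s hs
  rw [uIcc_of_ge ht] at hs
  simp [max_eq_left hs.2]

theorem softPos_pos {t : ℝ} (ht : 0 < t) : 0 < softPos t := by
  refine intervalIntegral.intervalIntegral_pos_of_pos_on
    (continuous_clampUnit.intervalIntegrable _ _) (fun s hs => ?_) ht
  exact lt_min one_pos (lt_max_of_lt_right hs.1)

theorem abs_softPos_sub_le (s t : ℝ) : |softPos s - softPos t| ≤ |s - t| := by
  simpa [Real.dist_eq] using lipschitzWith_softPos.dist_le_mul s t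

/-- The maximum principle for the variational equation. -/
theorem FormClosure.le_of_le {u F : Rd d → ℝ} (hu : FormClosure m J u) (hF : MemLp F 2 m)
    (hu' : ∀ v, FormClosure m J v →
      ∫ x, u x * v x ∂m + ∫ q, inc u q * inc v q ∂J = ∫ x, F x * v x ∂m)
    {C : ℝ} (hC : 0 ≤ C) (hFC : ∀ x, F x ≤ C) : ∀ᵐ x ∂m, u x ≤ C := by
  obtain ⟨φ, a1, a2, a3, a4, a5⟩ := hu.approx
  -- S is C^1 and 1-Lipschitz, and S 0 = 0 because C ≥ 0. Hence S ∘ φ n is again in C_c^1 with no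
  -- larger increments. Testing with it, and not with S ∘ u, avoids proving that S ∘ u is in the
  -- domain.
  let S : ℝ → ℝ := fun s => softPos (s - C)
  have S0 : S 0 = 0 := softPos_of_nonpos (by linarith)
  have Slip : ∀ s t, |S s - S t| ≤ |s - t| := fun s t => by
    simpa [S] using abs_softPos_sub_le (s - C) (t - C)
  have Scont : Continuous S := by
    have := lipschitzWith_softPos.continuous
    fun_prop
  have Sabs : ∀ s, |S s| ≤ |s| := fun s => by simpa [S0] using Slip s 0
  have Scd : ContDiff ℝ 1 S := contDiff_softPos.comp (contDiff_id.sub contDiff_const)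
  have hS : ∀ n, IsCcOne (S ∘ φ n) := fun n => ⟨Scd.comp (a1 n).1, (a1 n).2.comp_left S0⟩
  have hSm : ∀ n, MemLp (S ∘ φ n) 2 m := fun n =>
    (a2 n).mono (Scont.comp_aestronglyMeasurable (a2 n).1) (ae_of_all _ fun x => Sabs _)
  have hSu : MemLp (S ∘ u) 2 m :=
    hu.memLp.mono (Scont.comp_aestronglyMeasurable hu.memLp.1) (ae_of_all _ fun x => Sabs _)
  have hSi : ∀ n, MemLp (inc (S ∘ φ n)) 2 J := by
    intro n
    refine (a3 n).mono ?_ (ae_of_all _ fun q => Slip _ _)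
    have : Continuous (inc (S ∘ φ n)) := by
      have := (a1 n).1.continuous
      unfold inc; fun_prop
    exact this.aestronglyMeasurable
  have hconv : Tendsto (fun n => eLpNorm (S ∘ φ n - S ∘ u) 2 m) atTop (𝓝 0) := by
    refine tendsto_of_tendsto_of_tendsto_of_le_of_le tendsto_const_nhds a4
      (fun _ => zero_le) fun n => eLpNorm_mono fun x => ?_
    exact Slip _ _
  have hFu : MemLp (F - u) 2 m := hF.sub hu.memLp
  have hlim : Tendsto (fun n => ∫ x, (F - u) x * (S ∘ φ n) x ∂m) atTop
      (𝓝 (∫ x, (F - u) x * (S ∘ u) x ∂m)) :=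
    tendsto_integral_mul_of_L2 (fun _ => hFu) hFu hSm hSu (by simp) hconv
  -- By monotonicity of S, ∫ inc (φ n) · inc (S ∘ φ n) ≥ 0. Replacing inc (φ n) by inc u costs at
  -- most the product on the left, which tends to zero.
  have hlow : ∀ n, -((eLpNorm (inc (φ n) - inc u) 2 J).toReal *
      ((eLpNorm (inc (φ n) - inc u) 2 J).toReal + (eLpNorm (inc u) 2 J).toReal))
      ≤ ∫ x, (F - u) x * (S ∘ φ n) x ∂m := by
    intro n
    have e := hu' _ (FormClosure.of_isCcOne (hS n) (hSm n) (hSi n))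
    have e1 : ∫ x, (F - u) x * (S ∘ φ n) x ∂m = ∫ q, inc u q * inc (S ∘ φ n) q ∂J := by
      have : ∫ x, (F - u) x * (S ∘ φ n) x ∂m
          = ∫ x, F x * (S ∘ φ n) x ∂m - ∫ x, u x * (S ∘ φ n) x ∂m := by
        rw [← integral_sub (integrable_mul_of_memLp_two hF (hSm n))
          (integrable_mul_of_memLp_two hu.memLp (hSm n))]
        refine integral_congr_ae (ae_of_all _ fun x => ?_)
        simp only [Pi.sub_apply]; ring
      rw [this]; linarith
    have hd := (a3 n).sub hu.memLp_inc
    have e2 : ∫ q, inc u q * inc (S ∘ φ n) q ∂J = ∫ q, inc (φ n) q * inc (S ∘ φ n) q ∂J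
        - ∫ q, (inc (φ n) - inc u) q * inc (S ∘ φ n) q ∂J := by
      rw [← integral_sub (integrable_mul_of_memLp_two (a3 n) (hSi n))
          (integrable_mul_of_memLp_two hd (hSi n))]
      refine integral_congr_ae (ae_of_all _ fun x => ?_)
      simp only [Pi.sub_apply]; ring
    have e3 : 0 ≤ ∫ q, inc (φ n) q * inc (S ∘ φ n) q ∂J := by
      refine integral_nonneg fun q => ?_
      simp only [inc, Function.comp, S, Pi.zero_apply]
      rcases le_total (φ n q.1) (φ n q.2) with h | h
      · exact mul_nonneg_of_nonpos_of_nonpos (by linarith)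
          (sub_nonpos.2 (monotone_softPos (by linarith)))
      · exact mul_nonneg (by linarith) (sub_nonneg.2 (monotone_softPos (by linarith)))
    have e4 := (abs_le.1 (abs_integral_mul_le hd (hSi n))).2
    have e5 : (eLpNorm (inc (S ∘ φ n)) 2 J).toReal
        ≤ (eLpNorm (inc (φ n) - inc u) 2 J).toReal + (eLpNorm (inc u) 2 J).toReal := by
      rw [← ENNReal.toReal_add hd.2.ne hu.memLp_inc.2.ne]
      refine ENNReal.toReal_mono (ENNReal.add_ne_top.2 ⟨hd.2.ne, hu.memLp_inc.2.ne⟩) ?_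
      calc eLpNorm (inc (S ∘ φ n)) 2 J ≤ eLpNorm (inc (φ n)) 2 J :=
            eLpNorm_mono fun q => Slip _ _
        _ = eLpNorm ((inc (φ n) - inc u) + inc u) 2 J := by simp
        _ ≤ _ := eLpNorm_add_le hd.1 hu.memLp_inc.1 (by norm_num)
    have e6 := mul_le_mul_of_nonneg_left e5
      (ENNReal.toReal_nonneg (a := eLpNorm (inc (φ n) - inc u) 2 J))
    rw [e1, e2]; linarith
  have hlow' : 0 ≤ ∫ x, (F - u) x * (S ∘ u) x ∂m := by
    refine le_of_tendsto_of_tendsto' ?_ hlim hlow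
    have t : Tendsto (fun n => (eLpNorm (inc (φ n) - inc u) 2 J).toReal) atTop (𝓝 0) := by
      simpa [Function.comp_def] using (ENNReal.tendsto_toReal ENNReal.zero_ne_top).comp a5
    simpa using (t.mul (t.add_const _)).neg
  -- Where u > C one has F - u < 0 < S ∘ u; elsewhere S ∘ u = 0. A nonpositive integrand with
  -- nonnegative integral vanishes almost everywhere, so {u > C} is null.
  have hneg : ∀ x, (F - u) x * (S ∘ u) x ≤ 0 := by
    intro x
    rcases le_or_gt (u x) C with h | h
    · simp [S, softPos_of_nonpos (sub_nonpos.2 h)]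
    · exact mul_nonpos_of_nonpos_of_nonneg (by have := hFC x; simp only [Pi.sub_apply]; linarith)
        (softPos_pos (sub_pos.2 h)).le
  have hz : ∫ x, -((F - u) x * (S ∘ u) x) ∂m = 0 := by
    rw [integral_neg, neg_eq_zero]
    exact le_antisymm (integral_nonpos hneg) hlow'
  rw [integral_eq_zero_iff_of_nonneg (fun x => neg_nonneg.2 (hneg x))
    (integrable_mul_of_memLp_two hFu hSu).neg] at hz
  filter_upwards [hz] with x hx
  by_contra h
  push Not at h
  have h1 : (F - u) x < 0 := by have := hFC x; simp only [Pi.sub_apply]; linarith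
  have h2 : 0 < S (u x) := softPos_pos (sub_pos.2 h)
  have := mul_neg_of_neg_of_pos h1 h2
  simp only [Pi.zero_apply, neg_eq_zero, Function.comp] at hx
  linarith

end

/-! ### The jump measure, and the resolvent as a variational solution -/

section

variable {d : ℕ} {m : Measure (Rd d)} {J : Measure (Rd d × Rd d)}

/-- The measure on pairs whose density is the jump density. -/
def jumpMeasure (α : ℝ) (Γ : Set (Rd d)) (k : Rd d → Rd d → ℝ≥0) : Measure (Rd d × Rd d) :=
  volume.withDensity fun q => (jump α Γ k q : ℝ≥0∞)

variable {α : ℝ} {Γ : Set (Rd d)} {k : Rd d → Rd d → ℝ≥0}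

theorem measurable_jump (hΓ : MeasurableSet Γ) (hk : Measurable fun q : Rd d × Rd d => k q.1 q.2) :
    Measurable (jump α Γ k) := by
  unfold jump
  refine Measurable.ite ((measurable_fst.sub measurable_snd) hΓ) ?_ measurable_const
  exact hk.div (((measurable_fst.sub measurable_snd).nnnorm).pow_const _)

theorem jumpMeasure_absolutelyContinuous : jumpMeasure α Γ k ≪ volume :=
  withDensity_absolutelyContinuous _ _

theorem lintegral_jumpMeasure (hj : Measurable (jump α Γ k)) (S : Set (Rd d × Rd d))
    (g : Rd d × Rd d → ℝ≥0∞) :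
    ∫⁻ q in S, g q ∂jumpMeasure α Γ k = ∫⁻ q in S, g q * (jump α Γ k q : ℝ≥0∞) := by
  rw [jumpMeasure, restrict_withDensity',
    lintegral_withDensity_eq_lintegral_mul_non_measurable _ hj.coe_nnreal_ennreal
      (ae_of_all _ fun _ => ENNReal.coe_lt_top)]
  exact lintegral_congr fun q => mul_comm _ _

theorem energyOn_eq (hj : Measurable (jump α Γ k)) (S : Set (Rd d × Rd d)) (f : Rd d → ℝ) :
    energyOn α Γ k S f = eLpNorm (inc f) 2 ((jumpMeasure α Γ k).restrict S) ^ 2 := by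
  rw [eLpNorm_two_sq, lintegral_jumpMeasure hj]; rfl

theorem energy_eq (hj : Measurable (jump α Γ k)) (f : Rd d → ℝ) :
    energy α Γ k f = 2⁻¹ * eLpNorm (inc f) 2 (jumpMeasure α Γ k) ^ 2 := by
  rw [energy, energyOn_eq hj, Measure.restrict_univ]

theorem formOn_eq (hj : Measurable (jump α Γ k)) (S : Set (Rd d × Rd d)) (f g : Rd d → ℝ) :
    formOn α Γ k S f g = ∫ q in S, inc f q * inc g q ∂jumpMeasure α Γ k := by
  rw [jumpMeasure, restrict_withDensity', integral_withDensity_eq_integral_smul hj]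
  refine integral_congr_ae (ae_of_all _ fun q => ?_)
  simp only [inc, NNReal.smul_def, smul_eq_mul]; ring

theorem form_eq (hj : Measurable (jump α Γ k)) (f g : Rd d → ℝ) :
    form α Γ k f g = 1 / 2 * ∫ q, inc f q * inc g q ∂jumpMeasure α Γ k := by
  rw [form, formOn_eq hj, Measure.restrict_univ]

theorem FormClosure.smul_measure {u : Rd d → ℝ} (hu : FormClosure m J u) {c : ℝ≥0∞}
    (hc : c ≠ ∞) : FormClosure m (c • J) u := by
  obtain ⟨φ, a1, a2, a3, a4, a5⟩ := hu.approx
  refine ⟨hu.aesm, hu.memLp, hu.memLp_inc.smul_measure hc, φ, a1, a2,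
    fun n => (a3 n).smul_measure hc, a4, ?_⟩
  simp_rw [eLpNorm_smul_measure_of_ne_top (p := 2) (by norm_num), smul_eq_mul]
  simpa using ENNReal.Tendsto.const_mul a5
    (Or.inr (ENNReal.rpow_ne_top_of_nonneg (by norm_num) hc))

theorem formClosure_smul_iff {u : Rd d → ℝ} {c : ℝ≥0∞} (hc : c ≠ ∞) (hc0 : c ≠ 0) :
    FormClosure m (c • J) u ↔ FormClosure m J u := by
  refine ⟨fun h => ?_, fun h => h.smul_measure hc⟩
  have := h.smul_measure (ENNReal.inv_ne_top.2 hc0)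
  rwa [smul_smul, ENNReal.inv_mul_cancel hc0 hc, one_smul] at this

theorem memLp_inc_of_energy (hj : Measurable (jump α Γ k)) {u : Rd d → ℝ}
    (hu : AEStronglyMeasurable u volume) (h : energy α Γ k u < ∞) :
    MemLp (inc u) 2 (jumpMeasure α Γ k) := by
  refine ⟨(aestronglyMeasurable_inc hu).mono_ac jumpMeasure_absolutelyContinuous, ?_⟩
  rw [energy_eq hj] at h
  by_contra hcon
  simp only [not_lt, top_le_iff] at hcon
  simp [hcon, ENNReal.mul_top] at h

theorem energy_lt_top (hj : Measurable (jump α Γ k)) {u : Rd d → ℝ}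
    (h : MemLp (inc u) 2 (jumpMeasure α Γ k)) : energy α Γ k u < ∞ := by
  rw [energy_eq hj]
  exact ENNReal.mul_lt_top (by simp) (ENNReal.pow_lt_top h.2)

/-- `MemDomain` does not ask each approximant to have finite norm. Since u has finite norm and the
distances tend to zero, all approximants from some index on do, and this tail serves in
`FormClosure`. The factor 1/2 in the energy does not affect convergence to zero. -/
theorem memDomain_iff (hm : m ≪ volume) (hj : Measurable (jump α Γ k)) {u : Rd d → ℝ} :
    MemDomain α Γ k m u ↔ FormClosure m (jumpMeasure α Γ k) u := by
  constructor
  · rintro ⟨h1, h2, h3, φ, h4, h5⟩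
    have i1 := memLp_inc_of_energy hj h1 h3
    have t1 : Tendsto (fun n => eLpNorm (φ n - u) 2 m) atTop (𝓝 0) := by
      rw [← tendsto_sq_iff]
      simp_rw [eLpNorm_sub_comm _ u]
      exact tendsto_of_tendsto_of_tendsto_of_le_of_le tendsto_const_nhds h5 (fun _ => zero_le)
        fun n => le_add_self
    have t2 : Tendsto (fun n => energy α Γ k (u - φ n)) atTop (𝓝 0) :=
      tendsto_of_tendsto_of_tendsto_of_le_of_le tendsto_const_nhds h5 (fun _ => zero_le)
        fun n => le_self_add
    have t3 : Tendsto (fun n => eLpNorm (inc (φ n) - inc u) 2 (jumpMeasure α Γ k)) atTop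
        (𝓝 0) := by
      rw [← tendsto_sq_iff]
      have := ENNReal.Tendsto.const_mul (a := 2) t2 (Or.inr (by simp))
      rw [mul_zero] at this
      refine this.congr fun n => ?_
      rw [energy_eq hj, ← mul_assoc, ENNReal.mul_inv_cancel (by simp) (by simp), one_mul, inc_sub,
        eLpNorm_sub_comm]
    have ev : ∀ᶠ n in atTop, eLpNorm (φ n - u) 2 m < ∞ ∧
        eLpNorm (inc (φ n) - inc u) 2 (jumpMeasure α Γ k) < ∞ :=
      (t1.eventually (gt_mem_nhds ENNReal.zero_lt_top)).and
        (t3.eventually (gt_mem_nhds ENNReal.zero_lt_top))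
    obtain ⟨N, hN⟩ := eventually_atTop.1 ev
    have c1 : ∀ n, AEStronglyMeasurable (φ n) volume := fun n =>
      (h4 n).1.continuous.aestronglyMeasurable
    refine ⟨h1, h2, i1, fun n => φ (n + N), fun n => h4 _, fun n => ?_, fun n => ?_,
      t1.comp (tendsto_add_atTop_nat N), t3.comp (tendsto_add_atTop_nat N)⟩
    · have : MemLp (φ (n + N) - u) 2 m :=
        ⟨((c1 _).mono_ac hm).sub h2.1, (hN _ (Nat.le_add_left _ _)).1⟩
      simpa using this.add h2
    · have : MemLp (inc (φ (n + N)) - inc u) 2 (jumpMeasure α Γ k) :=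
        ⟨((aestronglyMeasurable_inc (c1 _)).mono_ac jumpMeasure_absolutelyContinuous).sub i1.1,
          (hN _ (Nat.le_add_left _ _)).2⟩
      simpa using this.add i1
  · rintro ⟨h1, h2, h3, φ, h4, h5, h6, h7, h8⟩
    refine ⟨h1, h2, energy_lt_top hj h3, φ, h4, ?_⟩
    have e1 := ENNReal.Tendsto.const_mul (a := 2⁻¹) (tendsto_sq_iff.2 h8) (Or.inr (by simp))
    have e2 := e1.add (tendsto_sq_iff.2 h7)
    simp only [mul_zero, add_zero] at e2
    refine e2.congr fun n => ?_
    rw [energy_eq hj, inc_sub, eLpNorm_sub_comm, eLpNorm_sub_comm u]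

/-- Dividing the equation by λ puts all constants into the data: the jump measure is multiplied by
(2λ)⁻¹ and the source becomes λ⁻¹ f. A finite non-zero factor on the jump measure leaves the closure
unchanged. -/
theorem isResolvent_iff (hm : m ≪ volume) (hj : Measurable (jump α Γ k)) {lam : ℝ}
    (hl : 0 < lam) {f u : Rd d → ℝ} :
    IsResolvent α Γ k m lam f u ↔
      FormClosure m (ENNReal.ofReal (2 * lam)⁻¹ • jumpMeasure α Γ k) u ∧
      ∀ v, FormClosure m (ENNReal.ofReal (2 * lam)⁻¹ • jumpMeasure α Γ k) v →
        ∫ x, u x * v x ∂m + ∫ q, inc u q * inc v q ∂(ENNReal.ofReal (2 * lam)⁻¹ •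
          jumpMeasure α Γ k) = ∫ x, (lam⁻¹ • f) x * v x ∂m := by
  have h0 : ENNReal.ofReal (2 * lam)⁻¹ ≠ 0 := by
    rw [Ne, ENNReal.ofReal_eq_zero, not_le]; positivity
  simp only [IsResolvent, memDomain_iff hm hj, formClosure_smul_iff ENNReal.ofReal_ne_top h0]
  refine and_congr_right fun _ => forall₂_congr fun v _ => ?_
  rw [integral_smul_measure, form_eq hj, ENNReal.toReal_ofReal (by positivity)]
  have : ∫ x, (lam⁻¹ • f) x * v x ∂m = lam⁻¹ * ∫ x, f x * v x ∂m := by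
    rw [← integral_const_mul]
    exact integral_congr_ae (ae_of_all _ fun x => by simp only [Pi.smul_apply, smul_eq_mul]; ring)
  rw [this, smul_eq_mul]
  constructor
  · intro h
    rw [← h]; field_simp
  · intro h
    field_simp at h ⊢
    linarith

theorem exists_isResolvent (hm : m ≪ volume) (hm' : volume ≪ m) (hj : Measurable (jump α Γ k))
    {lam : ℝ} (hl : 0 < lam) {f : Rd d → ℝ} (hf : MemLp f 2 m) :
    ∃ u, IsResolvent α Γ k m lam f u := by
  simp_rw [isResolvent_iff hm hj hl]
  exact exists_formClosure_solution hm'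
    (Measure.smul_absolutelyContinuous.trans jumpMeasure_absolutelyContinuous)
    (hf.const_smul lam⁻¹)

theorem isResolvent_resolvent (hm : m ≪ volume) (hm' : volume ≪ m)
    (hj : Measurable (jump α Γ k)) {lam : ℝ} (hl : 0 < lam) {f : Rd d → ℝ} (hf : MemLp f 2 m) :
    IsResolvent α Γ k m lam f (resolvent α Γ k m lam f) := by
  have h := exists_isResolvent hm hm' hj hl hf
  rw [resolvent, dif_pos h]
  exact h.choose_spec

theorem IsResolvent.ae_unique (hm : m ≪ volume) (hm' : volume ≪ m)
    (hj : Measurable (jump α Γ k)) {lam : ℝ} (hl : 0 < lam) {f u v : Rd d → ℝ}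
    (hu : IsResolvent α Γ k m lam f u) (hv : IsResolvent α Γ k m lam f v) : u =ᵐ[volume] v := by
  rw [isResolvent_iff hm hj hl] at hu hv
  exact hm'.ae_le (formClosure_solution_unique hu.1 hv.1 hu.2 hv.2)

/-- The one-sided maximum principle is used for (f, u) and for (-f, -u), with the normalised source
bounded by M/λ. -/
theorem IsResolvent.ae_abs_le (hm : m ≪ volume) (hm' : volume ≪ m)
    (hj : Measurable (jump α Γ k)) {lam : ℝ} (hl : 0 < lam) {f u : Rd d → ℝ} (hf : MemLp f 2 m)
    (hu : IsResolvent α Γ k m lam f u) {M : ℝ} (hM : ∀ x, |f x| ≤ M) :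
    ∀ᵐ x, |u x| ≤ M / lam := by
  have hM0 : 0 ≤ M := (abs_nonneg _).trans (hM 0)
  have hu' : IsResolvent α Γ k m lam (-f) (-u) := by
    have hd : MemDomain α Γ k m (-u) := by
      have := hu.1
      rw [memDomain_iff hm hj] at this ⊢
      -- -u is written as (u - u) - u, so that closure under differences suffices.
      simpa using (this.sub this).sub this
    refine ⟨hd, fun v hv => ?_⟩
    have := hu.2 v hv
    rw [form_eq hj] at this ⊢
    have e : ∀ q, inc (-u) q = -inc u q := fun q => by simp only [inc, Pi.neg_apply]; ring
    simp only [e, Pi.neg_apply, neg_mul, integral_neg]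
    linarith
  have aux : ∀ g w : Rd d → ℝ, MemLp g 2 m → IsResolvent α Γ k m lam g w → (∀ x, g x ≤ M) →
      ∀ᵐ x, w x ≤ M / lam := by
    intro g w hg hw hgM
    rw [isResolvent_iff hm hj hl] at hw
    refine hm'.ae_le (hw.1.le_of_le (hg.const_smul lam⁻¹) hw.2 (by positivity) fun x => ?_)
    rw [Pi.smul_apply, smul_eq_mul, div_eq_inv_mul]
    exact mul_le_mul_of_nonneg_left (hgM x) (by positivity)
  filter_upwards [aux f u hf hu fun x => (abs_le.1 (hM x)).2,
    aux (-f) (-u) hf.neg hu' fun x => by simpa using neg_le.1 (abs_le.1 (hM x)).1] with x h1 h2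
  exact abs_le.2 ⟨by simp only [Pi.neg_apply] at h2; linarith, h1⟩

end

section

variable {d : ℕ} {m : Measure (Rd d)} {J : Measure (Rd d × Rd d)} {α : ℝ} {Γ : Set (Rd d)}

/-! ### Truncation of small and large jumps -/

/-- The pairs at distance between `η` and `1 / η`. -/
def midSet (d : ℕ) (η : ℝ) : Set (Rd d × Rd d) := {q | η < ‖q.1 - q.2‖ ∧ ‖q.1 - q.2‖ < 1 / η}

theorem measurableSet_midSet (η : ℝ) : MeasurableSet (midSet d η) := by
  have h : Measurable fun q : Rd d × Rd d => ‖q.1 - q.2‖ := by fun_prop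
  exact (measurableSet_lt measurable_const h).inter (measurableSet_lt h measurable_const)

theorem eventually_mem_midSet {q : Rd d × Rd d} (hq : q.1 ≠ q.2) :
    ∀ᶠ η in 𝓝[>] (0 : ℝ), q ∈ midSet d η := by
  have h0 : 0 < ‖q.1 - q.2‖ := norm_pos_iff.2 (sub_ne_zero.2 hq)
  have h1 : ∀ᶠ η in 𝓝[>] (0 : ℝ), η < ‖q.1 - q.2‖ :=
    mem_nhdsWithin_of_mem_nhds (gt_mem_nhds h0)
  have h2 : ∀ᶠ η in 𝓝[>] (0 : ℝ), ‖q.1 - q.2‖ < 1 / η := by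
    simpa only [one_div] using tendsto_inv_nhdsGT_zero.eventually_gt_atTop ‖q.1 - q.2‖
  exact h1.and h2

/-- As η → 0 the sets `midSet d η` exhaust the off-diagonal pairs, so this is dominated convergence.
`hdiag` disposes of the diagonal without any assumption on its J-mass. -/
theorem tendsto_setLIntegral_midSet_compl {G : Rd d × Rd d → ℝ≥0∞} (hG : AEMeasurable G J)
    (hfin : ∫⁻ q, G q ∂J ≠ ∞) (hdiag : ∀ q, q.1 = q.2 → G q = 0) :
    Tendsto (fun η => ∫⁻ q in (midSet d η)ᶜ, G q ∂J) (𝓝[>] 0) (𝓝 0) := by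
  simp_rw [← lintegral_indicator (measurableSet_midSet _).compl]
  rw [← lintegral_zero (μ := J)]
  refine tendsto_lintegral_filter_of_dominated_convergence' G
    (Eventually.of_forall fun η => hG.indicator (measurableSet_midSet _).compl)
    (Eventually.of_forall fun η => ae_of_all _ fun q => indicator_le_self _ _ _) hfin
    (ae_of_all _ fun q => ?_)
  refine tendsto_const_nhds.congr' ?_
  by_cases hq : q.1 = q.2
  · exact Eventually.of_forall fun η => by simp [indicator, hdiag q hq]
  · filter_upwards [eventually_mem_midSet hq] with η hη
    simp [indicator, hη]

theorem tendsto_eLpNorm_inc_midSet_compl {u : Rd d → ℝ} (hu : MemLp (inc u) 2 J) :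
    Tendsto (fun η => eLpNorm (inc u) 2 (J.restrict (midSet d η)ᶜ)) (𝓝[>] 0) (𝓝 0) := by
  rw [← tendsto_sq_iff]
  simp_rw [eLpNorm_two_sq]
  refine tendsto_setLIntegral_midSet_compl (hu.1.aemeasurable.pow_const 2).ennreal_ofReal ?_ ?_
  · rw [← eLpNorm_two_sq]; exact (ENNReal.pow_lt_top hu.2).ne
  · intro q hq; simp [inc, hq]

/-- Cauchy–Schwarz off `midSet`. It is enough that one factor be small and the other bounded; this
removes the tails both in the limit form and, uniformly in small ε, in the rescaled forms. -/
theorem abs_integral_sub_midSet_le {u g : Rd d → ℝ} (hu : MemLp (inc u) 2 J)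
    (hg : MemLp (inc g) 2 J) (η : ℝ) :
    |∫ q, inc u q * inc g q ∂J - ∫ q in midSet d η, inc u q * inc g q ∂J|
      ≤ (eLpNorm (inc u) 2 (J.restrict (midSet d η)ᶜ)).toReal *
        (eLpNorm (inc g) 2 (J.restrict (midSet d η)ᶜ)).toReal := by
  rw [← integral_add_compl (measurableSet_midSet η) (integrable_mul_of_memLp_two hu hg),
    add_sub_cancel_left]
  exact abs_integral_mul_le (hu.restrict _) (hg.restrict _)

theorem tendsto_integral_midSet {u g : Rd d → ℝ} (hu : MemLp (inc u) 2 J)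
    (hg : MemLp (inc g) 2 J) :
    Tendsto (fun η => ∫ q in midSet d η, inc u q * inc g q ∂J) (𝓝[>] 0)
      (𝓝 (∫ q, inc u q * inc g q ∂J)) := by
  rw [tendsto_iff_dist_tendsto_zero]
  have h1 := (ENNReal.tendsto_toReal ENNReal.zero_ne_top).comp
    (tendsto_eLpNorm_inc_midSet_compl hu)
  have h2 := (ENNReal.tendsto_toReal ENNReal.zero_ne_top).comp
    (tendsto_eLpNorm_inc_midSet_compl hg)
  refine squeeze_zero (fun _ => dist_nonneg) (fun η => ?_) (by simpa using h1.mul h2)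
  rw [Real.dist_eq, abs_sub_comm]
  exact abs_integral_sub_midSet_le hu hg η

/-! ### Translation invariant jump kernels -/

open Classical in
/-- The jump density of a translation invariant coefficient, as a function of the jump. -/
def levyDensity (α : ℝ) (Γ : Set (Rd d)) (K : Rd d → ℝ≥0) (z : Rd d) : ℝ≥0 :=
  if z ∈ Γ then K z / ‖z‖₊ ^ ((d : ℝ) + α) else 0

variable {K : Rd d → ℝ≥0}

theorem measurable_levyDensity (hΓ : MeasurableSet Γ) (hK : Measurable K) :
    Measurable (levyDensity α Γ K) :=
  Measurable.ite hΓ (hK.div (measurable_nnnorm.pow_const _)) measurable_const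

theorem jump_eq_levyDensity (q : Rd d × Rd d) :
    jump α Γ (fun x y => K (x - y)) q = levyDensity α Γ K (q.1 - q.2) := rfl

/-- The integral of `1 ∧ |z|²` against the jump density. -/
def levyMass (α : ℝ) (Γ : Set (Rd d)) (K : Rd d → ℝ≥0) : ℝ≥0∞ :=
  ∫⁻ z, ENNReal.ofReal (min 1 (‖z‖ ^ 2)) * (levyDensity α Γ K z : ℝ≥0∞)

/-- In the unit ball the integrand is at most C|z|^(2-d-α), integrable since α < 2; outside it is at
most C|z|^(-d-α), integrable since α > 0. -/
theorem levyMass_lt_top (hd : 1 ≤ d) (hα : α ∈ Ioo (0 : ℝ) 2) (hΓ : MeasurableSet Γ)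
    (hK : Measurable K) {C : ℝ≥0} (hKC : ∀ z, K z ≤ C) : levyMass α Γ K < ∞ := by
  have hjm := measurable_levyDensity (α := α) hΓ hK
  have hjle : ∀ z, (levyDensity α Γ K z : ℝ) ≤ C * ‖z‖ ^ (-((d : ℝ) + α)) := by
    intro z
    unfold levyDensity
    split_ifs
    · rw [NNReal.coe_div, NNReal.coe_rpow, coe_nnnorm, Real.rpow_neg (norm_nonneg _),
        div_eq_mul_inv]
      exact mul_le_mul_of_nonneg_right (hKC z) (by positivity)
    · simp only [NNReal.coe_zero]; positivity
  have hfm : Measurable fun z : Rd d => min 1 (‖z‖ ^ 2) * (levyDensity α Γ K z : ℝ) := by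
    fun_prop
  have hpos : ∀ z : Rd d, 0 ≤ min 1 (‖z‖ ^ 2) * (levyDensity α Γ K z : ℝ) := fun z => by
    positivity
  have hin : IntegrableOn (fun z : Rd d => min 1 (‖z‖ ^ 2) * (levyDensity α Γ K z : ℝ))
      (Metric.ball 0 1) volume := by
    refine integrableOn_ball_of_norm_le_rpow (C := C) (α := (d : ℝ) + α - 2) (by simpa using hd)
      (by simp only [finrank_euclideanSpace, Fintype.card_fin]; linarith [hα.2])
      (ae_of_all _ fun z => ?_) hfm.aestronglyMeasurable
    rw [Real.norm_of_nonneg (hpos z)]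
    rcases eq_or_ne z 0 with rfl | hz
    · simp only [norm_zero]; simp; positivity
    · have hz' : 0 < ‖z‖ := norm_pos_iff.2 hz
      calc min 1 (‖z‖ ^ 2) * (levyDensity α Γ K z : ℝ)
          ≤ ‖z‖ ^ 2 * (C * ‖z‖ ^ (-((d : ℝ) + α))) :=
            mul_le_mul (min_le_right _ _) (hjle z) (by positivity) (by positivity)
        _ = C * (‖z‖ ^ (2 : ℝ) * ‖z‖ ^ (-((d : ℝ) + α))) := by
            rw [Real.rpow_two]; ring
        _ = C * ‖z‖ ^ (-((d : ℝ) + α - 2)) := by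
            rw [← Real.rpow_add hz']; congr 2; ring
  have hout : IntegrableOn (fun z : Rd d => min 1 (‖z‖ ^ 2) * (levyDensity α Γ K z : ℝ))
      (Metric.ball 0 1)ᶜ volume := by
    -- The factor 2^(d+α) comes from |z| ≥ (1+|z|)/2 for |z| ≥ 1.
    have hi : Integrable (fun z : Rd d => C * 2 ^ ((d : ℝ) + α) *
        (1 + ‖z‖) ^ (-((d : ℝ) + α))) volume := by
      refine (integrable_one_add_norm ?_).const_mul _
      simp only [finrank_euclideanSpace, Fintype.card_fin]; linarith [hα.1]
    refine hi.integrableOn.mono' hfm.aestronglyMeasurable ?_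
    refine (ae_restrict_iff' Metric.isOpen_ball.measurableSet.compl).2 (ae_of_all _ fun z hz => ?_)
    have hz1 : 1 ≤ ‖z‖ := by simpa using hz
    have hs : 0 < (d : ℝ) + α := by have := hα.1; positivity
    rw [Real.norm_of_nonneg (hpos z)]
    calc min 1 (‖z‖ ^ 2) * (levyDensity α Γ K z : ℝ)
        ≤ 1 * (C * ‖z‖ ^ (-((d : ℝ) + α))) :=
          mul_le_mul (min_le_left _ _) (hjle z) (by positivity) (by positivity)
      _ ≤ C * ((1 + ‖z‖) / 2) ^ (-((d : ℝ) + α)) := by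
          rw [one_mul]
          refine mul_le_mul_of_nonneg_left ?_ (by positivity)
          exact Real.rpow_le_rpow_of_nonpos (by positivity) (by linarith) (by linarith)
      _ = _ := by
          rw [Real.div_rpow (by positivity) (by positivity),
            Real.rpow_neg (by norm_num : (0 : ℝ) ≤ 2), div_inv_eq_mul]
          ring
  have hall : Integrable (fun z : Rd d => min 1 (‖z‖ ^ 2) * (levyDensity α Γ K z : ℝ)) volume := by
    rw [← integrableOn_univ, ← union_compl_self (Metric.ball (0 : Rd d) 1)]
    exact hin.union hout
  have := hall.2
  rw [hasFiniteIntegral_iff_ofReal (ae_of_all _ hpos)] at this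
  refine lt_of_eq_of_lt (lintegral_congr fun z => ?_) this
  rw [ENNReal.ofReal_mul (by positivity), ENNReal.ofReal_coe_nnreal]

/-- The jump measure of a translation invariant coefficient. -/
abbrev levyMeasure (α : ℝ) (Γ : Set (Rd d)) (K : Rd d → ℝ≥0) : Measure (Rd d × Rd d) :=
  jumpMeasure α Γ fun x y => K (x - y)

theorem measurable_levyJump (hΓ : MeasurableSet Γ) (hK : Measurable K) :
    Measurable (jump α Γ fun x y => K (x - y)) :=
  measurable_jump hΓ (hK.comp (measurable_fst.sub measurable_snd))

theorem lintegral_levyMeasure (hΓ : MeasurableSet Γ) (hK : Measurable K)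
    {G : Rd d × Rd d → ℝ≥0∞} (hG : Measurable G) :
    ∫⁻ q, G q ∂levyMeasure α Γ K =
      ∫⁻ y, ∫⁻ z, G (y + z, y) * (levyDensity α Γ K z : ℝ≥0∞) := by
  have hj := measurable_levyJump (α := α) hΓ hK
  rw [← setLIntegral_univ, lintegral_jumpMeasure hj, setLIntegral_univ, Measure.volume_eq_prod,
    lintegral_prod_symm' (fun q : Rd d × Rd d => G q * (jump α Γ (fun x y => K (x - y)) q : ℝ≥0∞))
      (hG.mul hj.coe_nnreal_ennreal)]
  refine lintegral_congr fun y => ?_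
  rw [← lintegral_add_left_eq_self _ y]
  refine lintegral_congr fun z => ?_
  rw [jump_eq_levyDensity, add_sub_cancel_left]

/-- Here the first endpoint is kept and z = x - y is substituted in the second. Having both
parametrisations, a function of either endpoint factors out against `levyMass` without any symmetry
of K or Γ. -/
theorem lintegral_levyMeasure' (hΓ : MeasurableSet Γ) (hK : Measurable K)
    {G : Rd d × Rd d → ℝ≥0∞} (hG : Measurable G) :
    ∫⁻ q, G q ∂levyMeasure α Γ K =
      ∫⁻ x, ∫⁻ z, G (x, x - z) * (levyDensity α Γ K z : ℝ≥0∞) := by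
  have hj := measurable_levyJump (α := α) hΓ hK
  rw [← setLIntegral_univ, lintegral_jumpMeasure hj, setLIntegral_univ, Measure.volume_eq_prod,
    lintegral_prod (fun q : Rd d × Rd d => G q * (jump α Γ (fun x y => K (x - y)) q : ℝ≥0∞))
      (hG.mul hj.coe_nnreal_ennreal).aemeasurable]
  refine lintegral_congr fun x => ?_
  rw [← lintegral_sub_left_eq_self _ x]
  refine lintegral_congr fun z => ?_
  rw [jump_eq_levyDensity, sub_sub_cancel]

theorem lintegral_levyMeasure_snd (hΓ : MeasurableSet Γ) (hK : Measurable K)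
    {F : Rd d → ℝ≥0∞} (hF : Measurable F) :
    ∫⁻ q, F q.2 * ENNReal.ofReal (min 1 (‖q.1 - q.2‖ ^ 2)) ∂levyMeasure α Γ K
      = (∫⁻ y, F y) * levyMass α Γ K := by
  have hj := measurable_levyDensity (α := α) hΓ hK
  rw [lintegral_levyMeasure hΓ hK (by fun_prop), ← lintegral_mul_const _ hF]
  refine lintegral_congr fun y => ?_
  rw [levyMass, ← lintegral_const_mul _ (by fun_prop)]
  simp only [add_sub_cancel_left, mul_assoc]

theorem lintegral_levyMeasure_fst (hΓ : MeasurableSet Γ) (hK : Measurable K)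
    {F : Rd d → ℝ≥0∞} (hF : Measurable F) :
    ∫⁻ q, F q.1 * ENNReal.ofReal (min 1 (‖q.1 - q.2‖ ^ 2)) ∂levyMeasure α Γ K
      = (∫⁻ y, F y) * levyMass α Γ K := by
  have hj := measurable_levyDensity (α := α) hΓ hK
  rw [lintegral_levyMeasure' hΓ hK (by fun_prop), ← lintegral_mul_const _ hF]
  refine lintegral_congr fun y => ?_
  rw [levyMass, ← lintegral_const_mul _ (by fun_prop)]
  simp only [sub_sub_cancel, mul_assoc]

theorem lintegral_levyMeasure_translate (hΓ : MeasurableSet Γ) (hK : Measurable K)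
    {G : Rd d × Rd d → ℝ≥0∞} (hG : Measurable G) (t : Rd d) :
    ∫⁻ q, G (q.1 - t, q.2 - t) ∂levyMeasure α Γ K = ∫⁻ q, G q ∂levyMeasure α Γ K := by
  rw [lintegral_levyMeasure hΓ hK hG, lintegral_levyMeasure hΓ hK (by fun_prop)]
  rw [← lintegral_sub_right_eq_self (fun y => ∫⁻ z, G (y + z, y) * _) t]
  refine lintegral_congr fun y => lintegral_congr fun z => ?_
  rw [add_sub_right_comm]

/-- A function bounded by `c (1 ∧ |x-y|)` on its increments and vanishing outside a set of finite
measure has finite energy. -/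
theorem memLp_inc_of_lipschitz (hΓ : MeasurableSet Γ) (hK : Measurable K)
    (hA : levyMass α Γ K < ∞) {g : Rd d → ℝ} (hgm : Measurable g) {S : Set (Rd d)}
    (hS : MeasurableSet S) (hSfin : volume S < ∞) (hgS : ∀ x ∉ S, g x = 0) {c : ℝ}
    (hg : ∀ x y, (g x - g y) ^ 2 ≤ c * min 1 (‖x - y‖ ^ 2)) :
    MemLp (inc g) 2 (levyMeasure α Γ K) := by
  have hgi : Measurable (inc g) := by unfold inc; fun_prop
  refine ⟨hgi.aestronglyMeasurable, ?_⟩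
  refine (ENNReal.pow_lt_top_iff.1 ?_).resolve_right two_ne_zero
  rw [eLpNorm_two_sq]
  set F : Rd d → ℝ≥0∞ := S.indicator fun _ => ENNReal.ofReal c
  have hF : Measurable F := measurable_const.indicator hS
  have hFi : ∫⁻ x, F x < ∞ := by
    rw [lintegral_indicator hS, setLIntegral_const]
    exact ENNReal.mul_lt_top ENNReal.ofReal_lt_top hSfin
  calc ∫⁻ q, ENNReal.ofReal (inc g q ^ 2) ∂levyMeasure α Γ K
      ≤ ∫⁻ q, (F q.1 * ENNReal.ofReal (min 1 (‖q.1 - q.2‖ ^ 2)) +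
          F q.2 * ENNReal.ofReal (min 1 (‖q.1 - q.2‖ ^ 2))) ∂levyMeasure α Γ K := by
        refine lintegral_mono fun q => ?_
        have h1 : ENNReal.ofReal (inc g q ^ 2)
            ≤ ENNReal.ofReal c * ENNReal.ofReal (min 1 (‖q.1 - q.2‖ ^ 2)) := by
          rw [← ENNReal.ofReal_mul' (by positivity)]
          exact ENNReal.ofReal_le_ofReal (hg _ _)
        by_cases hx : q.1 ∈ S
        · simp only [F, indicator_of_mem hx]; exact h1.trans le_self_add
        by_cases hy : q.2 ∈ S
        · simp only [F, indicator_of_mem hy]; exact h1.trans le_add_self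
        · simp [inc, hgS _ hx, hgS _ hy]
    _ < ∞ := by
        rw [lintegral_add_left (by fun_prop), lintegral_levyMeasure_fst hΓ hK hF,
          lintegral_levyMeasure_snd hΓ hK hF]
        exact ENNReal.add_lt_top.2 ⟨ENNReal.mul_lt_top hFi hA, ENNReal.mul_lt_top hFi hA⟩

theorem IsCcInfty.isCcOne {g : Rd d → ℝ} (hg : IsCcInfty g) : IsCcOne g :=
  ⟨hg.1.of_le (by exact_mod_cast le_top), hg.2⟩

theorem IsCcInfty.isCc {g : Rd d → ℝ} (hg : IsCcInfty g) : IsCc g :=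
  ⟨hg.1.continuous, hg.2⟩

theorem IsCc.exists_bound {g : Rd d → ℝ} (hg : IsCc g) : ∃ M : ℝ, 0 ≤ M ∧ ∀ x, |g x| ≤ M := by
  obtain ⟨M, hM⟩ := hg.1.bounded_above_of_compact_support hg.2
  exact ⟨M, (norm_nonneg _).trans (hM 0), hM⟩

theorem IsCc.exists_ball {g : Rd d → ℝ} (hg : IsCc g) :
    ∃ R : ℝ, 1 ≤ R ∧ ∀ x, x ∉ Metric.ball (0 : Rd d) R → g x = 0 := by
  obtain ⟨R, hR⟩ := hg.2.isCompact.isBounded.subset_ball (0 : Rd d)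
  refine ⟨max R 1, le_max_right _ _, fun x hx => image_eq_zero_of_notMem_tsupport fun h => hx ?_⟩
  exact Metric.ball_subset_ball (le_max_left _ _) (hR h)

theorem IsCcInfty.sq_sub_le {g : Rd d → ℝ} (hg : IsCcInfty g) :
    ∃ c : ℝ, ∀ x y, (g x - g y) ^ 2 ≤ c * min 1 (‖x - y‖ ^ 2) := by
  obtain ⟨M, hM0, hM⟩ := hg.isCc.exists_bound
  obtain ⟨L, hL⟩ := hg.1.lipschitzWith_of_hasCompactSupport hg.2 (by simp)
  refine ⟨(2 * M) ^ 2 + (L : ℝ) ^ 2, fun x y => ?_⟩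
  have h1 : |g x - g y| ≤ 2 * M := by
    have := abs_sub (g x) (g y)
    linarith [hM x, hM y]
  have h2 : |g x - g y| ≤ L * ‖x - y‖ := by simpa [Real.dist_eq, dist_eq_norm] using hL.dist_le_mul x y
  rw [← sq_abs]
  rcases min_cases 1 (‖x - y‖ ^ 2) with h | h
  · rw [h.1]
    have := pow_le_pow_left₀ (abs_nonneg _) h1 2
    nlinarith [sq_nonneg (L : ℝ)]
  · rw [h.1]
    have := pow_le_pow_left₀ (abs_nonneg _) h2 2
    rw [mul_pow] at this
    nlinarith [mul_nonneg (sq_nonneg (2 * M)) (sq_nonneg ‖x - y‖)]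

theorem IsCcInfty.memLp_inc (hΓ : MeasurableSet Γ) (hK : Measurable K)
    (hA : levyMass α Γ K < ∞) {g : Rd d → ℝ} (hg : IsCcInfty g) :
    MemLp (inc g) 2 (levyMeasure α Γ K) := by
  obtain ⟨c, hc⟩ := hg.sq_sub_le
  obtain ⟨R, -, hR⟩ := hg.isCc.exists_ball
  exact memLp_inc_of_lipschitz hΓ hK hA hg.1.continuous.measurable
    Metric.isOpen_ball.measurableSet measure_ball_lt_top hR hc

end

/-! ### Translation invariant energies: truncation, regularisation, weak uniqueness -/

section

variable {d : ℕ} {J : Measure (Rd d × Rd d)} {α : ℝ} {Γ : Set (Rd d)} {K : Rd d → ℝ≥0}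

/-- On the pairs at distance between `η` and `1 / η` the energy is controlled by the `L²` norm. -/
theorem eLpNorm_inc_midSet_sq_le (hΓ : MeasurableSet Γ) (hK : Measurable K) {η : ℝ} (hη : 0 < η)
    (hη1 : η ≤ 1) {u : Rd d → ℝ} (hu : Measurable u) :
    eLpNorm (inc u) 2 ((levyMeasure α Γ K).restrict (midSet d η)) ^ 2
      ≤ ENNReal.ofReal (4 / η ^ 2) * levyMass α Γ K * eLpNorm u 2 volume ^ 2 := by
  rw [eLpNorm_two_sq, eLpNorm_two_sq, ← lintegral_indicator (measurableSet_midSet _)]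
  set F : Rd d → ℝ≥0∞ := fun x => ENNReal.ofReal (2 / η ^ 2) * ENNReal.ofReal (u x ^ 2)
  have hF : Measurable F := by fun_prop
  calc ∫⁻ q, (midSet d η).indicator (fun q => ENNReal.ofReal (inc u q ^ 2)) q ∂levyMeasure α Γ K
      ≤ ∫⁻ q, (F q.1 * ENNReal.ofReal (min 1 (‖q.1 - q.2‖ ^ 2)) +
          F q.2 * ENNReal.ofReal (min 1 (‖q.1 - q.2‖ ^ 2))) ∂levyMeasure α Γ K := by
        refine lintegral_mono fun q => ?_
        by_cases hq : q ∈ midSet d η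
        · rw [indicator_of_mem hq]
          -- On the truncated set 1 ∧ |x-y|² ≥ η², because η ≤ 1. Multiplying and dividing by it
          -- brings in `levyMass` and the constant 1/η².
          have h1 : η ^ 2 ≤ min 1 (‖q.1 - q.2‖ ^ 2) :=
            le_min (pow_le_one₀ hη.le hη1) (pow_le_pow_left₀ hη.le hq.1.le 2)
          simp only [F]
          rw [← ENNReal.ofReal_mul (by positivity), ← ENNReal.ofReal_mul (by positivity),
            ← ENNReal.ofReal_mul (by positivity), ← ENNReal.ofReal_mul (by positivity),
            ← ENNReal.ofReal_add (by positivity) (by positivity)]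
          refine ENNReal.ofReal_le_ofReal ?_
          have h2 : inc u q ^ 2 ≤ 2 * (u q.1 ^ 2 + u q.2 ^ 2) := by
            simp only [inc]; nlinarith [sq_nonneg (u q.1 + u q.2)]
          calc inc u q ^ 2 ≤ 2 * (u q.1 ^ 2 + u q.2 ^ 2) := h2
            _ = (2 / η ^ 2 * (u q.1 ^ 2 + u q.2 ^ 2)) * η ^ 2 := by field_simp
            _ ≤ (2 / η ^ 2 * (u q.1 ^ 2 + u q.2 ^ 2)) * min 1 (‖q.1 - q.2‖ ^ 2) :=
                mul_le_mul_of_nonneg_left h1 (by positivity)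
            _ = _ := by ring
        · rw [indicator_of_notMem hq]; exact zero_le
    _ = _ := by
        rw [lintegral_add_left (by fun_prop), lintegral_levyMeasure_fst hΓ hK hF,
          lintegral_levyMeasure_snd hΓ hK hF, ← add_mul, lintegral_const_mul _ (by fun_prop),
          ← add_mul, ← ENNReal.ofReal_add (by positivity) (by positivity)]
        rw [show 2 / η ^ 2 + 2 / η ^ 2 = 4 / η ^ 2 by ring]
        ring

theorem tendsto_eLpNorm_inc_midSet (hΓ : MeasurableSet Γ) (hK : Measurable K)
    (hA : levyMass α Γ K < ∞) {η : ℝ} (hη : 0 < η) (hη1 : η ≤ 1) {ι : Type*} {l : Filter ι}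
    {u : ι → Rd d → ℝ} (hu : ∀ i, Measurable (u i))
    (h : Tendsto (fun i => eLpNorm (u i) 2 volume) l (𝓝 0)) :
    Tendsto (fun i => eLpNorm (inc (u i)) 2 ((levyMeasure α Γ K).restrict (midSet d η))) l
      (𝓝 0) := by
  rw [← tendsto_sq_iff] at h ⊢
  refine tendsto_of_tendsto_of_tendsto_of_le_of_le tendsto_const_nhds ?_ (fun _ => zero_le)
    fun i => eLpNorm_inc_midSet_sq_le hΓ hK hη hη1 (hu i)
  simpa using ENNReal.Tendsto.const_mul h
    (Or.inr (ENNReal.mul_ne_top ENNReal.ofReal_ne_top hA.ne))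

/-- If `φ i → ψ` in `L²` with bounded energies, then `E(v, φ i) → E(v, ψ)`. -/
theorem tendsto_integral_inc_of_bounded (hΓ : MeasurableSet Γ) (hK : Measurable K)
    (hA : levyMass α Γ K < ∞) {ι : Type*} {l : Filter ι} {v ψ : Rd d → ℝ} {φ : ι → Rd d → ℝ}
    (hv : MemLp (inc v) 2 (levyMeasure α Γ K)) (hψ : MemLp (inc ψ) 2 (levyMeasure α Γ K))
    (hφ : ∀ i, MemLp (inc (φ i)) 2 (levyMeasure α Γ K)) (hψm : Measurable ψ)
    (hφm : ∀ i, Measurable (φ i)) {B : ℝ≥0∞} (hB : B ≠ ∞)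
    (hφB : ∀ i, eLpNorm (inc (φ i)) 2 (levyMeasure α Γ K) ≤ B)
    (hlim : Tendsto (fun i => eLpNorm (φ i - ψ) 2 volume) l (𝓝 0)) :
    Tendsto (fun i => ∫ q, inc v q * inc (φ i) q ∂levyMeasure α Γ K) l
      (𝓝 (∫ q, inc v q * inc ψ q ∂levyMeasure α Γ K)) := by
  set J := levyMeasure α Γ K with hJ
  set D : ℝ := (B + eLpNorm (inc ψ) 2 J).toReal
  have hd : ∀ i, MemLp (inc (φ i - ψ)) 2 J := fun i => by
    rw [inc_sub]; exact (hφ i).sub hψ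
  have hdB : ∀ i, (eLpNorm (inc (φ i - ψ)) 2 J).toReal ≤ D := fun i => by
    refine ENNReal.toReal_mono (ENNReal.add_ne_top.2 ⟨hB, hψ.2.ne⟩) ?_
    rw [inc_sub]
    exact (eLpNorm_sub_le (hφ i).1 hψ.1 (by norm_num)).trans (by gcongr; exact hφB i)
  rw [← tendsto_sub_nhds_zero_iff]
  have heq : ∀ i, ∫ q, inc v q * inc (φ i) q ∂J - ∫ q, inc v q * inc ψ q ∂J
      = ∫ q, inc v q * inc (φ i - ψ) q ∂J := fun i => by
    rw [← integral_sub (integrable_mul_of_memLp_two hv (hφ i))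
      (integrable_mul_of_memLp_two hv hψ)]
    refine integral_congr_ae (ae_of_all _ fun q => ?_)
    simp only [inc, Pi.sub_apply]; ring
  simp_rw [heq]
  rw [Metric.tendsto_nhds]
  intro ε hε
  have hD : 0 ≤ D := ENNReal.toReal_nonneg
  have t1 := (ENNReal.tendsto_toReal ENNReal.zero_ne_top).comp
    (tendsto_eLpNorm_inc_midSet_compl hv)
  have t2 : ∀ᶠ η in 𝓝[>] (0 : ℝ),
      (eLpNorm (inc v) 2 (J.restrict (midSet d η)ᶜ)).toReal * (D + 1) < ε / 2 := by
    have := t1.mul_const (D + 1)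
    simp only [ENNReal.toReal_zero, zero_mul] at this
    exact this.eventually (gt_mem_nhds (by positivity))
  -- η is chosen from the tail of the fixed function v alone, against the uniform bound for the
  -- increments of φ i - ψ. On the remaining pairs the energy of φ i - ψ is controlled by its L²
  -- norm.
  obtain ⟨η, hη, hη0, hη1⟩ := (t2.and (Ioc_mem_nhdsGT one_pos)).exists
  have t3 := (ENNReal.tendsto_toReal ENNReal.zero_ne_top).comp
    (tendsto_eLpNorm_inc_midSet (α := α) hΓ hK hA hη0 hη1
      (fun i => (hφm i).sub hψm) hlim)
  have t4 := t3.const_mul (eLpNorm (inc v) 2 (J.restrict (midSet d η))).toReal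
  simp only [ENNReal.toReal_zero, mul_zero] at t4
  filter_upwards [t4.eventually (gt_mem_nhds (half_pos hε))] with i hi
  rw [Real.dist_eq, sub_zero]
  have a1 := abs_integral_sub_midSet_le hv (hd i) η
  have a2 := abs_integral_mul_le (hv.restrict (midSet d η)) ((hd i).restrict (midSet d η))
  have a3 : (eLpNorm (inc (φ i - ψ)) 2 (J.restrict (midSet d η)ᶜ)).toReal ≤ D + 1 :=
    (ENNReal.toReal_mono (hd i).2.ne (eLpNorm_mono_measure _ Measure.restrict_le_self)).trans
      ((hdB i).trans (by linarith))
  have a4 := mul_le_mul_of_nonneg_left a3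
    (ENNReal.toReal_nonneg (a := eLpNorm (inc v) 2 (J.restrict (midSet d η)ᶜ)))
  have a5 := abs_sub_abs_le_abs_sub (∫ q, inc v q * inc (φ i - ψ) q ∂J)
    (∫ q in midSet d η, inc v q * inc (φ i - ψ) q ∂J)
  simp only [Function.comp] at hi
  linarith

instance sFinite_jumpMeasure {k : Rd d → Rd d → ℝ≥0} : SFinite (jumpMeasure α Γ k) := by
  unfold jumpMeasure; infer_instance

/-! ### Mollification and cut-off -/

/-- Averaging translates of a function does not increase its energy. -/
theorem eLpNorm_inc_average_le (hΓ : MeasurableSet Γ) (hK : Measurable K)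
    {P : Measure (Rd d)} [IsProbabilityMeasure P] {v : Rd d → ℝ} (hv : Measurable v) {M : ℝ}
    (hM : ∀ x, |v x| ≤ M) :
    eLpNorm (inc fun x => ∫ t, v (x - t) ∂P) 2 (levyMeasure α Γ K)
      ≤ eLpNorm (inc v) 2 (levyMeasure α Γ K) := by
  rw [← ENNReal.pow_le_pow_left_iff two_ne_zero, eLpNorm_two_sq, eLpNorm_two_sq]
  have hi : ∀ x, Integrable (fun t => v (x - t)) P := fun x =>
    Integrable.of_bound (by fun_prop : Measurable fun t => v (x - t)).aestronglyMeasurable M (ae_of_all _ fun t => hM _)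
  have hG : Measurable fun q : Rd d × Rd d => ENNReal.ofReal (inc v q ^ 2) := by
    unfold inc; fun_prop
  calc ∫⁻ q, ENNReal.ofReal (inc (fun x => ∫ t, v (x - t) ∂P) q ^ 2) ∂levyMeasure α Γ K
      ≤ ∫⁻ q, ∫⁻ t, ENNReal.ofReal (inc v (q.1 - t, q.2 - t) ^ 2) ∂P ∂levyMeasure α Γ K := by
        refine lintegral_mono fun q => ?_
        simp only [inc]
        rw [← integral_sub (hi _) (hi _), ← eLpNorm_two_sq,
          ← Real.enorm_eq_ofReal (sq_nonneg _), enorm_pow]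
        gcongr
        -- Jensen's inequality, as the comparison of L¹ and L² norms for a probability measure.
        calc _ ≤ eLpNorm (fun t => v (q.1 - t) - v (q.2 - t)) 1 P := by
              rw [eLpNorm_one_eq_lintegral_enorm]; exact enorm_integral_le_lintegral_enorm _
          _ ≤ _ := eLpNorm_le_eLpNorm_of_exponent_le (by norm_num)
              ((hi _).sub (hi _)).aestronglyMeasurable
    _ = ∫⁻ t, ∫⁻ q, ENNReal.ofReal (inc v (q.1 - t, q.2 - t) ^ 2) ∂levyMeasure α Γ K ∂P := by
        refine lintegral_lintegral_swap (Measurable.aemeasurable ?_)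
        unfold inc Function.uncurry; fun_prop
    _ = _ := by
        simp_rw [lintegral_levyMeasure_translate hΓ hK hG]
        simp

/-- A bounded measurable function with bounded support is an `L²` limit of smooth functions with
no more energy. -/
theorem exists_isCcInfty_approx (hΓ : MeasurableSet Γ) (hK : Measurable K) {v : Rd d → ℝ}
    (hv : Measurable v) {M R : ℝ} (hM : ∀ x, |v x| ≤ M)
    (hR : ∀ x, x ∉ Metric.ball (0 : Rd d) R → v x = 0) :
    ∃ φ : ℕ → Rd d → ℝ, (∀ n, IsCcInfty (φ n)) ∧
      Tendsto (fun n => eLpNorm (φ n - v) 2 volume) atTop (𝓝 0) ∧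
      ∀ n, eLpNorm (inc (φ n)) 2 (levyMeasure α Γ K) ≤ eLpNorm (inc v) 2 (levyMeasure α Γ K) := by
  have hM0 : 0 ≤ M := (abs_nonneg _).trans (hM 0)
  -- The outer radius stays twice the inner one, which is what almost everywhere convergence of the
  -- mollifications requires. It is at most 1, so all supports lie in one ball.
  let b : ℕ → ContDiffBump (0 : Rd d) := fun n =>
    ⟨1 / (2 * (n + 1)), 1 / (n + 1), by positivity, by
      apply one_div_lt_one_div_of_lt <;> linarith [Nat.cast_nonneg (α := ℝ) n]⟩
  have hb1 : ∀ n, (b n).rOut ≤ 1 := fun n => by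
    simp only [b]
    exact div_le_one_of_le₀ (by linarith [Nat.cast_nonneg (α := ℝ) n]) (by positivity)
  let ρ : ℕ → Rd d → ℝ := fun n => (b n).normed volume
  have hρ0 : ∀ n t, 0 ≤ ρ n t := fun n t => (b n).nonneg_normed t
  have hρc : ∀ n, Continuous (ρ n) := fun n => (b n).continuous_normed
  -- Convolution with ρ n is an average of translates under the probability P n, so it does not
  -- increase the energy.
  let P : ℕ → Measure (Rd d) := fun n => volume.withDensity fun t => ENNReal.ofReal (ρ n t)
  have hP : ∀ n, IsProbabilityMeasure (P n) := fun n => ⟨by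
    rw [withDensity_apply _ MeasurableSet.univ, Measure.restrict_univ,
      ← ofReal_integral_eq_lintegral_ofReal (b n).integrable_normed (ae_of_all _ (hρ0 n)),
      (b n).integral_normed, ENNReal.ofReal_one]⟩
  let φ : ℕ → Rd d → ℝ := fun n =>
    MeasureTheory.convolution (ρ n) v (ContinuousLinearMap.lsmul ℝ ℝ) volume
  have hφ : ∀ n, φ n = fun x => ∫ t, v (x - t) ∂P n := by
    intro n
    ext x
    simp only [φ, convolution_def, P, ContinuousLinearMap.lsmul_apply]
    rw [integral_withDensity_eq_integral_toReal_smul (by have := hρc n; fun_prop)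
      (ae_of_all _ fun _ => ENNReal.ofReal_lt_top)]
    refine integral_congr_ae (ae_of_all _ fun t => ?_)
    simp only [ENNReal.toReal_ofReal (hρ0 n t)]
  have hvi : Integrable v volume := by
    have : IntegrableOn v (Metric.ball 0 R) volume :=
      Measure.integrableOn_of_bounded measure_ball_lt_top.ne hv.aestronglyMeasurable
        (M := M) (ae_of_all _ hM)
    refine this.integrable_of_forall_notMem_eq_zero hR
  have hvc : HasCompactSupport v :=
    HasCompactSupport.of_support_subset_isCompact (isCompact_closedBall (0 : Rd d) R)
      fun x hx => by
        by_contra h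
        exact hx (hR x fun h' => h (Metric.ball_subset_closedBall h'))
  have hφM : ∀ n x, |φ n x| ≤ M := fun n x => by
    have := hP n
    rw [hφ n]
    simpa using norm_integral_le_of_norm_le_const (μ := P n) (f := fun t => v (x - t)) (C := M)
      (ae_of_all _ fun t => hM _)
  have hφR : ∀ n x, x ∉ Metric.ball (0 : Rd d) (R + 1) → φ n x = 0 := by
    intro n x hx
    refine integral_eq_zero_of_ae (ae_of_all _ fun t => ?_)
    by_cases ht : t ∈ Metric.ball (0 : Rd d) (b n).rOut
    · have : v (x - t) = 0 := by
        refine hR _ fun h => hx ?_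
        rw [mem_ball_zero_iff] at *
        have := norm_add_le (x - t) t
        rw [sub_add_cancel] at this
        linarith [hb1 n]
      simp [this]
    · have : ρ n t = 0 := by
        rw [← (b n).support_normed_eq (μ := volume)] at ht
        simpa using ht
      simp [this]
  have hae : ∀ᵐ x, Tendsto (fun n => φ n x) atTop (𝓝 (v x)) := by
    refine ContDiffBump.ae_convolution_tendsto_right_of_locallyIntegrable (K := 2)
      tendsto_one_div_add_atTop_nhds_zero_nat (Eventually.of_forall fun n => ?_)
      hvi.locallyIntegrable
    simp only [b]
    apply le_of_eq; field_simp
  have hφs : ∀ n, IsCcInfty (φ n) := fun n =>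
    ⟨(b n).hasCompactSupport_normed.contDiff_convolution_left _ (b n).contDiff_normed
      hvi.locallyIntegrable, (b n).hasCompactSupport_normed.convolution _ hvc⟩
  refine ⟨φ, hφs, ?_, fun n => ?_⟩
  · rw [← tendsto_sq_iff]
    simp_rw [eLpNorm_two_sq]
    rw [← lintegral_zero (μ := (volume : Measure (Rd d)))]
    refine tendsto_lintegral_of_dominated_convergence
      ((Metric.ball (0 : Rd d) (R + 1)).indicator fun _ => ENNReal.ofReal ((2 * M) ^ 2))
      (fun n => ?_) (fun n => ae_of_all _ fun x => ?_) ?_ ?_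
    · have := (hφs n).1.continuous.measurable
      simp only [Pi.sub_apply]; fun_prop
    · by_cases hx : x ∈ Metric.ball (0 : Rd d) (R + 1)
      · rw [indicator_of_mem hx]
        refine ENNReal.ofReal_le_ofReal ?_
        rw [← sq_abs]
        refine pow_le_pow_left₀ (abs_nonneg _) ?_ 2
        have := abs_sub (φ n x) (v x)
        simp only [Pi.sub_apply]
        linarith [hφM n x, hM x]
      · have : v x = 0 := hR x fun h => hx (Metric.ball_subset_ball (by linarith) h)
        simp [hφR n x hx, this]
    · rw [lintegral_indicator Metric.isOpen_ball.measurableSet, setLIntegral_const]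
      exact (ENNReal.mul_lt_top ENNReal.ofReal_lt_top measure_ball_lt_top).ne
    · filter_upwards [hae] with x hx
      have h1 : Tendsto (fun n => (φ n x - v x) ^ 2) atTop (𝓝 0) := by
        simpa using (hx.sub_const (v x)).pow 2
      simpa [Function.comp_def] using (ENNReal.continuous_ofReal.tendsto 0).comp h1
  · have := hP n
    rw [hφ n]
    exact eLpNorm_inc_average_le hΓ hK hv hM

/-- The piecewise linear cut-off at radius `R`. -/
def cutoff (R : ℝ) (x : Rd d) : ℝ := max 0 (min 1 (2 - ‖x‖ / R))

theorem continuous_cutoff (R : ℝ) : Continuous (cutoff R : Rd d → ℝ) := by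
  unfold cutoff; fun_prop

theorem cutoff_nonneg (R : ℝ) (x : Rd d) : 0 ≤ cutoff R x := le_max_left _ _

theorem cutoff_le_one (R : ℝ) (x : Rd d) : cutoff R x ≤ 1 := max_le zero_le_one (min_le_left _ _)

theorem cutoff_eq_one {R : ℝ} (hR : 0 < R) {x : Rd d} (hx : ‖x‖ ≤ R) : cutoff R x = 1 := by
  have : ‖x‖ / R ≤ 1 := div_le_one_of_le₀ hx hR.le
  rw [cutoff, min_eq_left (by linarith), max_eq_right zero_le_one]

theorem cutoff_eq_zero {R : ℝ} (hR : 0 < R) {x : Rd d} (hx : x ∉ Metric.ball (0 : Rd d) (2 * R)) :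
    cutoff R x = 0 := by
  have h : 2 * R ≤ ‖x‖ := by simpa using hx
  have : 2 ≤ ‖x‖ / R := (le_div_iff₀ hR).2 h
  rw [cutoff, max_eq_left]
  exact (min_le_right _ _).trans (by linarith)

theorem cutoff_sub_sq_le {R : ℝ} (hR : 1 ≤ R) (x y : Rd d) :
    (cutoff R x - cutoff R y) ^ 2 ≤ min 1 (‖x - y‖ ^ 2) := by
  refine le_min ?_ ?_
  · have h1 := cutoff_nonneg R x
    have h2 := cutoff_nonneg R y
    have h3 := cutoff_le_one R x
    have h4 := cutoff_le_one R y
    nlinarith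
  · refine sq_le_sq' ?_ ?_ <;>
    · have hR0 : 0 < R := by linarith
      have h : |‖x‖ / R - ‖y‖ / R| ≤ ‖x - y‖ := by
        rw [← sub_div, abs_div, abs_of_pos hR0]
        exact (div_le_self (abs_nonneg _) hR).trans (abs_norm_sub_norm_le x y)
      have h0 := norm_nonneg (x - y)
      have := abs_le.1 h
      unfold cutoff
      rcases max_cases 0 (min 1 (2 - ‖x‖ / R)) with a | a <;>
      rcases max_cases 0 (min 1 (2 - ‖y‖ / R)) with b | b <;>
      rcases min_cases 1 (2 - ‖x‖ / R) with e | e <;>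
      rcases min_cases 1 (2 - ‖y‖ / R) with f | f <;> linarith

/-- Leibniz rule: with χ the cut-off, inc (χ v) = χ(x) inc v + v(y) inc χ. The first term is
dominated by inc v. In the second, (inc χ)² ≤ 1 ∧ |x-y|² for every R ≥ 1, whence a bound independent
of R. -/
theorem eLpNorm_inc_cutoff_mul_le (hΓ : MeasurableSet Γ) (hK : Measurable K) {v : Rd d → ℝ}
    (hv : Measurable v) {R : ℝ} (hR : 1 ≤ R) :
    eLpNorm (inc (cutoff R * v)) 2 (levyMeasure α Γ K) ≤ eLpNorm (inc v) 2 (levyMeasure α Γ K) +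
      (eLpNorm v 2 volume ^ 2 * levyMass α Γ K) ^ (1 / 2 : ℝ) := by
  have hc := (continuous_cutoff (d := d) R).measurable
  have hvi : Measurable (inc v) := by unfold inc; fun_prop
  set w : Rd d × Rd d → ℝ := fun q => v q.2 * (cutoff R q.1 - cutoff R q.2) with hw
  have hwm : Measurable w := by fun_prop
  set z : Rd d × Rd d → ℝ := fun q => cutoff R q.1 * inc v q
  have hzm : Measurable z := by fun_prop
  have hsum : inc (cutoff R * v) = z + w := by
    ext q; simp only [inc, z, w, Pi.mul_apply, Pi.add_apply]; ring
  rw [hsum]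
  refine (eLpNorm_add_le hzm.aestronglyMeasurable hwm.aestronglyMeasurable (by norm_num)).trans
    (add_le_add (eLpNorm_mono fun q => ?_) ?_)
  · simp only [z, norm_mul, Real.norm_eq_abs, abs_of_nonneg (cutoff_nonneg R q.1)]
    exact mul_le_of_le_one_left (abs_nonneg _) (cutoff_le_one R _)
  · rw [one_div, ENNReal.le_rpow_inv_iff two_pos, ENNReal.rpow_two, eLpNorm_two_sq,
      eLpNorm_two_sq, ← lintegral_levyMeasure_snd hΓ hK (by fun_prop)]
    refine lintegral_mono fun q => ?_
    rw [← ENNReal.ofReal_mul (sq_nonneg _)]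
    refine ENNReal.ofReal_le_ofReal ?_
    rw [hw, mul_pow]
    exact mul_le_mul_of_nonneg_left (cutoff_sub_sq_le hR _ _) (sq_nonneg _)

theorem abs_cutoff_mul_le (R : ℝ) (v : Rd d → ℝ) (x : Rd d) :
    |((cutoff R : Rd d → ℝ) * v) x| ≤ |v x| := by
  rw [Pi.mul_apply, abs_mul, abs_of_nonneg (cutoff_nonneg R x)]
  exact mul_le_of_le_one_left (abs_nonneg _) (cutoff_le_one R _)

theorem tendsto_eLpNorm_cutoff_mul_sub {v : Rd d → ℝ} (hv : Measurable v)
    (hv2 : MemLp v 2 volume) :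
    Tendsto (fun n : ℕ => eLpNorm (cutoff ((n : ℝ) + 1) * v - v) 2 volume) atTop (𝓝 0) := by
  rw [← tendsto_sq_iff]
  simp_rw [eLpNorm_two_sq]
  rw [← lintegral_zero (μ := (volume : Measure (Rd d)))]
  refine tendsto_lintegral_of_dominated_convergence (fun x => ENNReal.ofReal (v x ^ 2))
    (fun n => ?_) (fun n => ae_of_all _ fun x => ENNReal.ofReal_le_ofReal ?_) ?_ ?_
  · have := (continuous_cutoff (d := d) ((n : ℝ) + 1)).measurable
    simp only [Pi.sub_apply, Pi.mul_apply]; fun_prop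
  · simp only [Pi.sub_apply, Pi.mul_apply]
    have a1 := cutoff_nonneg ((n : ℝ) + 1) x
    have a2 := cutoff_le_one ((n : ℝ) + 1) x
    rw [show cutoff ((n : ℝ) + 1) x * v x - v x = (cutoff ((n : ℝ) + 1) x - 1) * v x by ring,
      mul_pow]
    exact mul_le_of_le_one_left (sq_nonneg _) (by nlinarith)
  · rw [← eLpNorm_two_sq]; exact (ENNReal.pow_lt_top hv2.2).ne
  · refine ae_of_all _ fun x => tendsto_const_nhds.congr' ?_
    obtain ⟨N, hN⟩ := exists_nat_ge ‖x‖
    filter_upwards [eventually_ge_atTop N] with n hn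
    have : (N : ℝ) ≤ n := by exact_mod_cast hn
    simp [cutoff_eq_one (R := (n : ℝ) + 1) (by positivity) (x := x) (by linarith)]

/-- Uniqueness for the weak equation tested against smooth functions only. -/
theorem ae_eq_zero_of_forall_isCcInfty (hΓ : MeasurableSet Γ) (hK : Measurable K)
    (hA : levyMass α Γ K < ∞) {lam : ℝ} (hl : 0 < lam) {v : Rd d → ℝ} (hv : Measurable v) {M : ℝ}
    (hM : ∀ x, |v x| ≤ M) (hv2 : MemLp v 2 volume) (hvi : MemLp (inc v) 2 (levyMeasure α Γ K))
    (h : ∀ g, IsCcInfty g →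
      lam * (∫ x, v x * g x) + 1 / 2 * ∫ q, inc v q * inc g q ∂levyMeasure α Γ K = 0) :
    v =ᵐ[volume] 0 := by
  set J := levyMeasure α Γ K with hJ
  have hcm : ∀ R, Measurable (cutoff (d := d) R) := fun R => (continuous_cutoff R).measurable
  set B : ℝ≥0∞ := eLpNorm (inc v) 2 J + (eLpNorm v 2 volume ^ 2 * levyMass α Γ K) ^ (1 / 2 : ℝ)
  have hB : B ≠ ∞ := by
    refine ENNReal.add_ne_top.2 ⟨hvi.2.ne, ENNReal.rpow_ne_top_of_nonneg (by norm_num) ?_⟩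
    exact ENNReal.mul_ne_top (ENNReal.pow_ne_top hv2.2.ne) hA.ne
  have hcv2 : ∀ R, MemLp (cutoff R * v) 2 volume := fun R =>
    hv2.mono ((hcm R).mul hv).aestronglyMeasurable (ae_of_all _ (abs_cutoff_mul_le R v))
  have hcvi : ∀ R, 1 ≤ R → MemLp (inc (cutoff R * v)) 2 J := fun R hR => by
    refine ⟨?_, (eLpNorm_inc_cutoff_mul_le hΓ hK hv hR).trans_lt hB.lt_top⟩
    have := hcm R
    have : Measurable (inc (cutoff R * v)) := by unfold inc; simp only [Pi.mul_apply]; fun_prop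
    exact this.aestronglyMeasurable
  -- χ v is bounded with bounded support, so it is an L² limit of smooth functions with no more
  -- energy than itself; bounded energies suffice to pass to the limit in the form.
  have step1 : ∀ R, 1 ≤ R → lam * (∫ x, v x * ((cutoff R : Rd d → ℝ) * v) x) +
      1 / 2 * ∫ q, inc v q * inc (cutoff R * v) q ∂J = 0 := by
    intro R hR
    obtain ⟨φ, h1, h2, h3⟩ := exists_isCcInfty_approx (α := α) hΓ hK ((hcm R).mul hv)
      (fun x => (abs_cutoff_mul_le R v x).trans (hM x))
      (fun x hx => by rw [Pi.mul_apply, cutoff_eq_zero (by linarith) hx, zero_mul])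
    have hφ2 : ∀ n, MemLp (φ n) 2 volume := fun n =>
      (h1 n).1.continuous.memLp_of_hasCompactSupport (h1 n).2
    have t1 := tendsto_integral_mul_of_L2 (l := atTop) (fun _ => hv2) hv2 hφ2 (hcv2 R)
      (by simp) h2
    have t2 := tendsto_integral_inc_of_bounded hΓ hK hA hvi (hcvi R hR)
      (fun n => (h1 n).memLp_inc hΓ hK hA) ((hcm R).mul hv)
      (fun n => (h1 n).1.continuous.measurable) (hcvi R hR).2.ne h3 h2
    refine tendsto_nhds_unique ((t1.const_mul lam).add (t2.const_mul (1 / 2))) ?_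
    refine tendsto_const_nhds.congr fun n => (h (φ n) (h1 n)).symm
  have hR := tendsto_eLpNorm_cutoff_mul_sub hv hv2
  have hn1 : ∀ n : ℕ, (1 : ℝ) ≤ n + 1 := fun n => by linarith [Nat.cast_nonneg (α := ℝ) n]
  have t1 := tendsto_integral_mul_of_L2 (l := atTop) (fun _ => hv2) hv2
    (fun n : ℕ => hcv2 (n + 1)) hv2 (by simp) hR
  -- Letting R = n + 1 → ∞, with the energy bound B common to all cut-offs, makes v itself a test
  -- function.
  have t2 := tendsto_integral_inc_of_bounded hΓ hK hA hvi hvi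
      (fun n : ℕ => hcvi (n + 1) (hn1 n)) hv
      (fun n => (hcm _).mul hv) hB (fun n => eLpNorm_inc_cutoff_mul_le hΓ hK hv (hn1 n)) hR
  have hfin : lam * (∫ x, v x * v x) + 1 / 2 * ∫ q, inc v q * inc v q ∂J = 0 := by
    refine tendsto_nhds_unique ((t1.const_mul lam).add (t2.const_mul (1 / 2))) ?_
    exact tendsto_const_nhds.congr fun n => (step1 (n + 1) (hn1 n)).symm
  have p1 : 0 ≤ ∫ q, inc v q * inc v q ∂J := integral_nonneg fun q => mul_self_nonneg _
  have p2 : 0 ≤ ∫ x, v x * v x := integral_nonneg fun q => mul_self_nonneg _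
  refine ae_eq_zero_of_integral_sq_add (J := 0) hv2 ?_
  rw [integral_zero_measure, add_zero]
  by_contra hcon
  push Not at hcon
  have := mul_pos hl hcon
  linarith

end

section

variable {d : ℕ} {Ω : Type*} [MeasurableSpace Ω] {P : Measure Ω} {τ : Rd d → Ω → Ω}

/-! ### The maximal inequality -/

/-- The weak type inequality for averages over balls of integer radii. -/
theorem mul_measure_le_of_forall_exists_lt (φ : Rd d → ℝ≥0∞) (t : ℝ≥0∞)
    {N : ℕ} {L : ℝ} (E : Set (Rd d)) (hE : E ⊆ Metric.closedBall 0 L)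
    (h : ∀ x ∈ E, ∃ n < N, t * ((n : ℝ≥0∞) + 1) ^ d
      < ∫⁻ y in Metric.closedBall x ((n : ℝ) + 1), φ y) :
    t * volume E ≤ (5 ^ d * volume (Metric.ball (0 : Rd d) 1)) *
      ∫⁻ y in Metric.closedBall 0 (L + N), φ y := by
  classical
  have h' : ∀ x, ∃ n : ℕ, x ∈ E → n < N ∧ t * ((n : ℝ≥0∞) + 1) ^ d
      < ∫⁻ y in Metric.closedBall x ((n : ℝ) + 1), φ y := fun x => by
    by_cases hx : x ∈ E
    · obtain ⟨n, h1, h2⟩ := h x hx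
      exact ⟨n, fun _ => ⟨h1, h2⟩⟩
    · exact ⟨0, fun h => absurd h hx⟩
  choose n hn using h'
  have hnN : ∀ a ∈ E, (n a : ℝ) + 1 ≤ N := fun a ha => by exact_mod_cast (hn a ha).1
  -- The radii are bounded by N, so Vitali's lemma selects disjoint balls whose fivefold
  -- enlargements cover E. This is the origin of the constant 5^d |B(0,1)|.
  obtain ⟨u, huE, hdisj, hcov⟩ := Vitali.exists_disjoint_subfamily_covering_enlargement_closedBall
    E id (fun x => (n x : ℝ) + 1) N hnN 5 (by norm_num)
  have hucount : u.Countable := by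
    refine hdisj.countable_of_nonempty_interior fun x _ => ?_
    exact ⟨x, Metric.ball_subset_interior_closedBall (Metric.mem_ball_self (by positivity))⟩
  have hEu : E ⊆ ⋃ x ∈ u, Metric.closedBall x (5 * ((n x : ℝ) + 1)) := by
    intro a ha
    obtain ⟨b, hb, hab⟩ := hcov a ha
    exact mem_biUnion hb (hab (Metric.mem_closedBall_self (by positivity)))
  have := hucount.to_subtype
  calc t * volume E ≤ t * ∑' x : u, volume (Metric.closedBall (x : Rd d) (5 * ((n x : ℝ) + 1))) := by
        gcongr
        exact (measure_mono hEu).trans (measure_biUnion_le _ hucount _)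
    _ = ∑' x : u, (5 ^ d * volume (Metric.ball (0 : Rd d) 1)) *
          (t * ((n x : ℝ≥0∞) + 1) ^ d) := by
        rw [← ENNReal.tsum_mul_left]
        refine tsum_congr fun x => ?_
        rw [Measure.addHaar_closedBall _ _ (by positivity), finrank_euclideanSpace,
          Fintype.card_fin, mul_pow, ENNReal.ofReal_mul (by positivity),
          ENNReal.ofReal_pow (by positivity), ENNReal.ofReal_pow (by positivity)]
        have : ENNReal.ofReal ((n x : ℝ) + 1) = (n x : ℝ≥0∞) + 1 := by
          rw [ENNReal.ofReal_add (by positivity) zero_le_one]; simp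
        rw [this]
        have : ENNReal.ofReal 5 = 5 := by simp
        rw [this]; ring
    _ ≤ ∑' x : u, (5 ^ d * volume (Metric.ball (0 : Rd d) 1)) *
          ∫⁻ y in Metric.closedBall (x : Rd d) ((n x : ℝ) + 1), φ y := by
        gcongr with x
        exact (hn x (huE x.2)).2.le
    _ = (5 ^ d * volume (Metric.ball (0 : Rd d) 1)) *
          ∫⁻ y in ⋃ x ∈ u, Metric.closedBall x ((n x : ℝ) + 1), φ y := by
        rw [ENNReal.tsum_mul_left, lintegral_biUnion (f := φ) hucount
          (s := fun x => Metric.closedBall x ((n x : ℝ) + 1))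
          (fun x _ => Metric.isClosed_closedBall.measurableSet) hdisj]
    _ ≤ _ := by
        gcongr
        refine iUnion₂_subset fun x hx => Metric.closedBall_subset_closedBall' ?_
        have h1 := hnN x (huE hx)
        have h2 : dist x 0 ≤ L := hE (huE hx)
        linarith

/-- The maximal function along the flow, over balls of integer radii. -/
def maximalFlow (τ : Rd d → Ω → Ω) (F : Ω → ℝ≥0∞) (ω : Ω) : ℝ≥0∞ :=
  ⨆ n : ℕ, (∫⁻ x in Metric.closedBall 0 ((n : ℝ) + 1), F (τ x ω)) / ((n : ℝ≥0∞) + 1) ^ d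

namespace IsStationaryErgodic

theorem measurable_comp (hτ : IsStationaryErgodic P τ) {β : Type*} [MeasurableSpace β] {F : Ω → β}
    (hF : Measurable F) : Measurable fun q : Rd d × Ω => F (τ q.1 q.2) := hF.comp hτ.measurable

theorem measurable_map (hτ : IsStationaryErgodic P τ) (x : Rd d) : Measurable (τ x) :=
  hτ.measurable.comp (measurable_const.prodMk measurable_id)

theorem image_eq_preimage (hτ : IsStationaryErgodic P τ) (x : Rd d) (A : Set Ω) :
    τ x '' A = τ (-x) ⁻¹' A := by
  ext ω
  constructor
  · rintro ⟨ω', h, rfl⟩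
    simpa [hτ.add, hτ.zero] using h
  · intro h
    exact ⟨_, h, by simp [hτ.add, hτ.zero]⟩

theorem measurePreserving (hτ : IsStationaryErgodic P τ) (x : Rd d) :
    MeasurePreserving (τ x) P P := by
  refine ⟨hτ.measurable_map x, Measure.ext fun A hA => ?_⟩
  rw [Measure.map_apply (hτ.measurable_map x) hA, ← hτ.stationary (-x) A hA,
    hτ.image_eq_preimage, neg_neg]

theorem measurable_ballIntegral (hτ : IsStationaryErgodic P τ) {F : Ω → ℝ≥0∞} (hF : Measurable F)
    (S : Set (Rd d)) : Measurable fun ω => ∫⁻ x in S, F (τ x ω) :=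
  (hτ.measurable_comp hF).lintegral_prod_left

theorem lintegral_ballIntegral [SFinite P] (hτ : IsStationaryErgodic P τ) {F : Ω → ℝ≥0∞}
    (hF : Measurable F) (S : Set (Rd d)) :
    ∫⁻ ω, (∫⁻ x in S, F (τ x ω)) ∂P = volume S * ∫⁻ ω, F ω ∂P := by
  rw [lintegral_lintegral_swap (f := fun ω x => F (τ x ω))
    ((hτ.measurable_comp hF).comp measurable_swap).aemeasurable]
  simp_rw [(hτ.measurePreserving _).lintegral_comp hF]
  rw [lintegral_const, Measure.restrict_apply_univ, mul_comm]

/-- Transference. The inequality on ℝ^d is applied along each orbit to the x in B(0,L) with τ_x ω in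
the exceptional event, then integrated over ω. By stationarity |B(0,L)| appears on the left and
|B(0,L+N)| on the right, and their ratio tends to 1 as L → ∞. The restriction n < N keeps the
enlargement of the ball bounded. -/
theorem maximal_inequality_aux [SFinite P] (hτ : IsStationaryErgodic P τ) {F : Ω → ℝ≥0∞}
    (hF : Measurable F) (t : ℝ≥0∞) (N : ℕ) :
    t * P {ω | ∃ n < N, t * ((n : ℝ≥0∞) + 1) ^ d
        < ∫⁻ x in Metric.closedBall 0 ((n : ℝ) + 1), F (τ x ω)}
      ≤ (5 ^ d * volume (Metric.ball (0 : Rd d) 1)) * ∫⁻ ω, F ω ∂P := by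
  set D := {ω | ∃ n < N, t * ((n : ℝ≥0∞) + 1) ^ d
        < ∫⁻ x in Metric.closedBall 0 ((n : ℝ) + 1), F (τ x ω)} with hD
  set c := 5 ^ d * volume (Metric.ball (0 : Rd d) 1)
  have hDm : MeasurableSet D := by
    have : D = ⋃ n ∈ {n | n < N}, {ω | t * ((n : ℝ≥0∞) + 1) ^ d
        < ∫⁻ x in Metric.closedBall 0 ((n : ℝ) + 1), F (τ x ω)} := by
      ext ω; simp [hD]
    rw [this]
    exact MeasurableSet.biUnion (to_countable _) fun n _ =>
      measurableSet_lt measurable_const (hτ.measurable_ballIntegral hF _)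
  have key : ∀ j : ℕ, t * P D ≤
      ENNReal.ofReal (1 + N / ((j : ℝ) + 1)) ^ d * (c * ∫⁻ ω, F ω ∂P) := by
    intro j
    set L : ℝ := (j : ℝ) + 1
    have hL : 0 < L := by positivity
    set b := volume (Metric.closedBall (0 : Rd d) L)
    have hb0 : b ≠ 0 := (Metric.measure_closedBall_pos _ _ hL).ne'
    have hbt : b ≠ ∞ := measure_closedBall_lt_top.ne
    have e1 : b * (t * P D) ≤ c * (volume (Metric.closedBall (0 : Rd d) (L + N)) * ∫⁻ ω, F ω ∂P) := by
      have s1 : b * P D = ∫⁻ ω, volume (Metric.closedBall 0 L ∩ {x | τ x ω ∈ D}) ∂P := by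
        have := hτ.lintegral_ballIntegral (F := D.indicator 1) (measurable_one.indicator hDm)
          (Metric.closedBall (0 : Rd d) L)
        rw [lintegral_indicator_one hDm] at this
        rw [← this]
        refine lintegral_congr fun ω => ?_
        have hm : MeasurableSet {x | τ x ω ∈ D} :=
          (hτ.measurable.comp (measurable_id.prodMk measurable_const)) hDm
        have : ∀ x, D.indicator (1 : Ω → ℝ≥0∞) (τ x ω) = {x | τ x ω ∈ D}.indicator 1 x :=
          fun x => rfl
        simp_rw [this]
        rw [lintegral_indicator_one hm, Measure.restrict_apply hm, inter_comm]
      calc b * (t * P D) = t * (b * P D) := by ring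
        _ = ∫⁻ ω, t * volume (Metric.closedBall 0 L ∩ {x | τ x ω ∈ D}) ∂P := by
            rw [s1, lintegral_const_mul]
            have : MeasurableSet {q : Ω × Rd d | q.2 ∈ Metric.closedBall 0 L ∧ τ q.2 q.1 ∈ D} :=
              (measurable_snd Metric.isClosed_closedBall.measurableSet).inter
                ((hτ.measurable.comp measurable_swap) hDm)
            exact measurable_measure_prodMk_left this
        _ ≤ ∫⁻ ω, c * (∫⁻ x in Metric.closedBall 0 (L + N), F (τ x ω)) ∂P := by
            refine lintegral_mono fun ω => ?_
            refine mul_measure_le_of_forall_exists_lt _ t _ inter_subset_left ?_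
            rintro x ⟨-, n, hn, hx⟩
            refine ⟨n, hn, hx.trans_eq ?_⟩
            simp_rw [hτ.add]
            rw [← lintegral_indicator Metric.isClosed_closedBall.measurableSet,
              ← lintegral_indicator Metric.isClosed_closedBall.measurableSet,
              ← lintegral_add_right_eq_self (fun y => (Metric.closedBall x _).indicator _ y) x]
            refine lintegral_congr fun y => ?_
            simp only [indicator, mem_closedBall_iff_norm, sub_zero, add_sub_cancel_right]
        _ = _ := by
            rw [lintegral_const_mul _ (hτ.measurable_ballIntegral hF _),
              hτ.lintegral_ballIntegral hF]
    have e2 : volume (Metric.closedBall (0 : Rd d) (L + N))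
        = ENNReal.ofReal (1 + N / L) ^ d * b := by
      rw [Measure.addHaar_closedBall _ _ (by positivity),
        show b = _ from Measure.addHaar_closedBall _ _ hL.le, ← mul_assoc,
        ← ENNReal.ofReal_pow (by positivity), ← ENNReal.ofReal_mul (by positivity),
        finrank_euclideanSpace, Fintype.card_fin, ← mul_pow]
      congr 3; field_simp
    rw [e2] at e1
    have e3 : b * (t * P D) ≤ b * (ENNReal.ofReal (1 + N / L) ^ d * (c * ∫⁻ ω, F ω ∂P)) :=
      e1.trans_eq (by ring)
    exact (ENNReal.mul_le_mul_iff_right hb0 hbt).1 e3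
  have hlim : Tendsto (fun j : ℕ => ENNReal.ofReal (1 + N / ((j : ℝ) + 1)) ^ d) atTop (𝓝 1) := by
    have h1 : Tendsto (fun j : ℕ => 1 + (N : ℝ) / ((j : ℝ) + 1)) atTop (𝓝 1) := by
      have := (tendsto_one_div_add_atTop_nhds_zero_nat (𝕜 := ℝ)).const_mul (N : ℝ)
      simpa [div_eq_mul_inv] using this.const_add 1
    have h2 := (ENNReal.continuous_pow d).continuousAt.tendsto.comp
      ((ENNReal.continuous_ofReal.tendsto _).comp h1)
    simpa [Function.comp_def] using h2
  by_cases hfin : c * ∫⁻ ω, F ω ∂P = ∞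
  · rw [hfin]; exact le_top
  · have hl := ENNReal.Tendsto.mul_const hlim (Or.inr hfin)
    rw [one_mul] at hl
    exact ge_of_tendsto' hl key

/-- The maximal inequality of weak type `(1,1)` along the flow. -/
theorem maximal_inequality [SFinite P] (hτ : IsStationaryErgodic P τ) {F : Ω → ℝ≥0∞}
    (hF : Measurable F) (t : ℝ≥0∞) :
    t * P {ω | t < maximalFlow τ F ω}
      ≤ (5 ^ d * volume (Metric.ball (0 : Rd d) 1)) * ∫⁻ ω, F ω ∂P := by
  set D : ℕ → Set Ω := fun N => {ω | ∃ n < N, t * ((n : ℝ≥0∞) + 1) ^ d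
        < ∫⁻ x in Metric.closedBall 0 ((n : ℝ) + 1), F (τ x ω)} with hD
  have hmono : Monotone D := fun a b hab ω ⟨n, hn, h⟩ => ⟨n, hn.trans_le hab, h⟩
  have hU : {ω | t < maximalFlow τ F ω} = ⋃ N, D N := by
    ext ω
    simp only [mem_ofPred_eq, maximalFlow, lt_iSup_iff, mem_iUnion, hD]
    have hiff : ∀ n : ℕ, t < (∫⁻ x in Metric.closedBall 0 ((n : ℝ) + 1), F (τ x ω)) /
        ((n : ℝ≥0∞) + 1) ^ d ↔ t * ((n : ℝ≥0∞) + 1) ^ d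
          < ∫⁻ x in Metric.closedBall 0 ((n : ℝ) + 1), F (τ x ω) := fun n =>
      ENNReal.lt_div_iff_mul_lt (Or.inl (by positivity)) (Or.inl (by finiteness))
    simp_rw [hiff]
    exact ⟨fun ⟨n, h⟩ => ⟨n + 1, n, Nat.lt_succ_self n, h⟩, fun ⟨_, n, _, h⟩ => ⟨n, h⟩⟩
  rw [hU, hmono.measure_iUnion, ENNReal.mul_iSup]
  exact iSup_le fun N => hτ.maximal_inequality_aux hF t N

theorem ae_maximalFlow_lt_top [IsFiniteMeasure P] (hτ : IsStationaryErgodic P τ) {F : Ω → ℝ≥0∞}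
    (hF : Measurable F) (hfin : ∫⁻ ω, F ω ∂P < ∞) : ∀ᵐ ω ∂P, maximalFlow τ F ω < ∞ := by
  set C := (5 ^ d * volume (Metric.ball (0 : Rd d) 1)) * ∫⁻ ω, F ω ∂P
  have hC : C ≠ ∞ := ENNReal.mul_ne_top
    (ENNReal.mul_ne_top (by finiteness) measure_ball_lt_top.ne) hfin.ne
  rw [ae_iff]
  by_contra h
  set p := P {ω | ¬maximalFlow τ F ω < ∞}
  have hp : p ≠ ∞ := measure_ne_top _ _
  have hb : ∀ n : ℕ, (n : ℝ≥0∞) ≤ C / p := fun n => by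
    rw [ENNReal.le_div_iff_mul_le (Or.inl h) (Or.inl hp)]
    refine le_trans ?_ (hτ.maximal_inequality hF n)
    refine mul_le_mul_right (measure_mono fun ω hω => ?_) _
    exact (ENNReal.natCast_lt_top n).trans_le (not_lt.1 hω)
  obtain ⟨n, hn⟩ := ENNReal.exists_nat_gt (ENNReal.div_ne_top hC h)
  exact absurd (hb n) (not_le.2 hn)

end IsStationaryErgodic

theorem lintegral_comp_inv_smul {ε : ℝ} (hε : 0 < ε) {G : Rd d → ℝ≥0∞} (hG : Measurable G) :
    ∫⁻ x, G (ε⁻¹ • x) = ENNReal.ofReal (ε ^ d) * ∫⁻ x, G x := by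
  have h0 : ε⁻¹ ≠ 0 := by positivity
  rw [← lintegral_map hG (measurable_const_smul _), Measure.map_addHaar_smul _ h0,
    lintegral_smul_measure, finrank_euclideanSpace, Fintype.card_fin]
  congr 2
  rw [inv_pow, inv_inv, abs_of_nonneg (by positivity)]

/-- Rescaled integrals over balls are controlled by the maximal function. -/
theorem setLIntegral_scaled_le_maximalFlow {Ω : Type*} {τ : Rd d → Ω → Ω} {F : Ω → ℝ≥0∞} {ω : Ω}
    (hF : Measurable fun x => F (τ x ω)) {ε R : ℝ} (hε : 0 < ε) :
    ∫⁻ x in Metric.ball 0 R, F (τ (ε⁻¹ • x) ω)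
      ≤ ENNReal.ofReal ((|R| + 2 * ε) ^ d) * maximalFlow τ F ω := by
  -- The rescaled ball has radius R/ε, below n + 1, and ε(n + 1) ≤ |R| + 2ε. This is how arbitrary ε
  -- reduces to integer radii.
  set n := ⌈|R| / ε⌉₊
  have hn : |R| / ε ≤ n := Nat.le_ceil _
  have hn2 : (n : ℝ) < |R| / ε + 1 := Nat.ceil_lt_add_one (by positivity)
  calc ∫⁻ x in Metric.ball 0 R, F (τ (ε⁻¹ • x) ω)
      ≤ ∫⁻ x, (Metric.closedBall (0 : Rd d) ((n : ℝ) + 1)).indicator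
          (fun y => F (τ y ω)) (ε⁻¹ • x) := by
        rw [← lintegral_indicator Metric.isOpen_ball.measurableSet]
        refine lintegral_mono fun x => ?_
        by_cases hx : x ∈ Metric.ball (0 : Rd d) R
        · have : ε⁻¹ • x ∈ Metric.closedBall (0 : Rd d) ((n : ℝ) + 1) := by
            rw [mem_closedBall_zero_iff, norm_smul, Real.norm_of_nonneg (by positivity)]
            have h1 : ‖x‖ ≤ |R| := (mem_ball_zero_iff.1 hx).le.trans (le_abs_self R)
            calc ε⁻¹ * ‖x‖ ≤ ε⁻¹ * |R| := by gcongr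
              _ = |R| / ε := by ring
              _ ≤ _ := by linarith
          rw [indicator_of_mem hx, indicator_of_mem this]
        · rw [indicator_of_notMem hx]; exact zero_le
    _ = ENNReal.ofReal (ε ^ d) * ∫⁻ x in Metric.closedBall 0 ((n : ℝ) + 1), F (τ x ω) := by
        rw [lintegral_comp_inv_smul hε (hF.indicator Metric.isClosed_closedBall.measurableSet),
          lintegral_indicator Metric.isClosed_closedBall.measurableSet]
    _ ≤ ENNReal.ofReal (ε ^ d) * (maximalFlow τ F ω * ((n : ℝ≥0∞) + 1) ^ d) := by
        gcongr
        rw [← ENNReal.div_le_iff (by positivity) (by finiteness)]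
        exact le_iSup (fun n : ℕ => (∫⁻ x in Metric.closedBall 0 ((n : ℝ) + 1), F (τ x ω)) /
          ((n : ℝ≥0∞) + 1) ^ d) n
    _ = ENNReal.ofReal ((ε * (n + 1)) ^ d) * maximalFlow τ F ω := by
        have : ((n : ℝ≥0∞) + 1) ^ d = ENNReal.ofReal (((n : ℝ) + 1) ^ d) := by
          rw [ENNReal.ofReal_pow (by positivity), ENNReal.ofReal_add (by positivity) zero_le_one]
          simp
        rw [this, mul_pow, ENNReal.ofReal_mul (by positivity)]; ring
    _ ≤ _ := by
        gcongr
        calc ε * ((n : ℝ) + 1) ≤ ε * (|R| / ε + 1 + 1) := by gcongr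
          _ = |R| + 2 * ε := by field_simp; ring

end

section

variable {d : ℕ}

/-! ### The ergodic theorem -/

/-- Continuity of translations in `L¹`. -/
theorem tendsto_integral_translate_sub {h : Rd d → ℝ} (hh : Integrable h volume) :
    Tendsto (fun t : Rd d => ∫ x, |h (x - t) - h x|) (𝓝 0) (𝓝 0) := by
  have : Fact ((1 : ℝ≥0∞) ≠ ∞) := ⟨ENNReal.one_ne_top⟩
  have hm : MemLp h 1 volume := memLp_one_iff_integrable.2 hh
  have hmt : ∀ t : Rd d, MemLp (fun x => h (-t +ᵥ x)) 1 volume := fun t =>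
    hm.comp_measurePreserving (measurePreserving_vadd (-t) volume)
  have : Tendsto (fun t : Rd d => (DomAddAct.mk (-t)) +ᵥ hm.toLp h) (𝓝 0)
      (𝓝 ((DomAddAct.mk (-(0 : Rd d))) +ᵥ hm.toLp h)) := by
    have h1 : Continuous fun t : Rd d => DomAddAct.mk (-t) :=
      DomAddAct.continuous_mk.comp continuous_neg
    exact (h1.vadd continuous_const).tendsto 0
  simp only [DomAddAct.mk_vadd_toLp] at this
  rw [Lp.tendsto_Lp_iff_tendsto_eLpNorm'' (fun (t : Rd d) x => h (-t +ᵥ x)) hmt] at this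
  have h2 := (ENNReal.tendsto_toReal ENNReal.zero_ne_top).comp this
  simp only [ENNReal.toReal_zero, neg_zero, zero_vadd] at h2
  refine h2.congr fun t => ?_
  simp only [Function.comp]
  rw [eLpNorm_one_eq_lintegral_enorm, ← integral_norm_eq_lintegral_enorm
    ((hmt t).1.sub hm.1)]
  refine integral_congr_ae (ae_of_all _ fun x => ?_)
  simp only [Pi.sub_apply, vadd_eq_add, Real.norm_eq_abs, neg_add_eq_sub]

/-- Bounded measurable functions with bounded support. -/
structure IsTest (h : Rd d → ℝ) : Prop where
  measurable : Measurable h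
  bounded : ∃ M : ℝ, 0 ≤ M ∧ ∀ x, |h x| ≤ M
  support : ∃ R : ℝ, 0 ≤ R ∧ ∀ x, x ∉ Metric.ball (0 : Rd d) R → h x = 0

theorem IsTest.integrable {h : Rd d → ℝ} (hh : IsTest h) : Integrable h volume := by
  obtain ⟨M, -, hM⟩ := hh.bounded
  obtain ⟨R, -, hR⟩ := hh.support
  have : IntegrableOn h (Metric.ball 0 R) volume :=
    Measure.integrableOn_of_bounded measure_ball_lt_top.ne hh.measurable.aestronglyMeasurable
      (M := M) (ae_of_all _ hM)
  exact this.integrable_of_forall_notMem_eq_zero hR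

theorem IsCc.isTest {g : Rd d → ℝ} (hg : IsCc g) : IsTest g := by
  obtain ⟨R, h1, h2⟩ := hg.exists_ball
  exact ⟨hg.1.measurable, hg.exists_bound, R, by linarith, h2⟩

section

variable {Ω : Type*} {τ : Rd d → Ω → Ω}

/-- The rescaled averages of `F` along the orbit of `ω` converge to `c`. -/
def AveragesTo (τ : Rd d → Ω → Ω) (F : Ω → ℝ) (c : ℝ) (ω : Ω) : Prop :=
  ∀ h : Rd d → ℝ, IsTest h →
    Tendsto (fun ε : ℝ => ∫ x, h x * F (τ (ε⁻¹ • x) ω)) (𝓝[>] 0) (𝓝 (c * ∫ x, h x))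

theorem lintegral_test_mul_le {F : Ω → ℝ} {ω : Ω} (hF : Measurable fun x => F (τ x ω))
    {h : Rd d → ℝ} {M R : ℝ} (hM0 : 0 ≤ M)
    (hM : ∀ x, |h x| ≤ M) (hR0 : 0 ≤ R) (hR : ∀ x, x ∉ Metric.ball (0 : Rd d) R → h x = 0)
    {ε : ℝ} (hε : 0 < ε) :
    ∫⁻ x, ‖h x * F (τ (ε⁻¹ • x) ω)‖ₑ ≤ ENNReal.ofReal (M * (R + 2 * ε) ^ d) *
      maximalFlow τ (fun ω => ‖F ω‖ₑ) ω := by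
  calc ∫⁻ x, ‖h x * F (τ (ε⁻¹ • x) ω)‖ₑ
      ≤ ∫⁻ x in Metric.ball 0 R, ENNReal.ofReal M * ‖F (τ (ε⁻¹ • x) ω)‖ₑ := by
        rw [← lintegral_indicator Metric.isOpen_ball.measurableSet]
        refine lintegral_mono fun x => ?_
        by_cases hx : x ∈ Metric.ball (0 : Rd d) R
        · rw [indicator_of_mem hx, enorm_mul]
          gcongr
          rw [Real.enorm_eq_ofReal_abs]
          exact ENNReal.ofReal_le_ofReal (hM x)
        · simp [hR x hx]
    _ = ENNReal.ofReal M * ∫⁻ x in Metric.ball 0 R, ‖F (τ (ε⁻¹ • x) ω)‖ₑ :=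
        lintegral_const_mul _ (hF.comp (measurable_const_smul ε⁻¹)).enorm
    _ ≤ ENNReal.ofReal M * (ENNReal.ofReal ((|R| + 2 * ε) ^ d) *
          maximalFlow τ (fun ω => ‖F ω‖ₑ) ω) := by
        gcongr
        exact setLIntegral_scaled_le_maximalFlow (F := fun ω => ‖F ω‖ₑ) hF.enorm hε
    _ = _ := by
        rw [abs_of_nonneg hR0, ENNReal.ofReal_mul hM0, mul_assoc]

theorem integrable_test_mul {F : Ω → ℝ} {ω : Ω} (hF : Measurable fun x => F (τ x ω))
    (hfin : maximalFlow τ (fun ω => ‖F ω‖ₑ) ω < ∞) {h : Rd d → ℝ} (hh : IsTest h) {ε : ℝ}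
    (hε : 0 < ε) : Integrable fun x => h x * F (τ (ε⁻¹ • x) ω) := by
  obtain ⟨M, hM0, hM⟩ := hh.bounded
  obtain ⟨R, hR0, hR⟩ := hh.support
  refine ⟨(hh.measurable.mul (hF.comp (measurable_const_smul ε⁻¹))).aestronglyMeasurable,
    (lintegral_test_mul_le hF hM0 hM hR0 hR hε).trans_lt ?_⟩
  exact ENNReal.mul_lt_top ENNReal.ofReal_lt_top hfin

theorem abs_integral_test_mul_le {F : Ω → ℝ} {ω : Ω} (hF : Measurable fun x => F (τ x ω))
    {δ : ℝ} (hδ : 0 ≤ δ) (hfin : maximalFlow τ (fun ω => ‖F ω‖ₑ) ω ≤ ENNReal.ofReal δ)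
    {h : Rd d → ℝ} {M R : ℝ} (hM0 : 0 ≤ M) (hM : ∀ x, |h x| ≤ M) (hR0 : 0 ≤ R)
    (hR : ∀ x, x ∉ Metric.ball (0 : Rd d) R → h x = 0) {ε : ℝ} (hε : 0 < ε) :
    |∫ x, h x * F (τ (ε⁻¹ • x) ω)| ≤ M * (R + 2 * ε) ^ d * δ := by
  have h1 := (enorm_integral_le_lintegral_enorm (μ := volume)
    (fun x => h x * F (τ (ε⁻¹ • x) ω))).trans (lintegral_test_mul_le hF hM0 hM hR0 hR hε)
  have h2 : ‖∫ x, h x * F (τ (ε⁻¹ • x) ω)‖ₑ ≤ ENNReal.ofReal (M * (R + 2 * ε) ^ d * δ) := by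
    rw [ENNReal.ofReal_mul (by positivity)]
    exact h1.trans (by gcongr)
  rw [Real.enorm_eq_ofReal_abs] at h2
  exact (ENNReal.ofReal_le_ofReal_iff (by positivity)).1 h2

end

namespace IsStationaryErgodic

variable {Ω : Type*} [MeasurableSpace Ω] {P : Measure Ω} {τ : Rd d → Ω → Ω}

theorem measurable_orbit (hτ : IsStationaryErgodic P τ) {β : Type*} [MeasurableSpace β] {F : Ω → β}
    (hF : Measurable F) (ω : Ω) : Measurable fun x => F (τ x ω) :=
  hF.comp (hτ.measurable.comp (measurable_id.prodMk measurable_const))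

theorem ae_orbit [SFinite P] (hτ : IsStationaryErgodic P τ) {p : Ω → Prop}
    (hp : MeasurableSet {ω | p ω}) (h : ∀ᵐ ω ∂P, p ω) : ∀ᵐ ω ∂P, ∀ᵐ x : Rd d, p (τ x ω) := by
  have hm : MeasurableSet {q : Rd d × Ω | p (τ q.1 q.2)} := hτ.measurable hp
  have h1 : ∀ᵐ q ∂(volume.prod P), p (τ q.1 q.2) :=
    (Measure.ae_prod_iff_ae_ae hm).2 (ae_of_all _ fun x => (hτ.measurePreserving x).quasiMeasurePreserving.ae h)
  have h2 : ∀ᵐ q ∂(P.prod volume), p (τ q.2 q.1) :=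
    (Measure.measurePreserving_swap (μ := P) (ν := (volume : Measure (Rd d)))).quasiMeasurePreserving.ae h1
  exact Measure.ae_ae_of_ae_prod h2

/-- The averages see F along a whole orbit. By Fubini and stationarity, almost every orbit meets the
null event {F ≠ G} in a Lebesgue-null set of parameters, and dilations preserve null sets. -/
theorem averagesTo_congr [SFinite P] (hτ : IsStationaryErgodic P τ) {F G : Ω → ℝ} (hF : Measurable F)
    (hG : Measurable G) (h : F =ᵐ[P] G) {c : ℝ} (hFc : ∀ᵐ ω ∂P, AveragesTo τ F c ω) :
    ∀ᵐ ω ∂P, AveragesTo τ G c ω := by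
  filter_upwards [hFc, hτ.ae_orbit (measurableSet_eq_fun hF hG) h] with ω h1 h2 g hg
  refine (h1 g hg).congr' ?_
  filter_upwards [self_mem_nhdsWithin] with ε hε
  have h0 : ε⁻¹ ≠ 0 := inv_ne_zero (ne_of_gt hε)
  refine integral_congr_ae ?_
  filter_upwards [(Measure.quasiMeasurePreserving_smul volume h0).ae h2] with x hx
  rw [hx]

/-- The event that all maximal functions from index m on exceed δ has probability at most a constant
times δ⁻¹ ∫ G n for every n ≥ m, hence zero. Infinitely many good indices are enough below, so no
subsequence has to be extracted. -/
theorem ae_frequently_maximalFlow_le [SFinite P] (hτ : IsStationaryErgodic P τ)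
    {G : ℕ → Ω → ℝ≥0∞} (hG : ∀ n, Measurable (G n))
    (hlim : Tendsto (fun n => ∫⁻ ω, G n ω ∂P) atTop (𝓝 0)) {δ : ℝ≥0∞} (hδ : δ ≠ 0) :
    ∀ᵐ ω ∂P, ∃ᶠ n in atTop, maximalFlow τ (G n) ω ≤ δ := by
  have h1 : ∀ᵐ ω ∂P, ∀ m, ¬ ∀ n, m ≤ n → δ < maximalFlow τ (G n) ω := by
    rw [ae_all_iff]
    intro m
    rw [ae_iff]
    simp only [not_not]
    set S := {ω | ∀ n, m ≤ n → δ < maximalFlow τ (G n) ω}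
    have hle : ∀ᶠ n in atTop, δ * P S
        ≤ (5 ^ d * volume (Metric.ball (0 : Rd d) 1)) * ∫⁻ ω, G n ω ∂P := by
      filter_upwards [eventually_ge_atTop m] with n hn
      refine le_trans ?_ (hτ.maximal_inequality (hG n) δ)
      gcongr
      exact fun ω hω => hω n hn
    have h2 := ENNReal.Tendsto.const_mul (a := 5 ^ d * volume (Metric.ball (0 : Rd d) 1)) hlim
      (Or.inr (ENNReal.mul_ne_top (by finiteness) measure_ball_lt_top.ne))
    rw [mul_zero] at h2
    have := ge_of_tendsto h2 hle
    simpa [hδ] using this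
  filter_upwards [h1] with ω hω
  rw [frequently_atTop]
  intro m
  have := hω m
  push Not at this
  exact this

/-- Banach's principle. The maximal function of F - Fn controls the averages of F - Fn for all
weights and all ε ∈ (0,1] together, so the exceptional null set does not depend on the weight. -/
theorem averagesTo_of_approx [IsFiniteMeasure P] (hτ : IsStationaryErgodic P τ) {F : Ω → ℝ}
    (hF : Measurable F) (hFi : Integrable F P) {Fn : ℕ → Ω → ℝ} (hFn : ∀ n, Measurable (Fn n))
    (hFni : ∀ n, Integrable (Fn n) P)
    (hgood : ∀ n, ∀ᵐ ω ∂P, AveragesTo τ (Fn n) (∫ ω, Fn n ω ∂P) ω)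
    (hlim : Tendsto (fun n => ∫⁻ ω, ‖F ω - Fn n ω‖ₑ ∂P) atTop (𝓝 0)) :
    ∀ᵐ ω ∂P, AveragesTo τ F (∫ ω, F ω ∂P) ω := by
  have hc : Tendsto (fun n => ∫ ω, Fn n ω ∂P) atTop (𝓝 (∫ ω, F ω ∂P)) := by
    refine tendsto_integral_of_L1 F hFi.1 (Eventually.of_forall hFni) ?_
    simpa only [← enorm_sub_rev (F _)] using hlim
  have hfreq : ∀ᵐ ω ∂P, ∀ k : ℕ, ∃ᶠ n in atTop,
      maximalFlow τ (fun ω => ‖F ω - Fn n ω‖ₑ) ω ≤ ENNReal.ofReal (1 / ((k : ℝ) + 1)) := by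
    rw [ae_all_iff]
    intro k
    refine hτ.ae_frequently_maximalFlow_le (fun n => (hF.sub (hFn n)).enorm) hlim ?_
    rw [Ne, ENNReal.ofReal_eq_zero, not_le]; positivity
  filter_upwards [hfreq, ae_all_iff.2 hgood,
    hτ.ae_maximalFlow_lt_top hF.enorm hFi.2,
    ae_all_iff.2 fun n => hτ.ae_maximalFlow_lt_top (hFn n).enorm (hFni n).2]
    with ω h1 h2 h3 h4 h hh
  obtain ⟨M, hM0, hM⟩ := hh.bounded
  obtain ⟨R, hR0, hR⟩ := hh.support
  rw [Metric.tendsto_nhds]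
  intro e he
  obtain ⟨k, hk⟩ : ∃ k : ℕ, M * (R + 2) ^ d * (1 / ((k : ℝ) + 1)) < e / 3 := by
    have := (tendsto_one_div_add_atTop_nhds_zero_nat (𝕜 := ℝ)).const_mul (M * (R + 2) ^ d)
    rw [mul_zero] at this
    exact (this.eventually (gt_mem_nhds (by positivity))).exists
  have hc' : ∀ᶠ n in atTop, |(∫ ω, Fn n ω ∂P) * (∫ x, h x) - (∫ ω, F ω ∂P) * ∫ x, h x| < e / 3 := by
    have := Metric.tendsto_nhds.1 (hc.mul_const (∫ x, h x)) (e / 3) (by positivity)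
    simpa only [Real.dist_eq] using this
  obtain ⟨n, hn1, hn2⟩ := ((h1 k).and_eventually hc').exists
  have h5 := Metric.tendsto_nhds.1 (h2 n h hh) (e / 3) (by positivity)
  filter_upwards [h5, Ioc_mem_nhdsGT one_pos] with ε h6 hε
  have h7 := abs_integral_test_mul_le (F := fun ω => F ω - Fn n ω)
    ((hτ.measurable_orbit hF ω).sub (hτ.measurable_orbit (hFn n) ω)) (by positivity) hn1
    hM0 hM hR0 hR hε.1
  have h8 : ∫ x, h x * (F (τ (ε⁻¹ • x) ω) - Fn n (τ (ε⁻¹ • x) ω))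
      = (∫ x, h x * F (τ (ε⁻¹ • x) ω)) - ∫ x, h x * Fn n (τ (ε⁻¹ • x) ω) := by
    rw [← integral_sub (integrable_test_mul (hτ.measurable_orbit hF ω) h3 hh hε.1)
      (integrable_test_mul (hτ.measurable_orbit (hFn n) ω) (h4 n) hh hε.1)]
    refine integral_congr_ae (ae_of_all _ fun x => ?_)
    simp only []; ring
  rw [h8] at h7
  have h9 : M * (R + 2 * ε) ^ d * (1 / ((k : ℝ) + 1)) ≤ M * (R + 2) ^ d * (1 / ((k : ℝ) + 1)) := by
    have := hε.1; have := hε.2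
    gcongr; linarith
  rw [Real.dist_eq] at h6 ⊢
  have e1 := abs_lt.1 h6
  have e2 := abs_lt.1 hn2
  have e3 := abs_le.1 h7
  rw [abs_lt]
  constructor <;> linarith

/-- A shift by y in Ω is a displacement by εy of the rescaled variable. Moved onto the weight, it
leaves an error of at most the L¹ norm of h(· - εy) - h, because indicators are bounded by 1. This
works for every ω. -/
theorem averagesTo_coboundary (hτ : IsStationaryErgodic P τ) {A : Set Ω} (hA : MeasurableSet A)
    (y : Rd d) (ω : Ω) :
    AveragesTo τ (fun ω => A.indicator (1 : Ω → ℝ) (τ y ω) - A.indicator (1 : Ω → ℝ) ω) 0 ω := by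
  intro h hh
  rw [zero_mul]
  have ha : Measurable (A.indicator (1 : Ω → ℝ)) := measurable_one.indicator hA
  have ha1 : ∀ ω, ‖A.indicator (1 : Ω → ℝ) ω‖ ≤ 1 := fun ω =>
    (norm_indicator_le_norm_self _ _).trans (by simp)
  have hlim : Tendsto (fun ε : ℝ => ∫ x, |h (x - ε • y) - h x|) (𝓝[>] 0) (𝓝 0) := by
    have h1 : Tendsto (fun ε : ℝ => ε • y) (𝓝[>] 0) (𝓝 0) := by
      have : Continuous fun ε : ℝ => ε • y := by fun_prop
      simpa using (this.tendsto 0).mono_left nhdsWithin_le_nhds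
    exact (tendsto_integral_translate_sub hh.integrable).comp h1
  refine squeeze_zero_norm' ?_ hlim
  filter_upwards [self_mem_nhdsWithin] with ε hε
  have hε0 : ε ≠ 0 := ne_of_gt hε
  set b : Rd d → ℝ := fun x => A.indicator (1 : Ω → ℝ) (τ (ε⁻¹ • x) ω)
  have hb : Measurable b := (hτ.measurable_orbit ha ω).comp (measurable_const_smul ε⁻¹)
  have hb1 : ∀ x, ‖b x‖ ≤ 1 := fun x => ha1 _
  have hshift : ∀ x, A.indicator (1 : Ω → ℝ) (τ y (τ (ε⁻¹ • x) ω)) = b (x + ε • y) := fun x => by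
    simp only [b, hτ.add, smul_add, smul_smul, inv_mul_cancel₀ hε0, one_smul]
    rw [add_comm]
  have i1 : Integrable (fun x => h x * b (x + ε • y)) :=
    hh.integrable.mul_bdd (c := 1) (by fun_prop : Measurable fun x => b (x + ε • y)).aestronglyMeasurable
      (ae_of_all _ fun x => hb1 _)
  have i2 : Integrable (fun x => h x * b x) :=
    hh.integrable.mul_bdd (c := 1) hb.aestronglyMeasurable (ae_of_all _ fun x => hb1 _)
  have i3 : Integrable (fun x => h (x - ε • y)) := hh.integrable.comp_sub_right _
  have i4 : Integrable (fun x => h (x - ε • y) * b x) :=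
    i3.mul_bdd (c := 1) hb.aestronglyMeasurable (ae_of_all _ fun x => hb1 _)
  have e1 : ∫ x, h x * (A.indicator (1 : Ω → ℝ) (τ y (τ (ε⁻¹ • x) ω))
      - A.indicator (1 : Ω → ℝ) (τ (ε⁻¹ • x) ω)) = ∫ x, (h (x - ε • y) - h x) * b x := by
    simp_rw [hshift, mul_sub, sub_mul]
    rw [integral_sub i1 i2, integral_sub i4 i2,
      ← integral_sub_right_eq_self (fun x => h x * b (x + ε • y)) (ε • y)]
    simp only [sub_add_cancel]
  rw [e1]
  refine (norm_integral_le_integral_norm _).trans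
    (integral_mono (i4.sub i2 |>.congr (ae_of_all _ fun x => by simp [sub_mul])).norm
      (i3.sub hh.integrable).abs fun x => ?_)
  simp only [norm_mul]
  exact mul_le_of_le_one_right (norm_nonneg _) (hb1 x)

/-- Almost invariant events are trivial. -/
theorem measure_eq_zero_or_one [IsProbabilityMeasure P] (hτ : IsStationaryErgodic P τ) {A : Set Ω}
    (hA : MeasurableSet A) (h : ∀ y, ∀ᵐ ω ∂P, (τ y ω ∈ A ↔ ω ∈ A)) : P A = 0 ∨ P A = 1 := by
  -- B collects the points whose orbit stays in A for almost every parameter. It is exactly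
  -- invariant, as the ergodicity hypothesis demands, and agrees with A almost surely by Fubini.
  set B : Set Ω := {ω | volume {x | τ x ω ∉ A} = 0} with hB
  have hm : MeasurableSet {q : Ω × Rd d | τ q.2 q.1 ∉ A} :=
    (hτ.measurable.comp measurable_swap) hA.compl
  have hBm : MeasurableSet B :=
    (measurable_measure_prodMk_left (ν := (volume : Measure (Rd d))) hm) (measurableSet_singleton 0)
  have hBinv : ∀ y ω, τ y ω ∈ B ↔ ω ∈ B := by
    intro y ω
    simp only [hB, mem_ofPred_eq, hτ.add]
    have : {x | τ (x + y) ω ∉ A} = (fun x => x + y) ⁻¹' {x | τ x ω ∉ A} := rfl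
    rw [this, measure_preimage_add_right]
  have hAB : A =ᵐ[P] B := by
    have h1 : ∀ᵐ q ∂(volume.prod P), (τ q.1 q.2 ∈ A ↔ q.2 ∈ A) := by
      refine (Measure.ae_prod_iff_ae_ae ?_).2 (ae_of_all _ h)
      have m1 : MeasurableSet {q : Rd d × Ω | τ q.1 q.2 ∈ A} := hτ.measurable hA
      have m2 : MeasurableSet {q : Rd d × Ω | q.2 ∈ A} := measurable_snd hA
      exact MeasurableSet.iff m1 m2
    have h2 : ∀ᵐ q ∂(P.prod volume), (τ q.2 q.1 ∈ A ↔ q.1 ∈ A) :=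
      (Measure.measurePreserving_swap (μ := P)
        (ν := (volume : Measure (Rd d)))).quasiMeasurePreserving.ae h1
    filter_upwards [Measure.ae_ae_of_ae_prod h2] with ω hω
    refine propext ?_
    change ω ∈ A ↔ volume {x | τ x ω ∉ A} = 0
    constructor
    · intro hωA
      rw [← nonpos_iff_eq_zero]
      refine (measure_mono fun x hx => ?_).trans (ae_iff.1 hω).le
      simp only [mem_ofPred_eq] at hx ⊢
      tauto
    · intro h0
      by_contra hωA
      have h3 : ∀ᵐ x : Rd d, τ x ω ∈ A := h0
      obtain ⟨x, hx1, hx2⟩ := (h3.and hω).exists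
      exact hωA (hx2.1 hx1)
  rw [measure_congr hAB]
  refine hτ.ergodic B hBm fun x => ?_
  rw [hτ.image_eq_preimage]
  ext ω
  exact hBinv _ _

theorem ae_eq_const_of_invariant [IsProbabilityMeasure P] (hτ : IsStationaryErgodic P τ) {g : Ω → ℝ}
    (hg : Measurable g) (h : ∀ y, ∀ᵐ ω ∂P, g (τ y ω) = g ω) : ∃ c : ℝ, g =ᵐ[P] fun _ => c := by
  refine exists_eventuallyEq_const_of_forall_separating MeasurableSet fun U hU => ?_
  rcases hτ.measure_eq_zero_or_one (hg hU) (fun y => by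
    filter_upwards [h y] with ω hω
    simp [hω]) with h0 | h1
  · right
    exact measure_eq_zero_iff_ae_notMem.1 h0
  · left
    exact (prob_compl_eq_zero_iff (hg hU)).2 h1

end IsStationaryErgodic

namespace IsStationaryErgodic

variable {Ω : Type*} [MeasurableSpace Ω] {P : Measure Ω} {τ : Rd d → Ω → Ω}

/-- The elements of `L²` whose averages converge almost surely. -/
def averagingSubmodule [IsFiniteMeasure P] (hτ : IsStationaryErgodic P τ) :
    Submodule ℝ (Lp ℝ 2 P) where
  carrier := {f | ∀ᵐ ω ∂P, AveragesTo τ f (∫ ω, f ω ∂P) ω}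
  zero_mem' := by
    have h0 : ∀ᵐ ω ∂P, AveragesTo τ (0 : Ω → ℝ) 0 ω := ae_of_all _ fun ω h hh => by simp
    have : ∫ ω, (0 : Lp ℝ 2 P) ω ∂P = 0 := by
      rw [integral_congr_ae (Lp.coeFn_zero ℝ 2 P)]; simp
    change ∀ᵐ ω ∂P, _
    rw [this]
    exact hτ.averagesTo_congr measurable_zero (Lp.stronglyMeasurable _).measurable
      (Lp.coeFn_zero ℝ 2 P).symm h0
  add_mem' := by
    intro f g hf hg
    have fm := (Lp.stronglyMeasurable f).measurable
    have gm := (Lp.stronglyMeasurable g).measurable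
    have fi := (Lp.memLp f).integrable (by norm_num)
    have gi := (Lp.memLp g).integrable (by norm_num)
    have h0 : ∀ᵐ ω ∂P, AveragesTo τ (fun ω => f ω + g ω) (∫ ω, f ω ∂P + ∫ ω, g ω ∂P) ω := by
      filter_upwards [hf, hg, hτ.ae_maximalFlow_lt_top fm.enorm fi.2,
        hτ.ae_maximalFlow_lt_top gm.enorm gi.2] with ω h1 h2 h3 h4 h hh
      rw [add_mul]
      refine ((h1 h hh).add (h2 h hh)).congr' ?_
      filter_upwards [self_mem_nhdsWithin] with ε hε
      rw [← integral_add (integrable_test_mul (hτ.measurable_orbit fm ω) h3 hh hε)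
        (integrable_test_mul (hτ.measurable_orbit gm ω) h4 hh hε)]
      simp_rw [mul_add]
    have : ∫ ω, (f + g : Lp ℝ 2 P) ω ∂P = ∫ ω, f ω ∂P + ∫ ω, g ω ∂P := by
      rw [integral_congr_ae (Lp.coeFn_add f g), ← integral_add fi gi]; rfl
    change ∀ᵐ ω ∂P, _
    rw [this]
    exact hτ.averagesTo_congr (fm.add gm) (Lp.stronglyMeasurable _).measurable
      (Lp.coeFn_add f g).symm h0
  smul_mem' := by
    intro c f hf
    have fm := (Lp.stronglyMeasurable f).measurable
    have h0 : ∀ᵐ ω ∂P, AveragesTo τ (fun ω => c * f ω) (c * ∫ ω, f ω ∂P) ω := by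
      filter_upwards [hf] with ω h1 h hh
      rw [mul_assoc]
      refine ((h1 h hh).const_mul c).congr fun ε => ?_
      rw [← integral_const_mul]
      refine integral_congr_ae (ae_of_all _ fun x => ?_)
      simp only []; ring
    have : ∫ ω, (c • f : Lp ℝ 2 P) ω ∂P = c * ∫ ω, f ω ∂P := by
      rw [integral_congr_ae (Lp.coeFn_smul c f), ← integral_const_mul]; rfl
    change ∀ᵐ ω ∂P, _
    rw [this]
    exact hτ.averagesTo_congr (fm.const_mul c) (Lp.stronglyMeasurable _).measurable
      (Lp.coeFn_smul c f).symm h0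

theorem toLp_mem_averagingSubmodule [IsFiniteMeasure P] (hτ : IsStationaryErgodic P τ)
    {F : Ω → ℝ} (hF : Measurable F) (hF2 : MemLp F 2 P)
    (h : ∀ᵐ ω ∂P, AveragesTo τ F (∫ ω, F ω ∂P) ω) : hF2.toLp F ∈ hτ.averagingSubmodule := by
  change ∀ᵐ ω ∂P, _
  rw [integral_congr_ae hF2.coeFn_toLp]
  exact hτ.averagesTo_congr hF (Lp.stronglyMeasurable _).measurable hF2.coeFn_toLp.symm h

theorem isClosed_averagingSubmodule [IsProbabilityMeasure P] (hτ : IsStationaryErgodic P τ) :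
    IsClosed (hτ.averagingSubmodule : Set (Lp ℝ 2 P)) := by
  refine IsSeqClosed.isClosed fun x f hx hxf => ?_
  refine hτ.averagesTo_of_approx (Lp.stronglyMeasurable f).measurable
    ((Lp.memLp f).integrable (by norm_num)) (Fn := fun n => x n)
    (fun n => (Lp.stronglyMeasurable (x n)).measurable)
    (fun n => (Lp.memLp (x n)).integrable (by norm_num)) hx ?_
  rw [Lp.tendsto_Lp_iff_tendsto_eLpNorm'] at hxf
  refine tendsto_of_tendsto_of_tendsto_of_le_of_le tendsto_const_nhds hxf (fun _ => zero_le)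
    fun n => ?_
  calc ∫⁻ ω, ‖f ω - x n ω‖ₑ ∂P = eLpNorm ((x n : Ω → ℝ) - (f : Ω → ℝ)) 1 P := by
        rw [eLpNorm_sub_comm, eLpNorm_one_eq_lintegral_enorm]; rfl
    _ ≤ _ := eLpNorm_le_eLpNorm_of_exponent_le (by norm_num)
        ((Lp.memLp (x n)).1.sub (Lp.memLp f).1)

/-- Von Neumann's argument: the subspace is closed, so its orthogonal complement has to vanish.
Orthogonality of f to coboundaries of indicators, with the shift moved onto f, makes f invariant,
hence constant by ergodicity; orthogonality to 1 makes the constant zero. -/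
theorem averagingSubmodule_eq_top [IsProbabilityMeasure P] (hτ : IsStationaryErgodic P τ) :
    hτ.averagingSubmodule = ⊤ := by
  rw [← hτ.isClosed_averagingSubmodule.submodule_topologicalClosure_eq,
    Submodule.topologicalClosure_eq_top_iff, Submodule.eq_bot_iff]
  intro f hf
  have fm := (Lp.stronglyMeasurable f).measurable
  have hort : ∀ F : Ω → ℝ, Measurable F → MemLp F 2 P →
      (∀ᵐ ω ∂P, AveragesTo τ F (∫ ω, F ω ∂P) ω) → ∫ ω, F ω * f ω ∂P = 0 := by
    intro F hF hF2 hFa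
    have := (Submodule.mem_orthogonal _ _).1 hf _ (hτ.toLp_mem_averagingSubmodule hF hF2 hFa)
    rwa [← Lp.toLp_coeFn f (Lp.memLp f), ← integral_mul_eq_inner hF2 (Lp.memLp f)] at this
  have fi : Integrable f P := (Lp.memLp f).integrable (by norm_num)
  have hinv : ∀ y, ∀ᵐ ω ∂P, f (τ y ω) = f ω := by
    intro y
    have fyi : Integrable (fun ω => f (τ y ω)) P :=
      (hτ.measurePreserving y).integrable_comp_of_integrable fi
    refine fyi.ae_eq_of_forall_setIntegral_eq _ _ fi fun A hA _ => ?_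
    set a : Ω → ℝ := A.indicator 1
    have am : Measurable a := measurable_one.indicator hA
    have a1 : ∀ ω, ‖a ω‖ ≤ 1 := fun ω => (norm_indicator_le_norm_self _ _).trans (by simp)
    have amy : Measurable fun ω => a (τ (-y) ω) := am.comp (hτ.measurable_map _)
    have hF2 : MemLp (fun ω => a (τ (-y) ω) - a ω) 2 P :=
      (MemLp.of_bound amy.aestronglyMeasurable 1 (ae_of_all _ fun ω => a1 _)).sub
        (MemLp.of_bound am.aestronglyMeasurable 1 (ae_of_all _ fun ω => a1 _))
    have ai : Integrable a P := Integrable.of_bound am.aestronglyMeasurable 1 (ae_of_all _ a1)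
    have ayi : Integrable (fun ω => a (τ (-y) ω)) P :=
      Integrable.of_bound amy.aestronglyMeasurable 1 (ae_of_all _ fun ω => a1 _)
    have aycomp : ∫ ω, a (τ (-y) ω) ∂P = ∫ ω, a ω ∂P :=
      integral_map_of_stronglyMeasurable (hτ.measurable_map (-y)) am.stronglyMeasurable
        |>.symm.trans (by rw [(hτ.measurePreserving (-y)).map_eq])
    have h1 := hort (fun ω => a (τ (-y) ω) - a ω) (amy.sub am) hF2 (by
      rw [integral_sub ayi ai, aycomp, sub_self]
      exact ae_of_all _ fun ω => hτ.averagesTo_coboundary hA (-y) ω)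
    have h2 : ∫ ω, a (τ (-y) ω) * f ω ∂P = ∫ ω, a ω * f (τ y ω) ∂P := by
      have hm : Measurable fun ω => a (τ (-y) ω) * f ω := amy.mul fm
      have := integral_map_of_stronglyMeasurable (μ := P) (hτ.measurable_map y)
        hm.stronglyMeasurable
      rw [(hτ.measurePreserving y).map_eq] at this
      rw [this]
      simp [hτ.add, hτ.zero]
    have h3 : ∫ ω, a (τ (-y) ω) * f ω ∂P - ∫ ω, a ω * f ω ∂P = 0 := by
      rw [← h1, ← integral_sub (fi.bdd_mul (c := 1) amy.aestronglyMeasurable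
        (ae_of_all _ fun ω => a1 _)) (fi.bdd_mul (c := 1) am.aestronglyMeasurable
        (ae_of_all _ fun ω => a1 _))]
      refine integral_congr_ae (ae_of_all _ fun ω => ?_)
      simp only []; ring
    rw [h2, sub_eq_zero] at h3
    have hind : ∀ G : Ω → ℝ, ∫ ω in A, G ω ∂P = ∫ ω, a ω * G ω ∂P := fun G => by
      rw [← integral_indicator hA]
      refine integral_congr_ae (ae_of_all _ fun ω => ?_)
      by_cases hω : ω ∈ A <;> simp [a, hω]
    rw [hind, hind, h3]
  obtain ⟨c, hc⟩ := hτ.ae_eq_const_of_invariant fm hinv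
  have h1 := hort (fun _ => 1) measurable_const (memLp_const 1)
    (ae_of_all _ fun ω h hh => by simp)
  have hc0 : c = 0 := by
    simpa [integral_congr_ae hc] using h1
  refine Lp.ext (hc.trans ?_)
  rw [hc0]
  exact (Lp.coeFn_zero ℝ 2 P).symm

/-- The multiparameter ergodic theorem, for bounded measurable weights with bounded support. -/
theorem ae_averagesTo [IsProbabilityMeasure P] (hτ : IsStationaryErgodic P τ) {F : Ω → ℝ}
    (hF : Measurable F) (hFi : Integrable F P) (hF0 : ∀ ω, 0 ≤ F ω) :
    ∀ᵐ ω ∂P, AveragesTo τ F (∫ ω, F ω ∂P) ω := by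
  have hm : ∀ n : ℕ, Measurable fun ω => min (F ω) n := fun n => hF.min measurable_const
  have hb : ∀ (n : ℕ) ω, ‖min (F ω) n‖ ≤ n := fun n ω => by
    rw [Real.norm_of_nonneg (le_min (hF0 ω) n.cast_nonneg)]; exact min_le_right _ _
  have h2 : ∀ n : ℕ, MemLp (fun ω => min (F ω) n) 2 P := fun n =>
    MemLp.of_bound (hm n).aestronglyMeasurable n (ae_of_all _ (hb n))
  refine hτ.averagesTo_of_approx hF hFi hm (fun n => (h2 n).integrable (by norm_num))
    (fun n => ?_) ?_
  · have hmem : (h2 n).toLp _ ∈ hτ.averagingSubmodule := by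
      rw [hτ.averagingSubmodule_eq_top]; trivial
    change ∀ᵐ ω ∂P, _ at hmem
    rw [integral_congr_ae (h2 n).coeFn_toLp] at hmem
    exact hτ.averagesTo_congr (Lp.stronglyMeasurable _).measurable (hm n) (h2 n).coeFn_toLp hmem
  · rw [← lintegral_zero (μ := P)]
    refine tendsto_lintegral_of_dominated_convergence (fun ω => ‖F ω‖ₑ)
      (fun n => (hF.sub (hm n)).enorm) (fun n => ae_of_all _ fun ω => ?_) hFi.2.ne
      (ae_of_all _ fun ω => ?_)
    · simp only [enorm_le_iff_norm_le, Real.norm_eq_abs]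
      have h0 := hF0 ω
      have h1 : 0 ≤ min (F ω) n := le_min h0 n.cast_nonneg
      have h3 := min_le_left (F ω) n
      rw [abs_of_nonneg h0, abs_of_nonneg (by linarith)]
      linarith
    · refine tendsto_const_nhds.congr' ?_
      obtain ⟨N, hN⟩ := exists_nat_ge (F ω)
      filter_upwards [eventually_ge_atTop N] with n hn
      have : F ω ≤ n := hN.trans (by exact_mod_cast hn)
      simp [min_eq_left this]

end IsStationaryErgodic

end

section

variable {d : ℕ} {J : Measure (Rd d × Rd d)} {α : ℝ} {Γ : Set (Rd d)} {K : Rd d → ℝ≥0}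

/-! ### Auxiliary facts for the passage to the limit -/

/-- `HypForms` takes Borel functions bounded everywhere, whereas resolvents and their limits are
measurable and bounded only up to null sets. -/
theorem exists_bounded_measurable_modification {u : Rd d → ℝ} (hu : AEStronglyMeasurable u volume)
    {M : ℝ} (hM0 : 0 ≤ M) (hM : ∀ᵐ x, |u x| ≤ M) :
    ∃ v : Rd d → ℝ, Measurable v ∧ (∀ x, |v x| ≤ M) ∧ u =ᵐ[volume] v := by
  refine ⟨fun x => max (-M) (min M (hu.mk u x)), ?_, fun x => ?_, ?_⟩
  · have := hu.stronglyMeasurable_mk.measurable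
    fun_prop
  · exact abs_le.2 ⟨le_max_left _ _, max_le (by linarith) (min_le_left _ _)⟩
  · filter_upwards [hu.ae_eq_mk, hM] with x hx h
    have := abs_le.1 h
    rw [← hx, min_eq_right this.2, max_eq_right this.1]

/-- Hölder with the conjugate exponent s: since |w|^s ≤ M^(s-1) |w|, a bounded family tending to
zero in L¹ does so in L^s. It is used with the density of μ^ε and with the local masses of the
conductance as weights. -/
theorem tendsto_lintegral_mul_weight {X ι : Type*} [MeasurableSpace X] {ν : Measure X}
    {l : Filter ι} {w : ι → X → ℝ} {W : ι → X → ℝ≥0∞} {p : ℝ} (hp : 1 < p) {M : ℝ}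
    (hw : ∀ᶠ i in l, AEMeasurable (w i) ν) (hwM : ∀ᶠ i in l, ∀ᵐ x ∂ν, |w i x| ≤ M)
    (hW : ∀ᶠ i in l, AEMeasurable (W i) ν) {B : ℝ≥0∞} (hB : B ≠ ∞)
    (hWB : ∀ᶠ i in l, ∫⁻ x, W i x ^ p ∂ν ≤ B)
    (hlim : Tendsto (fun i => ∫⁻ x, ‖w i x‖ₑ ∂ν) l (𝓝 0)) :
    Tendsto (fun i => ∫⁻ x, ‖w i x‖ₑ * W i x ∂ν) l (𝓝 0) := by
  set s := p.conjExponent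
  have hps : p.HolderConjugate s := Real.HolderConjugate.conjExponent hp
  have hs1 : 1 < s := hps.symm.lt
  set D : ℝ≥0∞ := ENNReal.ofReal M ^ (s - 1)
  have hD : D ≠ ∞ := ENNReal.rpow_ne_top_of_nonneg (by linarith) ENNReal.ofReal_ne_top
  have hup : Tendsto (fun i => (D * ∫⁻ x, ‖w i x‖ₑ ∂ν) ^ (1 / s) * B ^ (1 / p)) l (𝓝 0) := by
    have h1 := ENNReal.Tendsto.const_mul (a := D) hlim (Or.inr hD)
    rw [mul_zero] at h1
    have h2 := ((ENNReal.continuous_rpow_const (y := 1 / s)).tendsto 0).comp h1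
    rw [ENNReal.zero_rpow_of_pos (by positivity)] at h2
    have h3 := ENNReal.Tendsto.mul_const h2
      (Or.inr (ENNReal.rpow_ne_top_of_nonneg (y := 1 / p) (by positivity) hB))
    rwa [zero_mul] at h3
  refine tendsto_of_tendsto_of_tendsto_of_le_of_le' tendsto_const_nhds hup
    (Eventually.of_forall fun _ => zero_le) ?_
  filter_upwards [hw, hwM, hW, hWB] with i h1 h2 h3 h4
  refine (ENNReal.lintegral_mul_le_Lp_mul_Lq ν hps.symm h1.enorm h3).trans ?_
  gcongr
  rw [← lintegral_const_mul'' _ h1.enorm]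
  refine lintegral_mono_ae ?_
  filter_upwards [h2] with x hx
  have hxe : ‖w i x‖ₑ ≤ ENNReal.ofReal M := by
    rw [Real.enorm_eq_ofReal_abs]; exact ENNReal.ofReal_le_ofReal hx
  calc ‖w i x‖ₑ ^ s = ‖w i x‖ₑ ^ (s - 1) * ‖w i x‖ₑ := by
        conv_rhs => rw [← ENNReal.rpow_one ‖w i x‖ₑ, ← ENNReal.rpow_mul, one_mul]
        rw [← ENNReal.rpow_add_of_nonneg _ _ (by linarith) zero_le_one]
        congr 1; ring
    _ ≤ _ := by
        gcongr
        exact ENNReal.rpow_le_rpow hxe (by linarith)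

theorem jump_le {k : Rd d → Rd d → ℝ≥0} (hα : 0 < α) {η : ℝ} (hη : 0 < η) {q : Rd d × Rd d}
    (hq : q ∈ midSet d η) :
    (jump α Γ k q : ℝ≥0∞) ≤ ENNReal.ofReal (η ^ (-((d : ℝ) + α))) * k q.1 q.2 := by
  have hs : 0 < (d : ℝ) + α := by positivity
  rw [← ENNReal.ofReal_coe_nnreal, ← ENNReal.ofReal_coe_nnreal,
    ← ENNReal.ofReal_mul (by positivity)]
  refine ENNReal.ofReal_le_ofReal ?_
  unfold jump
  split_ifs
  · rw [NNReal.coe_div, NNReal.coe_rpow, coe_nnnorm, div_eq_mul_inv, mul_comm,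
      ← Real.rpow_neg (norm_nonneg _)]
    gcongr ?_ * _
    exact Real.rpow_le_rpow_of_nonpos hη hq.1.le (by linarith)
  · simp only [NNReal.coe_zero]; positivity

/-- Bound of the truncated form by a weighted `L¹` norm. -/
theorem lintegral_midSet_inc_mul_inc_le {k : Rd d → Rd d → ℝ≥0}
    (hk : Measurable fun q : Rd d × Rd d => k q.1 q.2) (hsymm : ∀ x y, k x y = k y x)
    (hj : Measurable (jump α Γ k)) (hα : 0 < α) {η : ℝ} (hη : 0 < η) {g w : Rd d → ℝ} {M R : ℝ}
    (hM : ∀ x, |g x| ≤ M) (hR : ∀ x, x ∉ Metric.ball (0 : Rd d) R → g x = 0)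
    (hw : AEMeasurable w volume) :
    ∫⁻ q in midSet d η, ‖inc w q * inc g q‖ₑ ∂jumpMeasure α Γ k ≤
      ENNReal.ofReal (2 * M * η ^ (-((d : ℝ) + α))) *
        (2 * ∫⁻ x in Metric.ball 0 (R + 1 / η),
          ‖w x‖ₑ * ∫⁻ y in Metric.ball 0 (R + 1 / η), (k x y : ℝ≥0∞)) := by
  have hM0 : 0 ≤ M := (abs_nonneg _).trans (hM 0)
  set B := Metric.ball (0 : Rd d) (R + 1 / η)
  have hB : MeasurableSet B := Metric.isOpen_ball.measurableSet
  have hw' : AEMeasurable w (volume.restrict B) := hw.restrict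
  have hw1 : AEMeasurable (fun q : Rd d × Rd d => w q.1)
      ((volume.restrict B).prod (volume.restrict B)) :=
    hw'.comp_quasiMeasurePreserving Measure.quasiMeasurePreserving_fst
  have hw2 : AEMeasurable (fun q : Rd d × Rd d => w q.2)
      ((volume.restrict B).prod (volume.restrict B)) :=
    hw'.comp_quasiMeasurePreserving Measure.quasiMeasurePreserving_snd
  have hk' : Measurable fun q : Rd d × Rd d => (k q.1 q.2 : ℝ≥0∞) := hk.coe_nnreal_ennreal
  set c := ENNReal.ofReal (2 * M * η ^ (-((d : ℝ) + α)))
  have hfst : ∫⁻ q in B ×ˢ B, ‖w q.1‖ₑ * (k q.1 q.2 : ℝ≥0∞)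
      = ∫⁻ x in B, ‖w x‖ₑ * ∫⁻ y in B, (k x y : ℝ≥0∞) := by
    rw [Measure.volume_eq_prod, ← Measure.prod_restrict,
      lintegral_prod (fun q : Rd d × Rd d => ‖w q.1‖ₑ * (k q.1 q.2 : ℝ≥0∞))
        (hw1.enorm.mul hk'.aemeasurable)]
    refine lintegral_congr fun x => ?_
    exact lintegral_const_mul' ‖w x‖ₑ _ enorm_ne_top
  have hsnd : ∫⁻ q in B ×ˢ B, ‖w q.2‖ₑ * (k q.1 q.2 : ℝ≥0∞)
      = ∫⁻ x in B, ‖w x‖ₑ * ∫⁻ y in B, (k x y : ℝ≥0∞) := by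
    rw [Measure.volume_eq_prod, ← Measure.prod_restrict,
      lintegral_prod_symm (fun q : Rd d × Rd d => ‖w q.2‖ₑ * (k q.1 q.2 : ℝ≥0∞))
        (hw2.enorm.mul hk'.aemeasurable)]
    refine lintegral_congr fun x => ?_
    -- Symmetry of k makes the term with w at the second point equal to the one with w at the first.
    simp_rw [fun y => hsymm y x]
    exact lintegral_const_mul' ‖w x‖ₑ _ enorm_ne_top
  calc ∫⁻ q in midSet d η, ‖inc w q * inc g q‖ₑ ∂jumpMeasure α Γ k
      = ∫⁻ q in midSet d η, ‖inc w q * inc g q‖ₑ * (jump α Γ k q : ℝ≥0∞) :=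
        lintegral_jumpMeasure hj _ _
    _ ≤ ∫⁻ q in B ×ˢ B, c * (‖w q.1‖ₑ * (k q.1 q.2 : ℝ≥0∞) + ‖w q.2‖ₑ * (k q.1 q.2 : ℝ≥0∞)) := by
        rw [← lintegral_indicator (measurableSet_midSet η),
          ← lintegral_indicator (hB.prod hB)]
        refine lintegral_mono fun q => ?_
        by_cases hq : q ∈ midSet d η
        swap
        · rw [indicator_of_notMem hq]; exact zero_le
        rw [indicator_of_mem hq]
        by_cases hqB : q ∈ B ×ˢ B
        · rw [indicator_of_mem hqB, ← add_mul, enorm_mul]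
          have h1 : ‖inc w q‖ₑ ≤ ‖w q.1‖ₑ + ‖w q.2‖ₑ := enorm_sub_le
          have h2 : ‖inc g q‖ₑ ≤ ENNReal.ofReal (2 * M) := by
            rw [Real.enorm_eq_ofReal_abs]
            refine ENNReal.ofReal_le_ofReal ?_
            have := abs_sub (g q.1) (g q.2)
            simp only [inc]
            linarith [hM q.1, hM q.2]
          calc ‖inc w q‖ₑ * ‖inc g q‖ₑ * (jump α Γ k q : ℝ≥0∞)
              ≤ (‖w q.1‖ₑ + ‖w q.2‖ₑ) * ENNReal.ofReal (2 * M) *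
                (ENNReal.ofReal (η ^ (-((d : ℝ) + α))) * k q.1 q.2) := by
                gcongr
                exact jump_le hα hη hq
            _ = _ := by
                simp only [c]
                rw [ENNReal.ofReal_mul (by positivity : 0 ≤ 2 * M)]; ring
        -- If |x-y| < 1/η and one of the points is in B(0,R), both are in B(0, R + 1/η). So off B ×
        -- B both values of g vanish.
        · have hz : inc g q = 0 := by
            have hlt := hq.2
            have key : ∀ a b : Rd d, ‖a - b‖ < 1 / η → a ∈ Metric.ball (0 : Rd d) R →
                a ∈ B ∧ b ∈ B := by
              intro a b hab ha
              rw [mem_ball_zero_iff] at ha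
              have hpos : 0 < 1 / η := by positivity
              refine ⟨mem_ball_zero_iff.2 (by linarith), mem_ball_zero_iff.2 ?_⟩
              have := norm_sub_norm_le b a
              rw [norm_sub_rev] at this
              linarith
            have h1 : q.1 ∉ Metric.ball (0 : Rd d) R := fun h => hqB (key _ _ hlt h)
            have h2 : q.2 ∉ Metric.ball (0 : Rd d) R := fun h => by
              rw [norm_sub_rev] at hlt
              exact hqB ⟨(key _ _ hlt h).2, (key _ _ hlt h).1⟩
            simp [inc, hR _ h1, hR _ h2]
          simp [hz]
    _ = _ := by
        rw [lintegral_const_mul' _ _ ENNReal.ofReal_ne_top, lintegral_add_left', hfst, hsnd,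
          ← two_mul]
        rw [Measure.volume_eq_prod, ← Measure.prod_restrict]
        exact hw1.enorm.mul hk'.aemeasurable

/-- Bounded measurable square integrable functions are `L²` limits of smooth functions. -/
theorem exists_isCcInfty_tendsto {v : Rd d → ℝ} (hv : Measurable v) {M : ℝ} (hM : ∀ x, |v x| ≤ M)
    (hv2 : MemLp v 2 volume) :
    ∃ φ : ℕ → Rd d → ℝ, (∀ n, IsCcInfty (φ n)) ∧
      Tendsto (fun n => eLpNorm (φ n - v) 2 volume) atTop (𝓝 0) := by
  have h1 : ∀ n : ℕ, ∃ φ, IsCcInfty φ ∧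
      eLpNorm (φ - cutoff ((n : ℝ) + 1) * v) 2 volume < ENNReal.ofReal (1 / ((n : ℝ) + 1)) := by
    intro n
    -- Only the L² convergence is kept, so the jump kernel chosen here is immaterial.
    obtain ⟨φ, a1, a2, -⟩ := exists_isCcInfty_approx (α := 1) MeasurableSet.univ
      (measurable_const (a := (1 : ℝ≥0)))
      ((continuous_cutoff (d := d) ((n : ℝ) + 1)).measurable.mul hv)
      (fun x => (abs_cutoff_mul_le _ v x).trans (hM x))
      (fun x hx => by rw [Pi.mul_apply, cutoff_eq_zero (by positivity) hx, zero_mul])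
    obtain ⟨k, hk⟩ := (a2.eventually (gt_mem_nhds
      (ENNReal.ofReal_pos.2 (by positivity : 0 < 1 / ((n : ℝ) + 1))))).exists
    exact ⟨φ k, a1 k, hk⟩
  choose φ h2 h3 using h1
  refine ⟨φ, h2, ?_⟩
  have h4 : Tendsto (fun n : ℕ => ENNReal.ofReal (1 / ((n : ℝ) + 1))) atTop (𝓝 0) := by
    have := (ENNReal.continuous_ofReal.tendsto 0).comp
      (tendsto_one_div_add_atTop_nhds_zero_nat (𝕜 := ℝ))
    rwa [ENNReal.ofReal_zero] at this
  have h5 := h4.add (tendsto_eLpNorm_cutoff_mul_sub hv hv2)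
  rw [add_zero] at h5
  refine tendsto_of_tendsto_of_tendsto_of_le_of_le tendsto_const_nhds h5 (fun _ => zero_le) fun n => ?_
  have hc := (continuous_cutoff (d := d) ((n : ℝ) + 1)).measurable
  have e : φ n - v = (φ n - cutoff ((n : ℝ) + 1) * v) + (cutoff ((n : ℝ) + 1) * v - v) := by abel
  simp only []
  rw [e]
  refine (eLpNorm_add_le ?_ ?_ (by norm_num)).trans (by gcongr; exact (h3 n).le)
  · exact ((h2 n).1.continuous.measurable.sub (hc.mul hv)).aestronglyMeasurable
  · exact ((hc.mul hv).sub hv).aestronglyMeasurable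

theorem ae_ne_jumpMeasure {k : Rd d → Rd d → ℝ≥0} (hα : 0 < α) (hj : Measurable (jump α Γ k)) :
    ∀ᵐ q ∂jumpMeasure α Γ k, q.1 ≠ q.2 := by
  rw [jumpMeasure, ae_withDensity_iff hj.coe_nnreal_ennreal]
  refine ae_of_all _ fun q hq h => hq ?_
  have hs : (d : ℝ) + α ≠ 0 := by positivity
  simp [jump, h, NNReal.zero_rpow hs]

/-- A bound on the truncated energies is a bound on the energy. -/
theorem eLpNorm_inc_sq_le_of_midSet {k : Rd d → Rd d → ℝ≥0} (hα : 0 < α)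
    (hj : Measurable (jump α Γ k)) {u : Rd d → ℝ} (hu : Measurable u) {B : ℝ≥0∞}
    (hB : ∀ η ∈ Ioc (0 : ℝ) 1,
      eLpNorm (inc u) 2 ((jumpMeasure α Γ k).restrict (midSet d η)) ^ 2 ≤ B) :
    eLpNorm (inc u) 2 (jumpMeasure α Γ k) ^ 2 ≤ B := by
  have hcov : AECover (jumpMeasure α Γ k) (𝓝[>] (0 : ℝ)) (midSet d) :=
    ⟨by filter_upwards [ae_ne_jumpMeasure hα hj] with q hq using eventually_mem_midSet hq,
      measurableSet_midSet⟩
  have hui : Measurable fun q => ENNReal.ofReal (inc u q ^ 2) := by unfold inc; fun_prop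
  have := hcov.lintegral_tendsto_of_countably_generated hui.aemeasurable
  rw [eLpNorm_two_sq]
  refine le_of_tendsto this ?_
  filter_upwards [Ioc_mem_nhdsGT one_pos] with η hη
  rw [← eLpNorm_two_sq]
  exact hB η hη

end

/-! ### Typical environments and a priori bounds -/

section

variable {d : ℕ} {Ω : Type*} {τ : Rd d → Ω → Ω} {α p : ℝ} {Γ : Set (Rd d)} {μ : Ω → ℝ≥0}
  {κ : Rd d → Rd d → Ω → ℝ≥0} {K : Rd d → ℝ≥0} {ω : Ω}

/-- The properties of a single environment that are used in the passage to the limit. -/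
structure TypicalEnvironment (τ : Rd d → Ω → Ω) (α : ℝ) (Γ : Set (Rd d)) (μ : Ω → ℝ≥0)
    (κ : Rd d → Rd d → Ω → ℝ≥0) (K : Rd d → ℝ≥0) (p : ℝ) (ω : Ω) : Prop where
  alpha_pos : 0 < α
  measurableSet_cone : MeasurableSet Γ
  measurable_mu : Measurable fun x => μ (τ x ω)
  mu_pos : ∀ᵐ x : Rd d, 0 < μ (τ x ω)
  measurable_kappa : Measurable fun q : Rd d × Rd d => κ q.1 q.2 ω
  symm : ∀ x y, κ x y ω = κ y x ω
  averages : AveragesTo τ (fun ω => (μ ω : ℝ)) 1 ω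
  maximal : maximalFlow τ (fun ω => (μ ω : ℝ≥0∞)) ω < ∞
  one_lt : 1 < p
  maximal_rpow : maximalFlow τ (fun ω => (μ ω : ℝ≥0∞) ^ p) ω < ∞
  measurable_K : Measurable K
  levy : levyMass α Γ K < ∞
  compact : HypCompact τ α Γ μ κ ω
  jumps : HypJumps α κ ω
  moment : HypMoment κ ω
  forms : HypForms α Γ κ K ω

/-- The jump measure of the rescaled coefficient. -/
abbrev scaledJump (α : ℝ) (Γ : Set (Rd d)) (κ : Rd d → Rd d → Ω → ℝ≥0) (ε : ℝ) (ω : Ω) :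
    Measure (Rd d × Rd d) := jumpMeasure α Γ (scaledCoeff κ ε ω)

namespace TypicalEnvironment

theorem measurable_scaledCoeff (hT : TypicalEnvironment τ α Γ μ κ K p ω) (ε : ℝ) :
    Measurable fun q : Rd d × Rd d => scaledCoeff κ ε ω q.1 q.2 :=
  hT.measurable_kappa.comp
    ((measurable_fst.const_smul ε⁻¹).prodMk (measurable_snd.const_smul ε⁻¹))

theorem measurable_scaledJump (hT : TypicalEnvironment τ α Γ μ κ K p ω) (ε : ℝ) :
    Measurable (jump α Γ (scaledCoeff κ ε ω)) :=
  measurable_jump hT.measurableSet_cone (hT.measurable_scaledCoeff ε)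

theorem measurable_limitJump (hT : TypicalEnvironment τ α Γ μ κ K p ω) :
    Measurable (jump α Γ fun x y => K (x - y)) :=
  measurable_levyJump hT.measurableSet_cone hT.measurable_K

theorem measurable_density (hT : TypicalEnvironment τ α Γ μ κ K p ω) (ε : ℝ) :
    Measurable fun x => μ (τ (ε⁻¹ • x) ω) :=
  hT.measurable_mu.comp (measurable_const_smul ε⁻¹)

theorem scaledMeasure_ac : scaledMeasure τ μ ε ω ≪ volume := withDensity_absolutelyContinuous _ _

theorem ac_scaledMeasure (hT : TypicalEnvironment τ α Γ μ κ K p ω) {ε : ℝ} (hε : 0 < ε) :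
    (volume : Measure (Rd d)) ≪ scaledMeasure τ μ ε ω := by
  refine withDensity_absolutelyContinuous'
    (hT.measurable_density ε).coe_nnreal_ennreal.aemeasurable ?_
  have h0 : ε⁻¹ ≠ 0 := by positivity
  filter_upwards [(Measure.quasiMeasurePreserving_smul volume h0).ae hT.mu_pos] with x hx
  exact ENNReal.coe_ne_zero.2 hx.ne'

theorem integral_scaledMeasure (hT : TypicalEnvironment τ α Γ μ κ K p ω) (ε : ℝ) (h : Rd d → ℝ) :
    ∫ x, h x ∂scaledMeasure τ μ ε ω = ∫ x, h x * μ (τ (ε⁻¹ • x) ω) := by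
  rw [scaledMeasure, integral_withDensity_eq_integral_smul (hT.measurable_density ε)]
  refine integral_congr_ae (ae_of_all _ fun x => ?_)
  simp only [NNReal.smul_def, smul_eq_mul, mul_comm]

theorem setLIntegral_density_le (hT : TypicalEnvironment τ α Γ μ κ K p ω) {ε : ℝ} (hε : 0 < ε)
    (R : ℝ) : ∫⁻ x in Metric.ball 0 R, (μ (τ (ε⁻¹ • x) ω) : ℝ≥0∞) ≤
      ENNReal.ofReal ((|R| + 2 * ε) ^ d) * maximalFlow τ (fun ω => (μ ω : ℝ≥0∞)) ω :=
  setLIntegral_scaled_le_maximalFlow (F := fun ω => (μ ω : ℝ≥0∞))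
    hT.measurable_mu.coe_nnreal_ennreal hε

theorem setLIntegral_density_rpow_le (hT : TypicalEnvironment τ α Γ μ κ K p ω) {ε : ℝ}
    (hε : 0 < ε) (R : ℝ) : ∫⁻ x in Metric.ball 0 R, (μ (τ (ε⁻¹ • x) ω) : ℝ≥0∞) ^ p ≤
      ENNReal.ofReal ((|R| + 2 * ε) ^ d) * maximalFlow τ (fun ω => (μ ω : ℝ≥0∞) ^ p) ω :=
  setLIntegral_scaled_le_maximalFlow (F := fun ω => (μ ω : ℝ≥0∞) ^ p)
    (hT.measurable_mu.coe_nnreal_ennreal.pow_const p) hε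

theorem memLp_scaledMeasure (hT : TypicalEnvironment τ α Γ μ κ K p ω) {ε : ℝ} (hε : 0 < ε)
    {h : Rd d → ℝ} (hh : IsTest h) : MemLp h 2 (scaledMeasure τ μ ε ω) := by
  obtain ⟨M, hM0, hM⟩ := hh.bounded
  obtain ⟨R, hR0, hR⟩ := hh.support
  refine ⟨hh.measurable.aestronglyMeasurable, (ENNReal.pow_lt_top_iff.1 ?_).resolve_right
    two_ne_zero⟩
  rw [eLpNorm_two_sq]
  calc ∫⁻ x, ENNReal.ofReal (h x ^ 2) ∂scaledMeasure τ μ ε ω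
      ≤ ∫⁻ x in Metric.ball 0 R, ENNReal.ofReal (M ^ 2) ∂scaledMeasure τ μ ε ω := by
        rw [← lintegral_indicator Metric.isOpen_ball.measurableSet]
        refine lintegral_mono fun x => ?_
        by_cases hx : x ∈ Metric.ball (0 : Rd d) R
        · rw [indicator_of_mem hx]
          refine ENNReal.ofReal_le_ofReal ?_
          rw [← sq_abs]
          exact pow_le_pow_left₀ (abs_nonneg _) (hM x) 2
        · simp [hR x hx]
    _ < ∞ := by
        rw [setLIntegral_const, scaledMeasure, withDensity_apply _ Metric.isOpen_ball.measurableSet]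
        refine ENNReal.mul_lt_top ENNReal.ofReal_lt_top ((hT.setLIntegral_density_le hε R).trans_lt ?_)
        exact ENNReal.mul_lt_top ENNReal.ofReal_lt_top hT.maximal

theorem isResolvent_Ueps (hT : TypicalEnvironment τ α Γ μ κ K p ω) {ε : ℝ} (hε : 0 < ε) {lam : ℝ}
    (hl : 0 < lam) {f : Rd d → ℝ} (hf : IsCc f) :
    IsResolvent α Γ (scaledCoeff κ ε ω) (scaledMeasure τ μ ε ω) lam f (Ueps τ α Γ μ κ lam ε ω f) :=
  isResolvent_resolvent scaledMeasure_ac (hT.ac_scaledMeasure hε) (hT.measurable_scaledJump ε) hl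
    (hT.memLp_scaledMeasure hε hf.isTest)

theorem isResolvent_UK (hT : TypicalEnvironment τ α Γ μ κ K p ω) {lam : ℝ}
    (hl : 0 < lam) {f : Rd d → ℝ} (hf : IsCc f) :
    IsResolvent α Γ (fun x y => K (x - y)) volume lam f (UK α Γ K lam f) :=
  isResolvent_resolvent Measure.AbsolutelyContinuous.rfl Measure.AbsolutelyContinuous.rfl
    hT.measurable_limitJump hl (hf.1.memLp_of_hasCompactSupport hf.2)

theorem abs_Ueps_le (hT : TypicalEnvironment τ α Γ μ κ K p ω) {ε : ℝ} (hε : 0 < ε) {lam : ℝ}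
    (hl : 0 < lam) {f : Rd d → ℝ} (hf : IsCc f) {M : ℝ} (hM : ∀ x, |f x| ≤ M) :
    ∀ᵐ x, |Ueps τ α Γ μ κ lam ε ω f x| ≤ M / lam :=
  (hT.isResolvent_Ueps hε hl hf).ae_abs_le scaledMeasure_ac (hT.ac_scaledMeasure hε)
    (hT.measurable_scaledJump ε) hl (hT.memLp_scaledMeasure hε hf.isTest) hM

theorem formClosure_Ueps (hT : TypicalEnvironment τ α Γ μ κ K p ω) {ε : ℝ} (hε : 0 < ε) {lam : ℝ}
    (hl : 0 < lam) {f : Rd d → ℝ} (hf : IsCc f) :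
    FormClosure (scaledMeasure τ μ ε ω) (scaledJump α Γ κ ε ω) (Ueps τ α Γ μ κ lam ε ω f) :=
  (memDomain_iff scaledMeasure_ac (hT.measurable_scaledJump ε)).1 (hT.isResolvent_Ueps hε hl hf).1

/-- The a priori bound on the energies of the resolvents. -/
theorem exists_energy_bound (hT : TypicalEnvironment τ α Γ μ κ K p ω) {lam : ℝ}
    (hl : 0 < lam) {f : Rd d → ℝ} (hf : IsCc f) :
    ∃ C : ℝ, 0 ≤ C ∧ ∀ ε ∈ Ioc (0 : ℝ) 1,
      lam * ∫ x, Ueps τ α Γ μ κ lam ε ω f x * Ueps τ α Γ μ κ lam ε ω f x ∂scaledMeasure τ μ ε ω +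
      1 / 2 * ∫ q, inc (Ueps τ α Γ μ κ lam ε ω f) q * inc (Ueps τ α Γ μ κ lam ε ω f) q
        ∂scaledJump α Γ κ ε ω ≤ C := by
  obtain ⟨M, hM0, hM⟩ := hf.exists_bound
  obtain ⟨R, hR1, hR⟩ := hf.exists_ball
  set A := (ENNReal.ofReal ((|R| + 2) ^ d) * maximalFlow τ (fun ω => (μ ω : ℝ≥0∞)) ω).toReal
  refine ⟨M * (M / lam) * A, by positivity, fun ε hε => ?_⟩
  set u := Ueps τ α Γ μ κ lam ε ω f
  have hu := hT.isResolvent_Ueps hε.1 hl hf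
  -- Testing with u itself leaves ∫ f u dμ^ε, where |f u| ≤ M · M/λ on the ball carrying f; the
  -- maximal function bounds the mass of that ball uniformly in ε ≤ 1.
  have he := hu.2 _ hu.1
  rw [form_eq (hT.measurable_scaledJump ε)] at he
  rw [he]
  have hA : (scaledMeasure τ μ ε ω).real (Metric.ball 0 R) ≤ A := by
    refine ENNReal.toReal_mono
      (ENNReal.mul_ne_top ENNReal.ofReal_ne_top hT.maximal.ne) ?_
    rw [scaledMeasure, withDensity_apply _ Metric.isOpen_ball.measurableSet]
    refine (hT.setLIntegral_density_le hε.1 R).trans ?_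
    have hε0 := hε.1
    gcongr
    linarith [hε.2]
  have hfin : scaledMeasure τ μ ε ω (Metric.ball 0 R) < ∞ := by
    rw [scaledMeasure, withDensity_apply _ Metric.isOpen_ball.measurableSet]
    exact (hT.setLIntegral_density_le hε.1 R).trans_lt
      (ENNReal.mul_lt_top ENNReal.ofReal_lt_top hT.maximal)
  have hset : ∫ x, f x * u x ∂scaledMeasure τ μ ε ω
      = ∫ x in Metric.ball 0 R, f x * u x ∂scaledMeasure τ μ ε ω := by
    refine (setIntegral_eq_integral_of_forall_compl_eq_zero fun x hx => ?_).symm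
    rw [hR x hx, zero_mul]
  rw [hset]
  have hb : ∀ᵐ x ∂scaledMeasure τ μ ε ω, |u x| ≤ M / lam :=
    scaledMeasure_ac.ae_le (hT.abs_Ueps_le hε.1 hl hf hM)
  have := norm_setIntegral_le_of_norm_le_const_ae (μ := scaledMeasure τ μ ε ω)
    (s := Metric.ball 0 R) (f := fun x => f x * u x) (C := M * (M / lam)) hfin (by
      filter_upwards [ae_restrict_of_ae hb] with x hx
      rw [norm_mul]
      exact mul_le_mul (hM x) hx (abs_nonneg _) hM0)
  refine (le_abs_self _).trans (this.trans ?_)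
  gcongr

end TypicalEnvironment

end

/-! ### Passage to the limit in the L² pairing and in the truncated form -/

section

variable {d : ℕ} {Ω : Type*} {τ : Rd d → Ω → Ω} {α p : ℝ} {Γ : Set (Rd d)} {μ : Ω → ℝ≥0}
  {κ : Rd d → Rd d → Ω → ℝ≥0} {K : Rd d → ℝ≥0} {ω : Ω}

/-- Convergence in `L¹` of all balls. -/
def LocallyTendsto (u : ℝ → Rd d → ℝ) (l : Filter ℝ) (u₀ : Rd d → ℝ) : Prop :=
  ∀ r : ℝ, 1 < r →
    Tendsto (fun ε => eLpNorm (u ε - u₀) 1 (volume.restrict (Metric.ball 0 r))) l (𝓝 0)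

theorem tendsto_of_enorm_sub {ι : Type*} {l : Filter ι} {a : ι → ℝ} {b : ℝ}
    (h : Tendsto (fun i => ‖a i - b‖ₑ) l (𝓝 0)) : Tendsto a l (𝓝 b) := by
  rw [tendsto_iff_edist_tendsto_0]
  simpa only [edist_eq_enorm_sub] using h

theorem IsTest.indicator_ball (R : ℝ) (hR : 0 ≤ R) {v : Rd d → ℝ} (hv : Measurable v) {M : ℝ}
    (hM : ∀ x, |v x| ≤ M) : IsTest ((Metric.ball (0 : Rd d) R).indicator v) :=
  ⟨hv.indicator Metric.isOpen_ball.measurableSet, ⟨M, (abs_nonneg _).trans (hM 0), fun x =>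
    (norm_indicator_le_norm_self v x).trans (hM x)⟩, R, hR, fun _ hx => indicator_of_notMem hx _⟩

theorem IsTest.mul_left {h v : Rd d → ℝ} (hh : IsTest h) (hv : Measurable v) {M : ℝ}
    (hM : ∀ x, |v x| ≤ M) : IsTest fun x => v x * h x := by
  obtain ⟨N, hN0, hN⟩ := hh.bounded
  obtain ⟨R, hR0, hR⟩ := hh.support
  have hM0 : 0 ≤ M := (abs_nonneg _).trans (hM 0)
  refine ⟨hv.mul hh.measurable, ⟨M * N, by positivity, fun x => ?_⟩, R, hR0, fun x hx => ?_⟩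
  · rw [abs_mul]; exact mul_le_mul (hM x) (hN x) (abs_nonneg _) hM0
  · rw [hR x hx, mul_zero]

namespace TypicalEnvironment

theorem integrable_scaledMeasure (hT : TypicalEnvironment τ α Γ μ κ K p ω) {ε : ℝ} (hε : 0 < ε)
    {h : Rd d → ℝ} (hh : IsTest h) : Integrable h (scaledMeasure τ μ ε ω) := by
  obtain ⟨R, hR0, hR⟩ := hh.support
  have h1 : IsTest ((Metric.ball (0 : Rd d) R).indicator fun _ => (1 : ℝ)) :=
    IsTest.indicator_ball R hR0 measurable_const (M := 1) (by simp)
  refine (integrable_mul_of_memLp_two (hT.memLp_scaledMeasure hε hh)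
    (hT.memLp_scaledMeasure hε h1)).congr (ae_of_all _ fun x => ?_)
  by_cases hx : x ∈ Metric.ball (0 : Rd d) R
  · simp [indicator_of_mem hx]
  · simp [hR x hx]

theorem tendsto_integral_test (hT : TypicalEnvironment τ α Γ μ κ K p ω) {h : Rd d → ℝ}
    (hh : IsTest h) :
    Tendsto (fun ε => ∫ x, h x ∂scaledMeasure τ μ ε ω) (𝓝[>] 0) (𝓝 (∫ x, h x)) := by
  simpa only [hT.integral_scaledMeasure, one_mul] using hT.averages h hh

variable {l : Filter ℝ} {u : ℝ → Rd d → ℝ} {u₀ : Rd d → ℝ} {M : ℝ}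

/-- u ε is replaced by u₀ through the L^p bound on the density, and the fixed bounded weight u₀ h is
then left to the ergodic theorem. -/
theorem tendsto_integral_mul_test (hT : TypicalEnvironment τ α Γ μ κ K p ω) (hl : l ≤ 𝓝[>] 0)
    (hu : ∀ᶠ ε in l, AEStronglyMeasurable (u ε) volume)
    (huM : ∀ᶠ ε in l, ∀ᵐ x, |u ε x| ≤ M) (hu0 : Measurable u₀) (hu0M : ∀ x, |u₀ x| ≤ M)
    (hconv : LocallyTendsto u l u₀) {h : Rd d → ℝ} (hh : IsTest h) :
    Tendsto (fun ε => ∫ x, u ε x * h x ∂scaledMeasure τ μ ε ω) l (𝓝 (∫ x, u₀ x * h x)) := by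
  obtain ⟨N, hN0, hN⟩ := hh.bounded
  obtain ⟨R', hR'0, hR'⟩ := hh.support
  -- `LocallyTendsto` only speaks of radii above 1.
  set R := R' + 2
  have hR : ∀ x, x ∉ Metric.ball (0 : Rd d) R → h x = 0 := fun x hx =>
    hR' x fun h => hx (Metric.ball_subset_ball (by simp [R]) h)
  have hpos : ∀ᶠ ε in l, ε ∈ Ioc (0 : ℝ) 1 := hl (Ioc_mem_nhdsGT one_pos)
  have hmain : Tendsto (fun ε => ∫⁻ x in Metric.ball 0 R,
      ‖u ε x - u₀ x‖ₑ * (μ (τ (ε⁻¹ • x) ω) : ℝ≥0∞)) l (𝓝 0) := by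
    refine tendsto_lintegral_mul_weight (w := fun ε x => u ε x - u₀ x) (M := 2 * M) hT.one_lt
      ?_ ?_ (Eventually.of_forall fun ε => (hT.measurable_density ε).coe_nnreal_ennreal.aemeasurable)
      (B := ENNReal.ofReal ((|R| + 2) ^ d) * maximalFlow τ (fun ω => (μ ω : ℝ≥0∞) ^ p) ω)
      (ENNReal.mul_ne_top ENNReal.ofReal_ne_top hT.maximal_rpow.ne) ?_ ?_
    · filter_upwards [hu] with ε h1
      exact (h1.aemeasurable.sub hu0.aemeasurable).restrict
    · filter_upwards [huM] with ε h1
      filter_upwards [ae_restrict_of_ae h1] with x hx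
      have := abs_sub (u ε x) (u₀ x)
      linarith [hu0M x]
    · filter_upwards [hpos] with ε hε
      refine (hT.setLIntegral_density_rpow_le hε.1 R).trans ?_
      have hε0 := hε.1
      gcongr
      linarith [hε.2]
    · have := hconv R (by simp only [R]; linarith)
      simpa only [eLpNorm_one_eq_lintegral_enorm, Pi.sub_apply] using this
  have hdiff : Tendsto (fun ε => ∫ x, u ε x * h x ∂scaledMeasure τ μ ε ω -
      ∫ x, u₀ x * h x ∂scaledMeasure τ μ ε ω) l (𝓝 0) := by
    refine tendsto_of_enorm_sub ?_
    have h0 := ENNReal.Tendsto.const_mul (a := ENNReal.ofReal N) hmain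
      (Or.inr ENNReal.ofReal_ne_top)
    rw [mul_zero] at h0
    refine tendsto_of_tendsto_of_tendsto_of_le_of_le' tendsto_const_nhds h0
      (Eventually.of_forall fun _ => zero_le) ?_
    filter_upwards [hpos, hu, huM] with ε hε h1 h2
    have i0 := hT.integrable_scaledMeasure hε.1 hh
    have i1 : Integrable (fun x => u ε x * h x) (scaledMeasure τ μ ε ω) :=
      i0.bdd_mul (c := M) (h1.mono_ac scaledMeasure_ac) (scaledMeasure_ac.ae_le h2)
    have i2 : Integrable (fun x => u₀ x * h x) (scaledMeasure τ μ ε ω) :=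
      i0.bdd_mul (c := M) hu0.aestronglyMeasurable (ae_of_all _ hu0M)
    rw [sub_zero, ← integral_sub i1 i2]
    refine (enorm_integral_le_lintegral_enorm _).trans ?_
    rw [scaledMeasure, lintegral_withDensity_eq_lintegral_mul_non_measurable _
      (hT.measurable_density ε).coe_nnreal_ennreal (ae_of_all _ fun _ => ENNReal.coe_lt_top),
      ← lintegral_const_mul' _ _ ENNReal.ofReal_ne_top,
      ← lintegral_indicator Metric.isOpen_ball.measurableSet]
    refine lintegral_mono fun x => ?_
    by_cases hx : x ∈ Metric.ball (0 : Rd d) R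
    · rw [indicator_of_mem hx, Pi.mul_apply, ← sub_mul, enorm_mul]
      have : ‖h x‖ₑ ≤ ENNReal.ofReal N := by
        rw [Real.enorm_eq_ofReal_abs]; exact ENNReal.ofReal_le_ofReal (hN x)
      calc (μ (τ (ε⁻¹ • x) ω) : ℝ≥0∞) * (‖u ε x - u₀ x‖ₑ * ‖h x‖ₑ)
          ≤ (μ (τ (ε⁻¹ • x) ω) : ℝ≥0∞) * (‖u ε x - u₀ x‖ₑ * ENNReal.ofReal N) := by gcongr
        _ = _ := by ring
    · simp [hR x hx]
  have := hdiff.add ((hT.tendsto_integral_test (hh.mul_left hu0 hu0M)).mono_left hl)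
  simpa using this

/-- The local masses of the rescaled coefficient. -/
theorem measurable_mass (hT : TypicalEnvironment τ α Γ μ κ K p ω) (ε : ℝ) (B : Set (Rd d)) :
    Measurable fun x => ∫⁻ y in B, (scaledCoeff κ ε ω x y : ℝ≥0∞) :=
  (hT.measurable_scaledCoeff ε).coe_nnreal_ennreal.lintegral_prod_right'

theorem exists_moment_bound (hT : TypicalEnvironment τ α Γ μ κ K p ω) :
    ∃ q : ℝ, 1 < q ∧ ∀ R : ℝ, 1 ≤ R → ∃ B : ℝ≥0∞, B ≠ ∞ ∧ ∀ᶠ ε in 𝓝[>] (0 : ℝ),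
      ∫⁻ x in Metric.ball (0 : Rd d) R,
        (∫⁻ y in Metric.ball (0 : Rd d) R, (scaledCoeff κ ε ω x y : ℝ≥0∞)) ^ q ≤ B := by
  obtain ⟨q, hq, h⟩ := hT.moment
  refine ⟨q, hq, fun R hR => ?_⟩
  obtain ⟨B, hB1, hB2⟩ := exists_between (h R hR)
  exact ⟨B, hB2.ne, (eventually_lt_of_limsup_lt hB1).mono fun _ h => h.le⟩

/-- The complement of `midSet` consists of the small and the large jumps of `HypJumps`, whose kernel
without the cone restriction dominates the present one. The order of quantifiers matters: η is fixed
before ε becomes small. -/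
theorem eventually_tail_le (hT : TypicalEnvironment τ α Γ μ κ K p ω) {g : Rd d → ℝ}
    (hg : IsCcInfty g) {δ : ℝ≥0∞} (hδ : δ ≠ 0) :
    ∀ᶠ η in 𝓝[>] (0 : ℝ), ∀ᶠ ε in 𝓝[>] (0 : ℝ),
      eLpNorm (inc g) 2 ((scaledJump α Γ κ ε ω).restrict (midSet d η)ᶜ) ^ 2 ≤ δ := by
  have hδ2 : 0 < δ / 2 := ENNReal.half_pos hδ
  obtain ⟨h1, h2⟩ := hT.jumps g hg
  filter_upwards [h1.eventually (gt_mem_nhds hδ2), h2.eventually (gt_mem_nhds hδ2)] with η a1 a2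
  filter_upwards [eventually_lt_of_limsup_lt a1, eventually_lt_of_limsup_lt a2] with ε b1 b2
  rw [eLpNorm_two_sq, lintegral_jumpMeasure (hT.measurable_scaledJump ε)]
  have hsub : (midSet d η)ᶜ ⊆ {q | ‖q.1 - q.2‖ ≤ η} ∪ {q | 1 / η ≤ ‖q.1 - q.2‖} := by
    intro q hq
    by_contra hcon
    simp only [mem_union, mem_ofPred_eq, not_or, not_le] at hcon
    exact hq hcon
  have hjump : ∀ q, (jump α Γ (scaledCoeff κ ε ω) q : ℝ≥0∞) ≤ jump α univ (scaledCoeff κ ε ω) q := by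
    intro q
    rw [ENNReal.coe_le_coe]
    unfold jump
    split_ifs <;> simp_all
  calc ∫⁻ q in (midSet d η)ᶜ, ENNReal.ofReal (inc g q ^ 2) * (jump α Γ (scaledCoeff κ ε ω) q : ℝ≥0∞)
      ≤ ∫⁻ q in {q | ‖q.1 - q.2‖ ≤ η} ∪ {q | 1 / η ≤ ‖q.1 - q.2‖},
          ENNReal.ofReal (inc g q ^ 2) * (jump α univ (scaledCoeff κ ε ω) q : ℝ≥0∞) := by
        refine (lintegral_mono_set hsub).trans (lintegral_mono fun q => ?_)
        gcongr
        exact ENNReal.coe_le_coe.1 (hjump q)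
    _ ≤ _ := lintegral_union_le _ _ _
    _ ≤ δ / 2 + δ / 2 := add_le_add b1.le b2.le
    _ = δ := ENNReal.add_halves δ

/-- `HypJumps` covers the pairs off `midSet` for one suitable η. On `midSet` the local mass a of the
coefficient is integrable over a ball because a ≤ 1 + a^q and `HypMoment` applies. -/
theorem eventually_memLp_inc (hT : TypicalEnvironment τ α Γ μ κ K p ω) {g : Rd d → ℝ}
    (hg : IsCcInfty g) :
    ∀ᶠ ε in 𝓝[>] (0 : ℝ), MemLp (inc g) 2 (scaledJump α Γ κ ε ω) := by
  obtain ⟨η, hη, hη0, hη1⟩ :=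
    ((hT.eventually_tail_le hg one_ne_zero).and (Ioc_mem_nhdsGT one_pos)).exists
  obtain ⟨N, hN0, hN⟩ := hg.isCc.exists_bound
  obtain ⟨R, hR1, hR⟩ := hg.isCc.exists_ball
  obtain ⟨q, hq, hmom⟩ := hT.exists_moment_bound
  have hRη : 1 ≤ R + 1 / η := by have : 0 < 1 / η := by positivity
                                 linarith
  obtain ⟨B, hB, hBev⟩ := hmom (R + 1 / η) hRη
  filter_upwards [hη, hBev] with ε h1 h2
  have hgc := hg.1.continuous
  have hgi : Measurable (inc g) := by
    have := hgc.measurable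
    unfold inc; fun_prop
  refine ⟨hgi.aestronglyMeasurable, (ENNReal.pow_lt_top_iff.1 ?_).resolve_right two_ne_zero⟩
  rw [eLpNorm_two_sq, ← lintegral_add_compl _ (measurableSet_midSet η), ENNReal.add_lt_top]
  constructor
  · have h3 := lintegral_midSet_inc_mul_inc_le (hT.measurable_scaledCoeff ε)
      (fun x y => hT.symm _ _) (hT.measurable_scaledJump ε) hT.alpha_pos hη0 hN hR
      hgc.measurable.aemeasurable
    have h4 : ∫⁻ q in midSet d η, ENNReal.ofReal (inc g q ^ 2) ∂scaledJump α Γ κ ε ω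
        = ∫⁻ q in midSet d η, ‖inc g q * inc g q‖ₑ ∂scaledJump α Γ κ ε ω := by
      refine lintegral_congr fun q => ?_
      rw [← sq, Real.enorm_eq_ofReal (sq_nonneg _)]
    rw [h4]
    refine h3.trans_lt (ENNReal.mul_lt_top ENNReal.ofReal_lt_top
      (ENNReal.mul_lt_top (by simp) ?_))
    calc ∫⁻ x in Metric.ball 0 (R + 1 / η),
          ‖g x‖ₑ * ∫⁻ y in Metric.ball 0 (R + 1 / η), (scaledCoeff κ ε ω x y : ℝ≥0∞)
        ≤ ∫⁻ x in Metric.ball 0 (R + 1 / η), ENNReal.ofReal N *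
          (1 + (∫⁻ y in Metric.ball 0 (R + 1 / η), (scaledCoeff κ ε ω x y : ℝ≥0∞)) ^ q) := by
          refine lintegral_mono fun x => ?_
          have : ‖g x‖ₑ ≤ ENNReal.ofReal N := by
            rw [Real.enorm_eq_ofReal_abs]; exact ENNReal.ofReal_le_ofReal (hN x)
          refine mul_le_mul' this ?_
          generalize ∫⁻ y in Metric.ball 0 (R + 1 / η), (scaledCoeff κ ε ω x y : ℝ≥0∞) = a
          rcases le_total a 1 with ha | ha
          · exact ha.trans le_self_add
          · exact (ENNReal.le_rpow_self_of_one_le ha hq.le).trans le_add_self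
      _ = ENNReal.ofReal N * (volume (Metric.ball (0 : Rd d) (R + 1 / η)) +
          ∫⁻ x in Metric.ball 0 (R + 1 / η),
          (∫⁻ y in Metric.ball 0 (R + 1 / η), (scaledCoeff κ ε ω x y : ℝ≥0∞)) ^ q) := by
          rw [lintegral_const_mul' _ _ ENNReal.ofReal_ne_top, lintegral_add_left measurable_const,
            setLIntegral_const, one_mul]
      _ < ∞ := ENNReal.mul_lt_top ENNReal.ofReal_lt_top
          (ENNReal.add_lt_top.2 ⟨measure_ball_lt_top, h2.trans_lt hB.lt_top⟩)
  · rw [← eLpNorm_two_sq]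
    exact h1.trans_lt ENNReal.one_lt_top

/-- The error made in replacing u ε by u₀ is a weighted L¹ norm of u ε - u₀, the weight being
bounded in L^q by `HypMoment`; what remains is `HypForms` for the bounded function u₀. -/
theorem tendsto_integral_midSet (hT : TypicalEnvironment τ α Γ μ κ K p ω) (hl : l ≤ 𝓝[>] 0)
    (hu : ∀ᶠ ε in l, AEStronglyMeasurable (u ε) volume)
    (hui : ∀ᶠ ε in l, MemLp (inc (u ε)) 2 (scaledJump α Γ κ ε ω))
    (huM : ∀ᶠ ε in l, ∀ᵐ x, |u ε x| ≤ M) (hu0 : Measurable u₀) (hu0M : ∀ x, |u₀ x| ≤ M)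
    (hconv : LocallyTendsto u l u₀) {g : Rd d → ℝ} (hg : IsCcInfty g) {η : ℝ} (hη : 0 < η) :
    Tendsto (fun ε => ∫ q in midSet d η, inc (u ε) q * inc g q ∂scaledJump α Γ κ ε ω) l
      (𝓝 (∫ q in midSet d η, inc u₀ q * inc g q ∂levyMeasure α Γ K)) := by
  obtain ⟨N, hN0, hN⟩ := hg.isCc.exists_bound
  obtain ⟨R, hR1, hR⟩ := hg.isCc.exists_ball
  obtain ⟨q, hq, hmom⟩ := hT.exists_moment_bound
  have hη' : 0 < 1 / η := by positivity
  obtain ⟨B, hB, hBev⟩ := hmom (R + 1 / η) (by linarith)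
  have hmain : Tendsto (fun ε => ∫⁻ x in Metric.ball 0 (R + 1 / η), ‖u ε x - u₀ x‖ₑ *
      ∫⁻ y in Metric.ball 0 (R + 1 / η), (scaledCoeff κ ε ω x y : ℝ≥0∞)) l (𝓝 0) := by
    refine tendsto_lintegral_mul_weight (w := fun ε x => u ε x - u₀ x) (M := 2 * M) hq
      ?_ ?_ (Eventually.of_forall fun ε => (hT.measurable_mass ε _).aemeasurable) hB (hl hBev) ?_
    · filter_upwards [hu] with ε h1
      exact (h1.aemeasurable.sub hu0.aemeasurable).restrict
    · filter_upwards [huM] with ε h1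
      filter_upwards [ae_restrict_of_ae h1] with x hx
      have := abs_sub (u ε x) (u₀ x)
      linarith [hu0M x]
    · have := hconv (R + 1 / η) (by linarith)
      simpa only [eLpNorm_one_eq_lintegral_enorm, Pi.sub_apply] using this
  set c := ENNReal.ofReal (2 * N * η ^ (-((d : ℝ) + α)))
  have hdiff : Tendsto (fun ε => ∫ q in midSet d η, inc (u ε) q * inc g q ∂scaledJump α Γ κ ε ω -
      ∫ q in midSet d η, inc u₀ q * inc g q ∂scaledJump α Γ κ ε ω) l (𝓝 0) := by
    refine tendsto_of_enorm_sub ?_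
    have h0 := ENNReal.Tendsto.const_mul (a := c)
      (ENNReal.Tendsto.const_mul (a := 2) hmain (Or.inr (by simp))) (Or.inr ENNReal.ofReal_ne_top)
    simp only [mul_zero] at h0
    refine tendsto_of_tendsto_of_tendsto_of_le_of_le' tendsto_const_nhds h0
      (Eventually.of_forall fun _ => zero_le) ?_
    filter_upwards [hu, hui, hl (hT.eventually_memLp_inc hg),
      h0.eventually (gt_mem_nhds ENNReal.zero_lt_top)] with ε h1 h2 h3 h4
    have hb := lintegral_midSet_inc_mul_inc_le (hT.measurable_scaledCoeff ε)
      (fun x y => hT.symm _ _) (hT.measurable_scaledJump ε) hT.alpha_pos hη hN hR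
      (w := fun x => u ε x - u₀ x) (h1.aemeasurable.sub hu0.aemeasurable)
    have i1 : IntegrableOn (fun q => inc (u ε) q * inc g q) (midSet d η)
        (scaledJump α Γ κ ε ω) := (integrable_mul_of_memLp_two h2 h3).integrableOn
    -- u₀ is not known to have finite energy for the rescaled kernel. The product is integrable
    -- because the bound `hb` is finite once ε is far enough along l.
    have i2 : IntegrableOn (fun q => inc (fun x => u ε x - u₀ x) q * inc g q) (midSet d η)
        (scaledJump α Γ κ ε ω) := by
      refine ⟨?_, hb.trans_lt h4⟩
      have := aestronglyMeasurable_inc (h1.sub hu0.aestronglyMeasurable)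
      exact ((this.mono_ac jumpMeasure_absolutelyContinuous).mul h3.1).restrict
    have e : ∫ q in midSet d η, inc u₀ q * inc g q ∂scaledJump α Γ κ ε ω
        = ∫ q in midSet d η, inc (u ε) q * inc g q ∂scaledJump α Γ κ ε ω -
          ∫ q in midSet d η, inc (fun x => u ε x - u₀ x) q * inc g q ∂scaledJump α Γ κ ε ω := by
      rw [← integral_sub i1 i2]
      refine integral_congr_ae (ae_of_all _ fun q => ?_)
      simp only [inc]; ring
    rw [e, sub_zero, sub_sub_cancel]
    exact (enorm_integral_le_lintegral_enorm _).trans hb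
  have h5 := (hT.forms η hη u₀ g ⟨hu0, M, hu0M⟩ hg).mono_left hl
  simp_rw [formOn_eq (hT.measurable_scaledJump _)] at h5
  rw [formOn_eq hT.measurable_limitJump] at h5
  have h6 := hdiff.add (show Tendsto (fun ε => ∫ q in midSet d η, inc u₀ q * inc g q
    ∂scaledJump α Γ κ ε ω) l (𝓝 (∫ q in midSet d η, inc u₀ q * inc g q ∂levyMeasure α Γ K)) from h5)
  simpa only [sub_add_cancel, zero_add] using h6

end TypicalEnvironment

end

/-! ### Lower semicontinuity and convergence of the full form -/

section

variable {d : ℕ} {Ω : Type*} {τ : Rd d → Ω → Ω} {α p : ℝ} {Γ : Set (Rd d)} {μ : Ω → ℝ≥0}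
  {κ : Rd d → Rd d → Ω → ℝ≥0} {K : Rd d → ℝ≥0} {ω : Ω}

/-- A family that is bounded in `L^∞` and in the norms of the rescaled forms and converges in
`L¹` of all balls. -/
structure BoundedConvergence (τ : Rd d → Ω → Ω) (α : ℝ) (Γ : Set (Rd d)) (μ : Ω → ℝ≥0)
    (κ : Rd d → Rd d → Ω → ℝ≥0) (ω : Ω) (l : Filter ℝ) (u : ℝ → Rd d → ℝ) (u₀ : Rd d → ℝ)
    (M A : ℝ) : Prop where
  le : l ≤ 𝓝[>] 0
  aesm : ∀ᶠ ε in l, AEStronglyMeasurable (u ε) volume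
  memLp : ∀ᶠ ε in l, MemLp (u ε) 2 (scaledMeasure τ μ ε ω)
  memLp_inc : ∀ᶠ ε in l, MemLp (inc (u ε)) 2 (scaledJump α Γ κ ε ω)
  ae_le : ∀ᶠ ε in l, ∀ᵐ x, |u ε x| ≤ M
  nonneg : 0 ≤ A
  sq_le : ∀ᶠ ε in l, ∫ x, u ε x * u ε x ∂scaledMeasure τ μ ε ω ≤ A
  energy_le : ∀ᶠ ε in l, ∫ q, inc (u ε) q * inc (u ε) q ∂scaledJump α Γ κ ε ω ≤ A
  measurable : Measurable u₀
  limit_le : ∀ x, |u₀ x| ≤ M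
  tendsto : LocallyTendsto u l u₀

theorem eLpNorm_two_sq_eq_ofReal {X : Type*} [MeasurableSpace X] {ν : Measure X} {f : X → ℝ}
    (hf : MemLp f 2 ν) : eLpNorm f 2 ν ^ 2 = ENNReal.ofReal (∫ x, f x * f x ∂ν) := by
  simp only [← sq]
  rw [← toReal_eLpNorm_two_sq f hf.1, ENNReal.ofReal_toReal (ENNReal.pow_ne_top hf.2.ne)]

theorem two_mul_integral_mul_le {X : Type*} [MeasurableSpace X] {ν : Measure X} {f g : X → ℝ}
    (hf : MemLp f 2 ν) (hg : MemLp g 2 ν) :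
    2 * ∫ x, f x * g x ∂ν ≤ ∫ x, f x * f x ∂ν + ∫ x, g x * g x ∂ν := by
  rw [← integral_const_mul, ← integral_add (integrable_mul_of_memLp_two hf hf)
    (integrable_mul_of_memLp_two hg hg)]
  refine integral_mono ((integrable_mul_of_memLp_two hf hg).const_mul 2)
    ((integrable_mul_of_memLp_two hf hf).add (integrable_mul_of_memLp_two hg hg)) fun x => ?_
  have := sq_nonneg (f x - g x)
  dsimp only
  nlinarith

theorem setIntegral_mul_self_le {X : Type*} [MeasurableSpace X] {ν : Measure X} {f : X → ℝ}
    (hf : MemLp f 2 ν) (S : Set X) : ∫ x in S, f x * f x ∂ν ≤ ∫ x, f x * f x ∂ν :=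
  setIntegral_le_integral (integrable_mul_of_memLp_two hf hf)
    (ae_of_all _ fun x => mul_self_nonneg (f x))

namespace BoundedConvergence

variable {l : Filter ℝ} [l.NeBot] {u : ℝ → Rd d → ℝ} {u₀ : Rd d → ℝ} {M A : ℝ}

/-- Lower semicontinuity by duality: with v = u₀ on the ball and 0 outside, 2 u v ≤ u² + v² is
integrated against μ^ε, and both terms containing v converge. The limit reads 2∫u₀² ≤ A + ∫u₀² over
the ball. -/
theorem setIntegral_sq_le (hT : TypicalEnvironment τ α Γ μ κ K p ω)
    (h : BoundedConvergence τ α Γ μ κ ω l u u₀ M A) {R : ℝ} (hR : 0 ≤ R) :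
    ∫ x in Metric.ball 0 R, u₀ x * u₀ x ≤ A := by
  set v := (Metric.ball (0 : Rd d) R).indicator u₀
  have hv : IsTest v := IsTest.indicator_ball R hR h.measurable h.limit_le
  have e1 : ∀ x, u₀ x * v x = (Metric.ball (0 : Rd d) R).indicator (fun x => u₀ x * u₀ x) x :=
    fun x => by by_cases hx : x ∈ Metric.ball (0 : Rd d) R <;> simp [v, hx]
  have e2 : ∀ x, v x * v x = (Metric.ball (0 : Rd d) R).indicator (fun x => u₀ x * u₀ x) x :=
    fun x => by by_cases hx : x ∈ Metric.ball (0 : Rd d) R <;> simp [v, hx]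
  have t1 := hT.tendsto_integral_mul_test h.le h.aesm h.ae_le h.measurable h.limit_le h.tendsto hv
  obtain ⟨N, -, hN⟩ := hv.bounded
  have t2 := (hT.tendsto_integral_test (hv.mul_left hv.measurable hN)).mono_left h.le
  simp only [e1] at t1
  simp only [e2] at t2
  rw [integral_indicator Metric.isOpen_ball.measurableSet] at t1 t2
  have hpos : ∀ᶠ ε in l, ε ∈ Ioi (0 : ℝ) := h.le self_mem_nhdsWithin
  have hle := le_of_tendsto_of_tendsto (t1.const_mul 2) (t2.const_add A) (by
    filter_upwards [hpos, h.memLp, h.sq_le] with ε hε h1 h2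
    have := two_mul_integral_mul_le h1 (hT.memLp_scaledMeasure hε hv)
    simp only [e2] at this
    linarith)
  linarith

theorem memLp_two (hT : TypicalEnvironment τ α Γ μ κ K p ω)
    (h : BoundedConvergence τ α Γ μ κ ω l u u₀ M A) : MemLp u₀ 2 volume := by
  refine ⟨h.measurable.aestronglyMeasurable, (ENNReal.pow_lt_top_iff.1 ?_).resolve_right
    two_ne_zero⟩
  rw [eLpNorm_two_sq]
  have hm : Measurable fun x => ENNReal.ofReal (u₀ x ^ 2) :=
    (h.measurable.pow_const 2).ennreal_ofReal
  have hc := (aecover_ball (μ := (volume : Measure (Rd d))) (x := 0)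
    (tendsto_natCast_atTop_atTop (R := ℝ))).lintegral_tendsto_of_countably_generated hm.aemeasurable
  refine (le_of_tendsto' hc fun n => ?_).trans_lt (ENNReal.ofReal_lt_top (r := A))
  have hb : IsTest ((Metric.ball (0 : Rd d) n).indicator u₀) :=
    IsTest.indicator_ball n n.cast_nonneg h.measurable h.limit_le
  have hi : IntegrableOn (fun x => u₀ x ^ 2) (Metric.ball 0 n) := by
    have := (hb.mul_left h.measurable h.limit_le).integrable
    refine (this.integrableOn (s := Metric.ball 0 n)).congr_fun (fun x hx => ?_)
      Metric.isOpen_ball.measurableSet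
    simp only [indicator_of_mem hx, sq]
  rw [← ofReal_integral_eq_lintegral_ofReal hi (ae_of_all _ fun x => sq_nonneg _)]
  refine ENNReal.ofReal_le_ofReal ?_
  simpa only [sq] using h.setIntegral_sq_le hT n.cast_nonneg

/-- The same duality for the energy. Convergence of truncated forms needs a smooth second argument,
so one tests with smooth φ n on `midSet`, lets ε → 0, then φ n → u₀, and finally η → 0 with the
bound A unchanged. -/
theorem memLp_inc_limit (hT : TypicalEnvironment τ α Γ μ κ K p ω)
    (h : BoundedConvergence τ α Γ μ κ ω l u u₀ M A) : MemLp (inc u₀) 2 (levyMeasure α Γ K) := by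
  have hu2 := h.memLp_two hT
  have haesm : AEStronglyMeasurable (inc u₀) (levyMeasure α Γ K) :=
    (aestronglyMeasurable_inc h.measurable.aestronglyMeasurable).mono_ac
      jumpMeasure_absolutelyContinuous
  refine ⟨haesm, (ENNReal.pow_lt_top_iff.1 ((eLpNorm_inc_sq_le_of_midSet hT.alpha_pos
    hT.measurable_limitJump h.measurable (B := ENNReal.ofReal A) fun η hη => ?_).trans_lt
    ENNReal.ofReal_lt_top)).resolve_right two_ne_zero⟩
  set J := (levyMeasure α Γ K).restrict (midSet d η)
  -- At fixed η the energy of u₀ is finite a priori, since u₀ ∈ L².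
  have hfin : MemLp (inc u₀) 2 J := by
    refine ⟨haesm.restrict, (ENNReal.pow_lt_top_iff.1 ((eLpNorm_inc_midSet_sq_le
      hT.measurableSet_cone hT.measurable_K hη.1 hη.2 h.measurable).trans_lt ?_)).resolve_right
      two_ne_zero⟩
    exact ENNReal.mul_lt_top (ENNReal.mul_lt_top ENNReal.ofReal_lt_top hT.levy)
      (ENNReal.pow_lt_top hu2.2)
  obtain ⟨φ, hφ, hφt⟩ := exists_isCcInfty_tendsto h.measurable h.limit_le hu2
  have hφm : ∀ n, MemLp (inc (φ n)) 2 J := fun n =>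
    ((hφ n).memLp_inc hT.measurableSet_cone hT.measurable_K hT.levy).restrict _
  have hconv : Tendsto (fun n => eLpNorm (inc (φ n) - inc u₀) 2 J) atTop (𝓝 0) := by
    simp only [← inc_sub]
    exact tendsto_eLpNorm_inc_midSet hT.measurableSet_cone hT.measurable_K hT.levy hη.1 hη.2
      (fun n => (hφ n).1.continuous.measurable.sub h.measurable) hφt
  have key : ∀ n, 2 * ∫ q, inc u₀ q * inc (φ n) q ∂J ≤ A + ∫ q, inc (φ n) q * inc (φ n) q ∂J := by
    intro n
    obtain ⟨N, -, hN⟩ := (hφ n).isCc.exists_bound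
    have t1 := hT.tendsto_integral_midSet h.le h.aesm h.memLp_inc h.ae_le h.measurable h.limit_le
      h.tendsto (hφ n) hη.1
    have t2 := hT.tendsto_integral_midSet (u := fun _ => φ n) (u₀ := φ n) (M := N) h.le
      (Eventually.of_forall fun _ => (hφ n).1.continuous.aestronglyMeasurable)
      (h.le (hT.eventually_memLp_inc (hφ n))) (Eventually.of_forall fun _ => ae_of_all _ hN)
      (hφ n).1.continuous.measurable hN (fun r _ => by simp) (hφ n) hη.1
    refine le_of_tendsto_of_tendsto (t1.const_mul 2) (t2.const_add A) ?_
    filter_upwards [h.memLp_inc, h.le (hT.eventually_memLp_inc (hφ n)), h.energy_le] with ε h1 h2 h3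
    have := two_mul_integral_mul_le (h1.restrict (midSet d η)) (h2.restrict (midSet d η))
    have := setIntegral_mul_self_le h1 (midSet d η)
    linarith
  have c1 : Tendsto (fun n => ∫ q, inc u₀ q * inc (φ n) q ∂J) atTop
      (𝓝 (∫ q, inc u₀ q * inc u₀ q ∂J)) :=
    tendsto_integral_mul_of_L2 (fun _ => hfin) hfin hφm hfin (by simp) hconv
  have c2 := tendsto_integral_mul_of_L2 hφm hfin hφm hfin hconv hconv
  have := le_of_tendsto_of_tendsto' (c1.const_mul 2) (c2.const_add A) key
  rw [eLpNorm_two_sq_eq_ofReal hfin]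
  exact ENNReal.ofReal_le_ofReal (by linarith)

theorem tendsto_integral_inc (hT : TypicalEnvironment τ α Γ μ κ K p ω)
    (h : BoundedConvergence τ α Γ μ κ ω l u u₀ M A) {g : Rd d → ℝ} (hg : IsCcInfty g) :
    Tendsto (fun ε => ∫ q, inc (u ε) q * inc g q ∂scaledJump α Γ κ ε ω) l
      (𝓝 (∫ q, inc u₀ q * inc g q ∂levyMeasure α Γ K)) := by
  have hgK := hg.memLp_inc hT.measurableSet_cone hT.measurable_K hT.levy
  rw [Metric.tendsto_nhds]
  intro δ hδ
  have hA := h.nonneg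
  -- The tail of g is made at most δ' and that of u ε is at most A + 1, because x² ≤ A implies x ≤ A
  -- + 1. The product is δ/3, one of three errors.
  set δ' := δ / (3 * (A + 1))
  have hδ' : 0 < δ' := by positivity
  obtain ⟨η, hη1, hη2, hη0⟩ := ((hT.eventually_tail_le hg
    (δ := ENNReal.ofReal (δ' ^ 2)) (ENNReal.ofReal_pos.2 (by positivity)).ne').and
    (((StableHomog.tendsto_integral_midSet (h.memLp_inc_limit hT) hgK).eventually
      (Metric.ball_mem_nhds _ (show 0 < δ / 3 by positivity))).and
        (self_mem_nhdsWithin : Ioi (0 : ℝ) ∈ _))).exists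
  have t1 := hT.tendsto_integral_midSet h.le h.aesm h.memLp_inc h.ae_le h.measurable h.limit_le
    h.tendsto hg hη0
  filter_upwards [h.le hη1, t1.eventually (Metric.ball_mem_nhds _ (show 0 < δ / 3 by positivity)),
    h.memLp_inc, h.le (hT.eventually_memLp_inc hg), h.energy_le] with ε a1 a2 a3 a4 a5
  have b := abs_integral_sub_midSet_le a3 a4 η
  have b1 : (eLpNorm (inc (u ε)) 2 ((scaledJump α Γ κ ε ω).restrict (midSet d η)ᶜ)).toReal
      ≤ A + 1 := by
    have h1 : (eLpNorm (inc (u ε)) 2 (scaledJump α Γ κ ε ω)).toReal ^ 2 ≤ A := by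
      rw [← ENNReal.toReal_pow, eLpNorm_two_sq_eq_ofReal a3]
      exact (ENNReal.toReal_mono ENNReal.ofReal_ne_top (ENNReal.ofReal_le_ofReal a5)).trans
        (ENNReal.toReal_ofReal hA).le
    refine (ENNReal.toReal_mono a3.2.ne (eLpNorm_mono_measure _ Measure.restrict_le_self)).trans ?_
    nlinarith
  have b2 : (eLpNorm (inc g) 2 ((scaledJump α Γ κ ε ω).restrict (midSet d η)ᶜ)).toReal ≤ δ' := by
    rw [← abs_of_nonneg hδ'.le, ← abs_of_nonneg (ENNReal.toReal_nonneg (a := eLpNorm _ _ _)),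
      ← sq_le_sq, ← ENNReal.toReal_pow]
    exact ENNReal.toReal_le_of_le_ofReal (sq_nonneg _) a1
  have b3 := b.trans (mul_le_mul b1 b2 ENNReal.toReal_nonneg (by linarith))
  have b4 : (A + 1) * δ' = δ / 3 := by
    simp only [δ']; field_simp
  rw [b4] at b3
  rw [Real.dist_eq] at hη2 a2
  rw [Real.dist_eq]
  rw [abs_lt] at *
  rw [abs_le] at b3
  constructor <;> linarith [hη2.1, hη2.2, a2.1, a2.2, b3.1, b3.2]

end BoundedConvergence

end

/-! ### Identification of the limit and convergence of the resolvents -/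

section

variable {d : ℕ} {Ω : Type*} {τ : Rd d → Ω → Ω} {α p : ℝ} {Γ : Set (Rd d)} {μ : Ω → ℝ≥0}
  {κ : Rd d → Rd d → Ω → ℝ≥0} {K : Rd d → ℝ≥0} {ω : Ω}

theorem integral_mul_congr_left {X : Type*} [MeasurableSpace X] {ν : Measure X} {f f' g : X → ℝ}
    (h : f =ᵐ[ν] f') : ∫ x, f x * g x ∂ν = ∫ x, f' x * g x ∂ν :=
  integral_congr_ae (h.mul (EventuallyEq.refl _ g))

namespace TypicalEnvironment

variable {lam M : ℝ} {f g : Rd d → ℝ}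

theorem eventually_memDomain (hT : TypicalEnvironment τ α Γ μ κ K p ω) (hg : IsCcInfty g) :
    ∀ᶠ ε in 𝓝[>] (0 : ℝ),
      MemDomain α Γ (scaledCoeff κ ε ω) (scaledMeasure τ μ ε ω) g := by
  filter_upwards [hT.eventually_memLp_inc hg, self_mem_nhdsWithin] with ε h1 hε
  exact (memDomain_iff scaledMeasure_ac (hT.measurable_scaledJump ε)).2
    (FormClosure.of_isCcOne hg.isCcOne (hT.memLp_scaledMeasure hε hg.isCc.isTest) h1)

theorem memDomain_limit (hT : TypicalEnvironment τ α Γ μ κ K p ω) (hg : IsCcInfty g) :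
    MemDomain α Γ (fun x y => K (x - y)) volume g :=
  (memDomain_iff Measure.AbsolutelyContinuous.rfl hT.measurable_limitJump).2
    (FormClosure.of_isCcOne hg.isCcOne (hg.1.continuous.memLp_of_hasCompactSupport hg.2)
      (hg.memLp_inc hT.measurableSet_cone hT.measurable_K hT.levy))

theorem tendsto_integral_source (hT : TypicalEnvironment τ α Γ μ κ K p ω) (hf : IsCc f)
    (hg : IsCcInfty g) :
    Tendsto (fun ε => ∫ x, f x * g x ∂scaledMeasure τ μ ε ω) (𝓝[>] 0)
      (𝓝 (∫ x, f x * g x)) := by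
  obtain ⟨N, -, hN⟩ := hf.exists_bound
  exact hT.tendsto_integral_test (hg.isCc.isTest.mul_left hf.1.measurable hN)

theorem exists_boundedConvergence_Ueps (hT : TypicalEnvironment τ α Γ μ κ K p ω) (hl : 0 < lam)
    (hf : IsCc f) (hM : ∀ x, |f x| ≤ M) :
    ∃ A : ℝ, ∀ (l : Filter ℝ) (u₀ : Rd d → ℝ), l ≤ 𝓝[>] 0 → Measurable u₀ →
      (∀ x, |u₀ x| ≤ M / lam) → LocallyTendsto (fun ε => Ueps τ α Γ μ κ lam ε ω f) l u₀ →
      BoundedConvergence τ α Γ μ κ ω l (fun ε => Ueps τ α Γ μ κ lam ε ω f) u₀ (M / lam) A := by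
  obtain ⟨C, hC, hCb⟩ := hT.exists_energy_bound hl hf
  have hC' : 0 ≤ C / lam := by positivity
  -- The two terms of the energy bound are nonnegative: one yields C/λ for the square norm, the
  -- other 2C for the energy. The sum serves for both.
  refine ⟨C / lam + 2 * C, fun l u₀ hl0 hm hb ht => ?_⟩
  have hpos : ∀ᶠ ε in l, ε ∈ Ioc (0 : ℝ) 1 := hl0 (Ioc_mem_nhdsGT one_pos)
  refine ⟨hl0, hpos.mono fun ε hε => (hT.formClosure_Ueps hε.1 hl hf).aesm,
    hpos.mono fun ε hε => (hT.formClosure_Ueps hε.1 hl hf).memLp,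
    hpos.mono fun ε hε => (hT.formClosure_Ueps hε.1 hl hf).memLp_inc,
    hpos.mono fun ε hε => hT.abs_Ueps_le hε.1 hl hf hM, by positivity,
    hpos.mono fun ε hε => ?_, hpos.mono fun ε hε => ?_, hm, hb, ht⟩
  all_goals
    have h1 := hCb ε hε
    have h2 : 0 ≤ ∫ x, Ueps τ α Γ μ κ lam ε ω f x * Ueps τ α Γ μ κ lam ε ω f x
      ∂scaledMeasure τ μ ε ω := integral_nonneg fun x => mul_self_nonneg _
    have h3 : 0 ≤ ∫ q, inc (Ueps τ α Γ μ κ lam ε ω f) q * inc (Ueps τ α Γ μ κ lam ε ω f) q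
      ∂scaledJump α Γ κ ε ω := integral_nonneg fun q => mul_self_nonneg _
  · have : ∫ x, Ueps τ α Γ μ κ lam ε ω f x * Ueps τ α Γ μ κ lam ε ω f x
        ∂scaledMeasure τ μ ε ω ≤ C / lam := by
      rw [le_div_iff₀ hl]; linarith
    linarith
  · have := mul_nonneg hl.le h2
    linarith

/-- Every bounded limit point of the rescaled resolvents is the limiting resolvent. -/
theorem ae_eq_UK (hT : TypicalEnvironment τ α Γ μ κ K p ω) (hl : 0 < lam) (hf : IsCc f)
    (hM0 : 0 ≤ M) (hM : ∀ x, |f x| ≤ M) {l : Filter ℝ} [l.NeBot] {u₀ : Rd d → ℝ} {A : ℝ}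
    (h : BoundedConvergence τ α Γ μ κ ω l (fun ε => Ueps τ α Γ μ κ lam ε ω f) u₀ (M / lam) A) :
    u₀ =ᵐ[volume] UK α Γ K lam f := by
  have hU := hT.isResolvent_UK hl hf
  have hUc := (memDomain_iff Measure.AbsolutelyContinuous.rfl hT.measurable_limitJump).1 hU.1
  have hUb := hU.ae_abs_le Measure.AbsolutelyContinuous.rfl Measure.AbsolutelyContinuous.rfl
    hT.measurable_limitJump hl (hf.1.memLp_of_hasCompactSupport hf.2) hM
  obtain ⟨w, hwm, hwb, hw⟩ :=
    exists_bounded_measurable_modification hUc.aesm (by positivity) hUb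
  have hwi : inc (UK α Γ K lam f) =ᵐ[levyMeasure α Γ K] inc w :=
    jumpMeasure_absolutelyContinuous.ae_le (inc_ae_eq hw)
  have hw2 : MemLp w 2 volume := hUc.memLp.ae_eq hw
  have hwi2 : MemLp (inc w) 2 (levyMeasure α Γ K) := hUc.memLp_inc.ae_eq hwi
  have hu2 := h.memLp_two hT
  have hui2 := h.memLp_inc_limit hT
  -- u₀ solves the limit equation against smooth functions only, which is enough for uniqueness, so
  -- its membership in the domain is not required.
  have hzero : w - u₀ =ᵐ[volume] 0 := by
    refine ae_eq_zero_of_forall_isCcInfty hT.measurableSet_cone hT.measurable_K hT.levy hl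
      (hwm.sub h.measurable) (M := M / lam + M / lam)
      (fun x => (abs_sub _ _).trans (add_le_add (hwb x) (h.limit_le x))) (hw2.sub hu2)
      (by rw [inc_sub]; exact hwi2.sub hui2) fun g hg => ?_
    have hg2 : MemLp g 2 volume := hg.1.continuous.memLp_of_hasCompactSupport hg.2
    have hgi := hg.memLp_inc hT.measurableSet_cone hT.measurable_K hT.levy
    have hlim : lam * (∫ x, u₀ x * g x) + 1 / 2 * ∫ q, inc u₀ q * inc g q ∂levyMeasure α Γ K
        = ∫ x, f x * g x := by
      have t1 := ((hT.tendsto_integral_mul_test h.le h.aesm h.ae_le h.measurable h.limit_le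
        h.tendsto hg.isCc.isTest).const_mul lam).add
        ((h.tendsto_integral_inc hT hg).const_mul (1 / 2))
      refine tendsto_nhds_unique t1 (((hT.tendsto_integral_source hf hg).mono_left h.le).congr' ?_)
      filter_upwards [h.le (hT.eventually_memDomain hg), h.le self_mem_nhdsWithin] with ε h1 hε
      rw [← (hT.isResolvent_Ueps hε hl hf).2 g h1, form_eq (hT.measurable_scaledJump ε)]
    have hres := hU.2 g (hT.memDomain_limit hg)
    rw [form_eq hT.measurable_limitJump,
      integral_mul_congr_left hw, integral_mul_congr_left hwi] at hres
    have e1 : ∫ x, (w - u₀) x * g x = (∫ x, w x * g x) - ∫ x, u₀ x * g x := by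
      rw [← integral_sub (integrable_mul_of_memLp_two hw2 hg2)
        (integrable_mul_of_memLp_two hu2 hg2)]
      exact integral_congr_ae (ae_of_all _ fun x => by simp only [Pi.sub_apply]; ring)
    have e2 : ∫ q, inc (w - u₀) q * inc g q ∂levyMeasure α Γ K =
        ∫ q, inc w q * inc g q ∂levyMeasure α Γ K - ∫ q, inc u₀ q * inc g q ∂levyMeasure α Γ K := by
      rw [← integral_sub (integrable_mul_of_memLp_two hwi2 hgi)
        (integrable_mul_of_memLp_two hui2 hgi), inc_sub]
      exact integral_congr_ae (ae_of_all _ fun q => by simp only [Pi.sub_apply]; ring)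
    rw [e1, e2]
    linarith
  filter_upwards [hzero, hw] with x h1 h2
  rw [h2]
  exact (sub_eq_zero.1 h1).symm

/-- The positive part of |u₀| - M is at most |u₀ - u ε| almost everywhere, so its integral over
every ball vanishes in the limit. -/
theorem ae_abs_le_of_locallyTendsto {u : ℝ → Rd d → ℝ} {u₀ : Rd d → ℝ} {l : Filter ℝ} [l.NeBot]
    (hu0 : AEStronglyMeasurable u₀ volume) (hu : ∀ᶠ ε in l, ∀ᵐ x, |u ε x| ≤ M)
    (h : LocallyTendsto u l u₀) : ∀ᵐ x, |u₀ x| ≤ M := by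
  have hball : ∀ n : ℕ, ∀ᵐ x : Rd d, x ∈ Metric.ball (0 : Rd d) (n + 2) → |u₀ x| ≤ M := by
    intro n
    rw [← ae_restrict_iff' Metric.isOpen_ball.measurableSet]
    have h0 : ∫⁻ x in Metric.ball (0 : Rd d) (n + 2), ENNReal.ofReal (|u₀ x| - M) = 0 := by
      refine le_antisymm (ge_of_tendsto (h (n + 2) (by linarith [n.cast_nonneg (α := ℝ)])) ?_) zero_le
      filter_upwards [hu] with ε hε
      rw [eLpNorm_one_eq_lintegral_enorm]
      refine lintegral_mono_ae ?_
      filter_upwards [ae_restrict_of_ae hε] with x hx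
      rw [Pi.sub_apply, Real.enorm_eq_ofReal_abs]
      refine ENNReal.ofReal_le_ofReal ?_
      have := abs_sub_abs_le_abs_sub (u₀ x) (u ε x)
      rw [abs_sub_comm] at this
      linarith
    rw [lintegral_eq_zero_iff' (by
      exact ((hu0.restrict.norm.aemeasurable).sub_const M).ennreal_ofReal)] at h0
    filter_upwards [h0] with x hx
    have := ENNReal.ofReal_eq_zero.1 hx
    linarith
  filter_upwards [ae_all_iff.2 hball] with x hx
  obtain ⟨n, hn⟩ := exists_nat_gt ‖x‖
  exact hx n (by rw [mem_ball_zero_iff]; linarith)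

/-- Subsequence principle: each sequence tending to zero has a further one along which the
resolvents converge, and the limit, being U^K f, does not depend on the choice. -/
theorem locallyTendsto_UK (hT : TypicalEnvironment τ α Γ μ κ K p ω) (hl : 0 < lam)
    (hf : IsCc f) :
    LocallyTendsto (fun ε => Ueps τ α Γ μ κ lam ε ω f) (𝓝[>] 0) (UK α Γ K lam f) := by
  obtain ⟨M, hM0, hM⟩ := hf.exists_bound
  obtain ⟨A, hA⟩ := hT.exists_boundedConvergence_Ueps hl hf hM
  obtain ⟨C, hC, hCb⟩ := hT.exists_energy_bound hl hf
  have hlimsup : limsup (fun ε : ℝ => eLpNorm (Ueps τ α Γ μ κ lam ε ω f) ∞ volume +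
      energy α Γ (scaledCoeff κ ε ω) (Ueps τ α Γ μ κ lam ε ω f)) (𝓝[>] 0) < ∞ := by
    refine lt_of_le_of_lt (limsup_le_of_le (a := ENNReal.ofReal (M / lam) + ENNReal.ofReal C)
      ⟨0, fun _ _ => zero_le⟩ ?_) (ENNReal.add_lt_top.2 ⟨ENNReal.ofReal_lt_top,
      ENNReal.ofReal_lt_top⟩)
    filter_upwards [Ioc_mem_nhdsGT (zero_lt_one' ℝ)] with ε hε
    refine add_le_add ?_ ?_
    · rw [eLpNorm_exponent_top]
      refine eLpNormEssSup_le_of_ae_enorm_bound ?_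
      filter_upwards [hT.abs_Ueps_le hε.1 hl hf hM] with x hx
      rw [Real.enorm_eq_ofReal_abs]
      exact ENNReal.ofReal_le_ofReal hx
    · have h2 : 0 ≤ ∫ x, Ueps τ α Γ μ κ lam ε ω f x * Ueps τ α Γ μ κ lam ε ω f x
        ∂scaledMeasure τ μ ε ω := integral_nonneg fun x => mul_self_nonneg _
      rw [energy_eq (hT.measurable_scaledJump ε),
        eLpNorm_two_sq_eq_ofReal (hT.formClosure_Ueps hε.1 hl hf).memLp_inc,
        show (2⁻¹ : ℝ≥0∞) = ENNReal.ofReal (1 / 2) by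
          rw [one_div, ENNReal.ofReal_inv_of_pos two_pos]; simp,
        ← ENNReal.ofReal_mul (by norm_num)]
      refine ENNReal.ofReal_le_ofReal ?_
      have := hCb ε hε
      have := mul_nonneg hl.le h2
      linarith
  intro r hr
  refine tendsto_of_subseq_tendsto fun e he => ?_
  -- The first terms are dropped because `HypCompact` asks for sequences inside (0,1].
  obtain ⟨N, hN⟩ := eventually_atTop.1 (he.eventually (Ioc_mem_nhdsGT (zero_lt_one' ℝ)))
  have he0 : Tendsto (fun n => e (n + N)) atTop (𝓝[>] 0) := he.comp (tendsto_add_atTop_nat N)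
  obtain ⟨s, hs, u₀, hu0, hconv⟩ := hT.compact (fun ε => Ueps τ α Γ μ κ lam ε ω f)
    (fun ε hε => (hT.isResolvent_Ueps hε.1 hl hf).1) hlimsup (fun n => e (n + N))
    (fun n => hN _ (Nat.le_add_left _ _)) (he0.mono_right nhdsWithin_le_nhds)
  -- The subsequence is encoded as a filter on ε, so one set of limit statements serves for
  -- subsequences and for the full limit.
  set l : Filter ℝ := map (fun n => e (s n + N)) atTop
  have hle : l ≤ 𝓝[>] 0 := he0.comp hs.tendsto_atTop
  have hloc : LocallyTendsto (fun ε => Ueps τ α Γ μ κ lam ε ω f) l u₀ := fun r hr =>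
    tendsto_map'_iff.2 (hconv r hr)
  have hb : ∀ᵐ x, |u₀ x| ≤ M / lam :=
    ae_abs_le_of_locallyTendsto hu0.aestronglyMeasurable
      (hle (eventually_mem_nhdsWithin.mono fun ε hε => hT.abs_Ueps_le hε hl hf hM)) hloc
  obtain ⟨w, hwm, hwb, hw⟩ :=
    exists_bounded_measurable_modification hu0.aestronglyMeasurable (by positivity) hb
  have hloc' : LocallyTendsto (fun ε => Ueps τ α Γ μ κ lam ε ω f) l w := fun r hr =>
    (hloc r hr).congr fun ε => eLpNorm_congr_ae (ae_restrict_of_ae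
      (hw.mono fun x hx => by simp only [Pi.sub_apply, hx]))
  have hid := hT.ae_eq_UK hl hf hM0 hM (hA l w hle hwm hwb hloc')
  refine ⟨fun n => s n + N, ?_⟩
  refine (hconv r hr).congr fun n => eLpNorm_congr_ae (ae_restrict_of_ae ?_)
  filter_upwards [hw, hid] with x h1 h2
  simp only [Pi.sub_apply, h1, h2]

theorem exists_boundedConvergence_UK (hT : TypicalEnvironment τ α Γ μ κ K p ω) (hl : 0 < lam)
    (hf : IsCc f) : ∃ (w : Rd d → ℝ) (M A : ℝ), UK α Γ K lam f =ᵐ[volume] w ∧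
      BoundedConvergence τ α Γ μ κ ω (𝓝[>] 0) (fun ε => Ueps τ α Γ μ κ lam ε ω f) w M A := by
  obtain ⟨M, hM0, hM⟩ := hf.exists_bound
  obtain ⟨A, hA⟩ := hT.exists_boundedConvergence_Ueps hl hf hM
  have hU := hT.isResolvent_UK hl hf
  have hUb := hU.ae_abs_le Measure.AbsolutelyContinuous.rfl Measure.AbsolutelyContinuous.rfl
    hT.measurable_limitJump hl (hf.1.memLp_of_hasCompactSupport hf.2) hM
  obtain ⟨w, hwm, hwb, hw⟩ := exists_bounded_measurable_modification hU.1.aestronglyMeasurable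
    (by positivity) hUb
  refine ⟨w, M / lam, A, hw, hA _ w le_rfl hwm hwb fun r hr => ?_⟩
  exact (hT.locallyTendsto_UK hl hf r hr).congr fun ε => eLpNorm_congr_ae (ae_restrict_of_ae
    (hw.mono fun x hx => by simp only [Pi.sub_apply, hx]))

theorem tendsto_pairing (hT : TypicalEnvironment τ α Γ μ κ K p ω) (hl : 0 < lam)
    (hf : IsCc f) (hg : IsCc g) :
    Tendsto (fun ε => ∫ x, Ueps τ α Γ μ κ lam ε ω f x * g x ∂scaledMeasure τ μ ε ω)
      (𝓝[>] 0) (𝓝 (∫ x, UK α Γ K lam f x * g x)) := by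
  obtain ⟨w, M, A, hw, h⟩ := hT.exists_boundedConvergence_UK hl hf
  rw [integral_mul_congr_left hw]
  exact hT.tendsto_integral_mul_test h.le h.aesm h.ae_le h.measurable h.limit_le h.tendsto hg.isTest

theorem tendsto_form (hT : TypicalEnvironment τ α Γ μ κ K p ω) (hl : 0 < lam)
    (hf : IsCc f) (hg : IsCcInfty g) :
    Tendsto (fun ε => form α Γ (scaledCoeff κ ε ω) (Ueps τ α Γ μ κ lam ε ω f) g)
      (𝓝[>] 0) (𝓝 (form α Γ (fun x y => K (x - y)) (UK α Γ K lam f) g)) := by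
  obtain ⟨w, M, A, hw, h⟩ := hT.exists_boundedConvergence_UK hl hf
  have hwi : inc (UK α Γ K lam f) =ᵐ[levyMeasure α Γ K] inc w :=
    jumpMeasure_absolutelyContinuous.ae_le (inc_ae_eq hw)
  rw [form_eq hT.measurable_limitJump, integral_mul_congr_left hwi]
  simp only [form_eq (hT.measurable_scaledJump _)]
  exact (h.tendsto_integral_inc hT hg).const_mul (1 / 2)

end TypicalEnvironment

/-- Each moment of μ feeds one almost sure property: E[μ] = 1 gives the averages and a finite
maximal function of μ, and E[μ^p] < ∞ a finite maximal function of μ^p. -/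
theorem ae_typicalEnvironment (hd : 1 ≤ d) [MeasurableSpace Ω] {P : Measure Ω}
    [IsProbabilityMeasure P] (hτ : IsStationaryErgodic P τ) (hα : α ∈ Ioo (0 : ℝ) 2)
    (hΓ : IsSymmCone Γ) (hE : IsEnvironment P τ α μ κ) (hH : AssumptionH P τ α Γ μ κ K)
    (hp : 1 < p) (hμp : ∫⁻ ω, (μ ω : ℝ≥0∞) ^ p ∂P < ∞) :
    ∀ᵐ ω ∂P, TypicalEnvironment τ α Γ μ κ K p ω := by
  obtain ⟨C₁, C₂, -, hC⟩ := hH.bounds_K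
  have hμ' : Measurable fun ω => (μ ω : ℝ≥0∞) := hE.measurable_mu.coe_nnreal_ennreal
  have hmax1 := hτ.ae_maximalFlow_lt_top hμ' (by rw [hE.mean_mu]; exact ENNReal.one_lt_top)
  have hmax2 := hτ.ae_maximalFlow_lt_top (hμ'.pow_const p) hμp
  have hint : Integrable (fun ω => (μ ω : ℝ)) P := by
    refine ⟨hE.measurable_mu.coe_nnreal_real.aestronglyMeasurable, ?_⟩
    simp [HasFiniteIntegral, Real.enorm_of_nonneg, hE.mean_mu]
  have hone : ∫ ω, (μ ω : ℝ) ∂P = 1 := by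
    rw [integral_eq_lintegral_of_nonneg_ae (ae_of_all _ fun ω => NNReal.coe_nonneg _) hint.1]
    simp [hE.mean_mu]
  have havg := hτ.ae_averagesTo hE.measurable_mu.coe_nnreal_real hint fun ω => NNReal.coe_nonneg _
  rw [hone] at havg
  filter_upwards [hmax1, hmax2, havg, hH.compact, hH.jumps, hH.moment, hH.forms]
    with ω h1 h2 h3 h4 h5 h6 h7
  exact
    { alpha_pos := hα.1
      measurableSet_cone := hΓ.isOpen.measurableSet
      measurable_mu := hτ.measurable_orbit hE.measurable_mu ω
      mu_pos := hE.mu_pos ω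
      measurable_kappa := hE.measurable_kappa.comp
        (measurable_fst.prodMk (measurable_snd.prodMk measurable_const))
      symm := fun x y => hE.symm x y ω
      averages := h3
      maximal := h1
      one_lt := hp
      maximal_rpow := h2
      measurable_K := hH.measurable_K
      levy := levyMass_lt_top hd hα hΓ.isOpen.measurableSet hH.measurable_K fun z => (hC z).2
      compact := h4
      jumps := h5
      moment := h6
      forms := h7 }

end

end

end StableHomog

open StableHomog in
/-- For almost every `ω`, all `lam > 0` and all `f ∈ C_c`: the resolvents are well defined (they
solve their variational equations, uniquely up to null sets), `U^ε f → U^K f` in `L¹(B(0,r))`,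
and the pairings and energies against test functions converge. -/
theorem theorem2p2 {d : ℕ} (hd : 1 ≤ d) {Ω : Type*} [MeasurableSpace Ω]
    (P : Measure Ω) [IsProbabilityMeasure P]
    (τ : Rd d → Ω → Ω) (hτ : IsStationaryErgodic P τ)
    (α : ℝ) (hα : α ∈ Ioo (0 : ℝ) 2)
    (Γ : Set (Rd d)) (hΓ : IsSymmCone Γ)
    (μ : Ω → ℝ≥0) (κ : Rd d → Rd d → Ω → ℝ≥0) (hE : IsEnvironment P τ α μ κ)
    (K : Rd d → ℝ≥0) (hH : AssumptionH P τ α Γ μ κ K)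
    (p : ℝ) (hp : 1 < p) (hμp : ∫⁻ ω, (μ ω : ℝ≥0∞) ^ p ∂P < ∞) :
    ∀ᵐ ω ∂P, ∀ lam : ℝ, 0 < lam → ∀ f : Rd d → ℝ, IsCc f →
      ((∀ ε : ℝ, 0 < ε →
          IsResolvent α Γ (scaledCoeff κ ε ω) (scaledMeasure τ μ ε ω) lam f
            (Ueps τ α Γ μ κ lam ε ω f) ∧
          ∀ u : Rd d → ℝ,
            IsResolvent α Γ (scaledCoeff κ ε ω) (scaledMeasure τ μ ε ω) lam f u →
              u =ᵐ[volume] Ueps τ α Γ μ κ lam ε ω f) ∧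
        IsResolvent α Γ (fun x y => K (x - y)) volume lam f (UK α Γ K lam f) ∧
        ∀ u : Rd d → ℝ, IsResolvent α Γ (fun x y => K (x - y)) volume lam f u →
          u =ᵐ[volume] UK α Γ K lam f) ∧
      (∀ r : ℝ, 1 < r →
        Tendsto (fun ε : ℝ => eLpNorm (Ueps τ α Γ μ κ lam ε ω f - UK α Γ K lam f) 1
          (volume.restrict (Metric.ball 0 r))) (𝓝[>] 0) (𝓝 0)) ∧
      (∀ g : Rd d → ℝ, IsCc g →
        Tendsto (fun ε : ℝ => ∫ x, Ueps τ α Γ μ κ lam ε ω f x * g x ∂(scaledMeasure τ μ ε ω))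
          (𝓝[>] 0) (𝓝 (∫ x, UK α Γ K lam f x * g x))) ∧
      (∀ g : Rd d → ℝ, IsCcInfty g →
        Tendsto (fun ε : ℝ => form α Γ (scaledCoeff κ ε ω) (Ueps τ α Γ μ κ lam ε ω f) g)
          (𝓝[>] 0) (𝓝 (form α Γ (fun x y => K (x - y)) (UK α Γ K lam f) g))) := by
  filter_upwards [ae_typicalEnvironment hd hτ hα hΓ hE hH hp hμp] with ω hT lam hl f hf
  have hU := hT.isResolvent_UK hl hf
  refine ⟨⟨fun ε hε => ⟨hT.isResolvent_Ueps hε hl hf, fun u hu => ?_⟩, hU, fun u hu => ?_⟩,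
    hT.locallyTendsto_UK hl hf, fun g hg => hT.tendsto_pairing hl hf hg,
    fun g hg => hT.tendsto_form hl hf hg⟩
  · exact IsResolvent.ae_unique TypicalEnvironment.scaledMeasure_ac (hT.ac_scaledMeasure hε)
      (hT.measurable_scaledJump ε) hl hu (hT.isResolvent_Ueps hε hl hf)
  · exact IsResolvent.ae_unique Measure.AbsolutelyContinuous.rfl Measure.AbsolutelyContinuous.rfl
      hT.measurable_limitJump hl hu hU
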